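/- Conventions. A hypersurface germ $(X,0)\subset(\mathbb{C}^{n+1},0)$ is the germ at $0$ of the zero set of a holomorphic function germ $F\not\equiv 0$ with $F(0)=0$; an analytic set germ is reducible if it is the union of two analytic set germs both different from it, and irreducible otherwise. A linear projection is a surjective linear map $\pi:\mathbb{C}^{n+1}\to\mathbb{C}^n$; it is finite on $(X,0)$ if $0$ is an isolated point of $\pi^{-1}(0)\cap X$. Let $\alpha:\mathbb{D}\to\mathbb{C}^n$ be a holomorphic map on a neighbourhood of a closed disk $\mathbb{D}$ centred at $0$, injective on $\mathbb{D}$, with $\alpha(0)=0$. The corresponding arc-section of $(X,0)$ along $\pi$ is the germ at $0$ of $\pi^{-1}(\alpha(\mathbb{D}))\cap X$ (with its reduced structure). If $F=f+(\text{terms of order}>d)$ with $f\neq 0$ homogeneous of degree $d$, the tangent cone of $\{F=0\}$ is the projective hypersurface $\{f=0\}$. A plane quartic has a hyperflex if some line meets it at some point with multiplicity at least $4$. Proposition. 1. There exist irreducible hypersurface germs $(X,0)$, already in $(\mathbb{C}^3,0)$, such that for every linear projection $\pi$ that is finite on $(X,0)$ all arc-sections of $(X,0)$ along $\pi$ are reducible.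 Moreover, for every biholomorphic map germ $\varphi:(\mathbb{C}^3,0)\to(\mathbb{C}^3,0)$, the germ $(\varphi(X),0)$ is again an irreducible hypersurface germ with this property. 2. Every surface germ $(X,0)=\{F=0\}\subset(\mathbb{C}^3,0)$ whose tangent cone is a smooth plane quartic without hyperflexes (that is, $F$ has order $4$ and its initial form defines such a quartic) is irreducible and has all the properties in 1. 3. The quartic $x^4+y^4+x^2z^2+yz^3+z^4=0$ in $\mathbb{CP}^2$ is smooth without hyperflexes, and the surface germ at $0\in\mathbb{C}^3$ defined by the same equation is irreducible and has all the properties in 1. -/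

import Mathlib

open Filter Topology Asymptotics

/-! Set germs are represented by sets, and equality of germs at `p` is `A =ᶠ[𝓝 p] B`. -/

section Germs

variable {E : Type*} [NormedAddCommGroup E] [NormedSpace ℂ E]

/-- The germ of `A` at `p` is a complex analytic set germ: near `p`, the set `A` is the common
zero locus of finitely many functions that are holomorphic at `p`. -/
def IsAnalyticGermAt (A : Set E) (p : E) : Prop :=
  ∃ (k : ℕ) (f : Fin k → E → ℂ), (∀ i, AnalyticAt ℂ (f i) p) ∧
    A =ᶠ[𝓝 p] {x | ∀ i, f i x = 0}

/-- The germ of `A` at `p` is reducible: it is the union of two analytic germs, both different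
from it. -/
def IsReducibleGermAt (A : Set E) (p : E) : Prop :=
  ∃ B C : Set E, IsAnalyticGermAt B p ∧ IsAnalyticGermAt C p ∧
    A =ᶠ[𝓝 p] (B ∪ C : Set E) ∧ ¬ (B =ᶠ[𝓝 p] A) ∧ ¬ (C =ᶠ[𝓝 p] A)

/-- The germ of `A` at `p` is an irreducible analytic germ. -/
def IsIrreducibleGermAt (A : Set E) (p : E) : Prop :=
  IsAnalyticGermAt A p ∧ p ∈ A ∧ ¬ IsReducibleGermAt A p

/-- `(X, 0)` is a hypersurface germ: near `0` it is the zero set of one holomorphic function that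
vanishes at `0` and is not identically zero near `0`. -/
def IsHypersurfaceGerm (X : Set E) : Prop :=
  ∃ F : E → ℂ, AnalyticAt ℂ F 0 ∧ F 0 = 0 ∧ ¬ (∀ᶠ x in 𝓝 0, F x = 0) ∧
    X =ᶠ[𝓝 0] {x | F x = 0}

/-- `φ` represents an analytic change of coordinates (a biholomorphic map germ)
`(E, 0) → (E, 0)`. -/
def IsAnalyticCoordChange (φ : OpenPartialHomeomorph E E) : Prop :=
  (0 : E) ∈ φ.source ∧ φ 0 = 0 ∧ AnalyticAt ℂ φ 0 ∧ AnalyticAt ℂ φ.symm 0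

/-- The image of (the germ of) `X` under the change of coordinates `φ`. -/
def coordImage (φ : OpenPartialHomeomorph E E) (X : Set E) : Set E :=
  φ '' (φ.source ∩ X)

end Germs

section ArcSections

variable {n : ℕ}

/-- `π` is a linear projection `ℂⁿ⁺¹ → ℂⁿ` whose restriction to the germ `(X, 0)` is finite, that
is, `0` is an isolated point of `π⁻¹(0) ∩ X`. -/
def IsFiniteProjection (X : Set (Fin (n + 1) → ℂ))
    (π : (Fin (n + 1) → ℂ) →ₗ[ℂ] (Fin n → ℂ)) : Prop :=
  Function.Surjective π ∧ ∀ᶠ x in 𝓝 (0 : Fin (n + 1) → ℂ), x ∈ X → π x = 0 → x = 0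

/-- `α`, restricted to the closed disk of radius `r` about `0`, is an injective representative of
an arc in `(ℂⁿ, 0)`. -/
def IsInjectiveArc (α : ℂ → (Fin n → ℂ)) (r : ℝ) : Prop :=
  0 < r ∧ AnalyticOnNhd ℂ α (Metric.closedBall 0 r) ∧
    Set.InjOn α (Metric.closedBall 0 r) ∧ α 0 = 0

/-- The arc-section `π⁻¹(α(𝔻)) ∩ X`, where `𝔻` is the closed disk of radius `r` about `0`. -/
def arcSection (X : Set (Fin (n + 1) → ℂ)) (π : (Fin (n + 1) → ℂ) →ₗ[ℂ] (Fin n → ℂ))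
    (α : ℂ → (Fin n → ℂ)) (r : ℝ) : Set (Fin (n + 1) → ℂ) :=
  π ⁻¹' (α '' Metric.closedBall 0 r) ∩ X

/-- All arc-sections of `(X, 0)`, along all finite linear projections, are reducible (with their
reduced structure). -/
def AllArcSectionsReducible (X : Set (Fin (n + 1) → ℂ)) : Prop :=
  ∀ π : (Fin (n + 1) → ℂ) →ₗ[ℂ] (Fin n → ℂ), IsFiniteProjection X π →
    ∀ (α : ℂ → (Fin n → ℂ)) (r : ℝ), IsInjectiveArc α r →
      IsReducibleGermAt (arcSection X π α r) 0

/-- `(X, 0)` is an irreducible hypersurface germ in `(ℂⁿ⁺¹, 0)` all of whose arc-sections are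
reducible. -/
def IsIrreducibleWithReducibleArcSections (X : Set (Fin (n + 1) → ℂ)) : Prop :=
  IsHypersurfaceGerm X ∧ IsIrreducibleGermAt X 0 ∧ AllArcSectionsReducible X

end ArcSections

section TangentCone

/-- The nonzero homogeneous polynomial `f` of degree `d` is the initial form at `0` of the
holomorphic germ `F`; the tangent cone of the germ `F = 0` is then given by `f = 0`. -/
def HasInitialForm {m : ℕ} (F : (Fin m → ℂ) → ℂ) (d : ℕ) (f : MvPolynomial (Fin m) ℂ) : Prop :=
  AnalyticAt ℂ F 0 ∧ f.IsHomogeneous d ∧ f ≠ 0 ∧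
    (fun x => F x - MvPolynomial.eval x f) =O[𝓝 0] (fun x => ‖x‖ ^ (d + 1))

/-- `f = 0` is a smooth plane quartic in `ℂℙ²`. -/
def IsSmoothPlaneQuartic (f : MvPolynomial (Fin 3) ℂ) : Prop :=
  f.IsHomogeneous 4 ∧ f ≠ 0 ∧
    ∀ x : Fin 3 → ℂ, x ≠ 0 → MvPolynomial.eval x f = 0 →
      ∃ i, MvPolynomial.eval x (MvPolynomial.pderiv i f) ≠ 0

/-- The plane curve `f = 0` has a hyperflex: for some point `[p]` and some line through `[p]`
(joining it to `[q]`), the line meets the curve at `[p]` with multiplicity at least four. -/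
def HasHyperflex (f : MvPolynomial (Fin 3) ℂ) : Prop :=
  ∃ p q : Fin 3 → ℂ, LinearIndependent ℂ ![p, q] ∧
    (Polynomial.X : Polynomial ℂ) ^ 4 ∣
      MvPolynomial.aeval (fun i => Polynomial.C (p i) + Polynomial.C (q i) * Polynomial.X) f

/-- The polynomial `x⁴ + y⁴ + x²z² + yz³ + z⁴`. -/
noncomputable def exampleQuartic : MvPolynomial (Fin 3) ℂ :=
  MvPolynomial.X 0 ^ 4 + MvPolynomial.X 1 ^ 4 + MvPolynomial.X 0 ^ 2 * MvPolynomial.X 2 ^ 2 +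
    MvPolynomial.X 1 * MvPolynomial.X 2 ^ 3 + MvPolynomial.X 2 ^ 4

end TangentCone

/-! ### Taylor expansion along lines through the origin -/

section Taylor

variable {m : ℕ}

/-! Reducibility of arc-sections. Let `v` span the kernel of the projection, let `ι` be a linear
section of it, and write the arc as `α t = t ^ k • a t` with `a 0 ≠ 0`. The arc-section consists of
the points `ι (α t) + s • v` with `G (t, s) = F (ι (α t) + s • v) = 0`. Substituting `s = t ^ k * σ`
gives `G = t ^ (4 * k) * K (t, σ)`, where `K (0, ·)` is the quartic `f` restricted to the affine
line through `ι (a 0)` in direction `v`. Absence of hyperflexes forces this restriction to have a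
root `σ₀`, and its order there is less than four. On the other hand `G (0, s) = F (s • v)` has order
at least four in `s`, and finite order because the projection is finite. So, for small `t ≠ 0`, the
zeros `s` with `s / t ^ k` near `σ₀` form a nonempty proper part of all small zeros. This part does
not mix with its complement as `t` circles `0`, so the two parts sweep out two analytic curves. The
direction `v` may lie on the tangent cone: the extra zeros then have `s / t ^ k` unbounded and fall
into the complement. The splitting is `exists_splitting`, and analyticity of the curves is
`isAnalyticGermAt_curve`. The latter rests on the residue formula (power sums over zeros are
analytic in the parameter), on Newton's identities, and on enough linear forms to separate finitely
many points. The conclusion is `isReducibleGermAt_arcSection`.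

Irreducibility of the surface. The smooth quartic `f` is prime, since two nonconstant factors would
vanish together at a nonzero, hence singular, point (`IsSmoothPlaneQuartic.prime`). Suppose `b * c`
vanishes on `F = 0` and neither factor does. Subtracting polynomial multiples of `F`, both factors
acquire initial forms not divisible by `f` (`exists_leading_not_dvd`); if this were impossible, the
factor would be flat along arcs covering `F = 0` and would vanish there
(`eventually_eq_zero_of_flat`). Through each direction of the cone passes an arc in `F = 0`, so the
product of the initial forms vanishes on `f = 0`. By the Nullstellensatz `f` divides this product,
contradicting primality (`eventually_eq_zero_or`).

Coordinate changes compose the initial form with an invertible linear map, which preserves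
smoothness and absence of hyperflexes (`HasInitialForm.comp`). For the explicit quartic, a hyperflex
would make its restriction to some line a constant times a fourth power of a linear form, and
comparing coefficients excludes this. -/

/-- Hadamard's lemma: the power series shifted by one index is an analytic family of linear forms,
and `g i` is its value on the `i`-th basis vector. -/
theorem AnalyticAt.exists_eq_add_sum_mul {h : (Fin m → ℂ) → ℂ} (hh : AnalyticAt ℂ h 0) :
    ∃ g : Fin m → (Fin m → ℂ) → ℂ, (∀ i, AnalyticAt ℂ (g i) 0) ∧
      ∀ᶠ x in 𝓝 0, h x = h 0 + ∑ i, x i * g i x := by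
  obtain ⟨p, r, hp⟩ := hh
  have hr : 0 < p.shift.radius := by
    rw [FormalMultilinearSeries.radius_shift]; exact hp.r_pos.trans_le hp.r_le
  have hL := p.shift.hasFPowerSeriesOnBall hr
  have hU := (hL.unshift (z := h 0)).hasFPowerSeriesAt
  have hpe : p.shift.unshift (h 0) = p := by
    rw [← hp.coeff_zero 0]
    have : p 0 0 = (continuousMultilinearCurryFin0 ℂ (Fin m → ℂ) ℂ) (p 0) := rfl
    rw [this]
    funext n
    cases n with
    | zero => simp [FormalMultilinearSeries.unshift]
    | succ n =>
      exact (continuousMultilinearCurryRightEquiv' ℂ n (Fin m → ℂ) ℂ).symm_apply_apply (p (n + 1))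
  rw [hpe] at hU
  refine ⟨fun i x => p.shift.sum x (Pi.single i 1), fun i => ?_, ?_⟩
  · exact ((ContinuousLinearMap.apply ℂ ℂ (Pi.single i (1 : ℂ) : Fin m → ℂ)).analyticAt _).comp
      (f := p.shift.sum) hL.analyticAt
  · filter_upwards [hU.eventually_hasSum_sub, hp.hasFPowerSeriesAt.eventually_hasSum_sub]
      with x h1 h2
    have h3 := h2.unique h1
    rw [h3, sub_zero]
    congr 1
    have hs : ∀ L : (Fin m → ℂ) →L[ℂ] ℂ, L x = ∑ i, L (Pi.single i (x i)) := fun L => by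
      rw [← map_sum, Finset.univ_sum_single]
    rw [hs]
    refine Finset.sum_congr rfl fun i _ => ?_
    have : (Pi.single i (x i) : Fin m → ℂ) = x i • Pi.single i (1 : ℂ) := by
      rw [← Pi.single_smul]; simp
    rw [this, map_smul, smul_eq_mul]

/-- A Taylor expansion along all lines through the origin, with analytic remainder. -/
theorem AnalyticAt.exists_taylor (n : ℕ) : ∀ {h : (Fin m → ℂ) → ℂ}, AnalyticAt ℂ h 0 →
    ∃ (Q : ℕ → MvPolynomial (Fin m) ℂ) (Θ : ℂ × (Fin m → ℂ) → ℂ),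
      (∀ j, (Q j).IsHomogeneous j) ∧ (∀ w, AnalyticAt ℂ Θ (0, w)) ∧
      ∀ᶠ x in 𝓝 0, ∀ (τ : ℂ) (w : Fin m → ℂ), τ • w = x →
        h x = ∑ j ∈ Finset.range n, τ ^ j * MvPolynomial.eval w (Q j) + τ ^ n * Θ (τ, w) := by
  induction n with
  | zero =>
    intro h hh
    refine ⟨0, fun p => h (p.1 • p.2), fun j => MvPolynomial.isHomogeneous_zero _ _ _, fun w => ?_,
      .of_forall ?_⟩
    · refine AnalyticAt.comp (by simpa using hh) ?_
      exact analyticAt_fst.smul analyticAt_snd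
    · rintro _ τ w rfl
      simp
  | succ n ih =>
    intro h hh
    obtain ⟨g, hg, hgeq⟩ := hh.exists_eq_add_sum_mul
    choose Q Θ hQ hΘ heq using fun i => ih (hg i)
    refine ⟨fun j => Nat.casesOn j (MvPolynomial.C (h 0))
      (fun j => ∑ i, MvPolynomial.X i * Q i j), fun p => ∑ i, p.2 i * Θ i p, ?_, ?_, ?_⟩
    · rintro (_ | j)
      · exact MvPolynomial.isHomogeneous_C _ _
      · refine MvPolynomial.IsHomogeneous.sum _ _ _ fun i _ => ?_
        rw [add_comm]
        exact (MvPolynomial.isHomogeneous_X _ _).mul (hQ i j)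
    · intro w
      refine Finset.analyticAt_fun_sum _ fun i _ => ?_
      refine AnalyticAt.fun_mul ?_ (hΘ i w)
      exact ((ContinuousLinearMap.proj (R := ℂ) (φ := fun _ : Fin m => ℂ) i).comp
        (ContinuousLinearMap.snd ℂ ℂ (Fin m → ℂ))).analyticAt _
    · filter_upwards [hgeq, eventually_all.2 heq] with x hx hx' τ w hτ
      rw [hx, Finset.sum_range_succ']
      have : ∀ i, x i * g i x = ∑ j ∈ Finset.range n,
          τ ^ (j + 1) * (w i * MvPolynomial.eval w (Q i j)) + τ ^ (n + 1) * (w i * Θ i (τ, w)) := by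
        intro i
        rw [hx' i τ w hτ, ← hτ, mul_add, Finset.mul_sum]
        simp only [Pi.smul_apply, smul_eq_mul]
        congr 1
        · exact Finset.sum_congr rfl fun j _ => by ring
        · ring
      simp only [this, Finset.sum_add_distrib]
      rw [Finset.sum_comm]
      simp only [map_sum, map_mul, MvPolynomial.eval_X, Finset.mul_sum]
      simp
      ring

theorem AnalyticAt.eventually_smul {P : (Fin m → ℂ) → Prop} (h : ∀ᶠ x in 𝓝 0, P x)
    (w : Fin m → ℂ) : ∀ᶠ p : ℂ × (Fin m → ℂ) in 𝓝 (0, w), P (p.1 • p.2) := by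
  have : Tendsto (fun p : ℂ × (Fin m → ℂ) => p.1 • p.2) (𝓝 (0, w)) (𝓝 0) := by
    have : Continuous (fun p : ℂ × (Fin m → ℂ) => p.1 • p.2) := by fun_prop
    simpa using this.tendsto (0, w)
  exact this.eventually h

theorem isBigO_smul_line {h : (Fin m → ℂ) → ℂ} {n : ℕ} (hO : h =O[𝓝 0] fun x => ‖x‖ ^ n)
    (w : Fin m → ℂ) : (fun τ : ℂ => h (τ • w)) =O[𝓝 0] fun τ => τ ^ n := by
  have ht : Tendsto (fun τ : ℂ => τ • w) (𝓝 0) (𝓝 0) := by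
    have : Continuous (fun τ : ℂ => τ • w) := by fun_prop
    simpa using this.tendsto 0
  refine (hO.comp_tendsto ht).trans ?_
  refine IsBigO.of_bound (‖w‖ ^ n) (.of_forall fun τ => ?_)
  simp [norm_smul, mul_pow, mul_comm]

/-- Strong induction: once the coefficients below `j` vanish, divide by `τ ^ j` and let `τ → 0`. The
left side tends to `c j`, the bound to `0` since `j < n`. -/
theorem sum_pow_mul_eq_zero_of_isBigO {n : ℕ} {c : ℕ → ℂ} {R : ℂ → ℂ} (hR : ContinuousAt R 0)
    (h : (fun τ : ℂ => ∑ j ∈ Finset.range n, τ ^ j * c j + τ ^ n * R τ) =O[𝓝 0] fun τ => τ ^ n) :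
    ∀ j < n, c j = 0 := by
  intro j
  induction j using Nat.strong_induction_on with
  | _ j ih =>
    intro hj
    have h1 : (fun τ : ℂ => τ ^ j * (∑ i ∈ Finset.range (n - j), τ ^ i * c (j + i) +
        τ ^ (n - j) * R τ)) =O[𝓝 0] fun τ => τ ^ j * τ ^ (n - j) := by
      refine (h.congr' ?_ ?_)
      · refine .of_forall fun τ => ?_
        have : ∑ i ∈ Finset.range n, τ ^ i * c i =
            ∑ i ∈ Finset.range (n - j), τ ^ (j + i) * c (j + i) := by
          conv_lhs => rw [show n = j + (n - j) by omega, Finset.sum_range_add]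
          rw [Finset.sum_eq_zero, zero_add]
          intro i hi
          rw [Finset.mem_range] at hi
          rw [ih i hi (by omega), mul_zero]
        simp only [this]
        rw [mul_add, Finset.mul_sum, ← mul_assoc, ← pow_add, Nat.add_sub_cancel' hj.le]
        simp only [pow_add, mul_assoc]
      · exact .of_forall fun τ => by simp only [← pow_add, Nat.add_sub_cancel' hj.le]
    obtain ⟨C, hC⟩ := h1.bound
    have h2 : ∀ᶠ τ in 𝓝[≠] (0 : ℂ), ‖∑ i ∈ Finset.range (n - j), τ ^ i * c (j + i) +
        τ ^ (n - j) * R τ‖ ≤ C * ‖τ ^ (n - j)‖ := by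
      filter_upwards [hC.filter_mono nhdsWithin_le_nhds, self_mem_nhdsWithin] with τ hτ hτ0
      rw [norm_mul, norm_mul, mul_left_comm] at hτ
      exact le_of_mul_le_mul_left hτ (norm_pos_iff.2 (pow_ne_zero _ hτ0))
    have hc1 : ContinuousAt (fun τ : ℂ => ‖∑ i ∈ Finset.range (n - j), τ ^ i * c (j + i) +
        τ ^ (n - j) * R τ‖) 0 := by fun_prop
    have hc2 : ContinuousAt (fun τ : ℂ => C * ‖τ ^ (n - j)‖) 0 := by fun_prop
    have h3 := le_of_tendsto_of_tendsto (hc1.tendsto.mono_left nhdsWithin_le_nhds)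
      (hc2.tendsto.mono_left nhdsWithin_le_nhds) h2
    obtain ⟨l, hl⟩ : ∃ l, n - j = l + 1 := ⟨n - j - 1, by omega⟩
    rw [hl, Finset.sum_range_succ'] at h3
    simpa using h3

theorem exists_eventually_bound {A B : Type*} [TopologicalSpace A] [TopologicalSpace B]
    {Θ : A × B → ℂ} {a : A} {K : Set B} (hK : IsCompact K)
    (h : ∀ w ∈ K, ContinuousAt Θ (a, w)) : ∃ C : ℝ, ∀ᶠ τ in 𝓝 a, ∀ w ∈ K, ‖Θ (τ, w)‖ ≤ C := by
  refine hK.induction_on (p := fun s => ∃ C : ℝ, ∀ᶠ τ in 𝓝 a, ∀ w ∈ s, ‖Θ (τ, w)‖ ≤ C) ⟨0, by simp⟩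
    ?_ ?_ ?_
  · rintro s t hst ⟨C, hC⟩
    exact ⟨C, hC.mono fun τ hτ w hw => hτ w (hst hw)⟩
  · rintro s t ⟨C, hC⟩ ⟨D, hD⟩
    refine ⟨max C D, ?_⟩
    filter_upwards [hC, hD] with τ h1 h2 w hw
    exact hw.elim (fun hw => (h1 w hw).trans (le_max_left _ _))
      fun hw => (h2 w hw).trans (le_max_right _ _)
  · intro w hw
    have h1 : ∀ᶠ p in 𝓝 (a, w), ‖Θ p‖ ≤ ‖Θ (a, w)‖ + 1 :=
      (h w hw).norm.eventually_le_const (by simp)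
    rw [nhds_prod_eq] at h1
    obtain ⟨pa, hpa, pb, hpb, hab⟩ := eventually_prod_iff.1 h1
    exact ⟨{w | pb w}, mem_nhdsWithin_of_mem_nhds hpb, _, hpa.mono fun τ hτ w hw => hab hτ hw⟩

theorem eval_smul_of_isHomogeneous {Q : MvPolynomial (Fin m) ℂ} {n : ℕ} (hQ : Q.IsHomogeneous n)
    (c : ℂ) (w : Fin m → ℂ) :
    MvPolynomial.eval (c • w) Q = c ^ n * MvPolynomial.eval w Q := by
  rw [MvPolynomial.eval_eq', MvPolynomial.eval_eq', Finset.mul_sum]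
  refine Finset.sum_congr rfl fun d hd => ?_
  have h1 : ∑ i, d i = n := by
    have := hQ (MvPolynomial.mem_support_iff.1 hd)
    rw [← this, Finsupp.weight_apply, Finsupp.sum_fintype _ _ (by simp)]
    simp
  simp only [Pi.smul_apply, smul_eq_mul, mul_pow, Finset.prod_mul_distrib,
    Finset.prod_pow_eq_pow_sum, h1]
  ring

/-- The initial form of a germ that vanishes to order `n`. -/
theorem AnalyticAt.exists_leading {h : (Fin m → ℂ) → ℂ} (hh : AnalyticAt ℂ h 0) {n : ℕ}
    (hO : h =O[𝓝 0] fun x => ‖x‖ ^ n) :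
    ∃ (Q : MvPolynomial (Fin m) ℂ) (Θ : ℂ × (Fin m → ℂ) → ℂ),
      Q.IsHomogeneous n ∧ (∀ w, AnalyticAt ℂ Θ (0, w)) ∧ (∀ w, Θ (0, w) = MvPolynomial.eval w Q) ∧
      (∀ᶠ x in 𝓝 0, ∀ (τ : ℂ) (w : Fin m → ℂ), τ • w = x → h x = τ ^ n * Θ (τ, w)) ∧
      (fun x => h x - MvPolynomial.eval x Q) =O[𝓝 0] fun x => ‖x‖ ^ (n + 1) := by
  obtain ⟨Q, Θ, hQ, hΘ, heq⟩ := hh.exists_taylor (n + 1)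
  have hz : ∀ j < n, ∀ w, MvPolynomial.eval w (Q j) = 0 := by
    intro j hj w
    have h1 : ContinuousAt (fun τ : ℂ => MvPolynomial.eval w (Q n) + τ * Θ (τ, w)) 0 := by
      have : ContinuousAt (fun τ : ℂ => Θ (τ, w)) 0 :=
        ContinuousAt.comp (f := fun τ : ℂ => (τ, w)) (hΘ w).continuousAt (by fun_prop)
      fun_prop
    refine sum_pow_mul_eq_zero_of_isBigO h1 (c := fun j => MvPolynomial.eval w (Q j)) ?_ j hj
    refine (isBigO_smul_line hO w).congr' ?_ (.refl _ _)
    have : ∀ᶠ τ : ℂ in 𝓝 0, ∀ τ' w', τ' • w' = τ • w → h (τ • w) = _ :=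
      (by have : Continuous (fun τ : ℂ => τ • w) := by fun_prop
          simpa using this.tendsto 0 : Tendsto (fun τ : ℂ => τ • w) (𝓝 0) (𝓝 0)).eventually heq
    filter_upwards [this] with τ hτ
    rw [hτ τ w rfl, Finset.sum_range_succ]
    ring
  have hexp : ∀ᶠ x in 𝓝 0, ∀ (τ : ℂ) (w : Fin m → ℂ), τ • w = x →
      h x = τ ^ n * (MvPolynomial.eval w (Q n) + τ * Θ (τ, w)) := by
    filter_upwards [heq] with x hx τ w hτ
    rw [hx τ w hτ, Finset.sum_range_succ, Finset.sum_eq_zero fun j hj => by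
      rw [hz j (Finset.mem_range.1 hj) w, mul_zero]]
    ring
  refine ⟨Q n, fun p => MvPolynomial.eval p.2 (Q n) + p.1 * Θ p, hQ n, fun w => ?_, by simp, hexp,
    ?_⟩
  · refine AnalyticAt.fun_add ?_ (analyticAt_fst.fun_mul (hΘ w))
    exact (AnalyticOnNhd.eval_mvPolynomial (Q n) _ (Set.mem_univ _)).comp analyticAt_snd
  -- Every `x ≠ 0` is `τ • w` with `τ = ‖x‖` and `w` on the unit sphere, where `Θ` is bounded
  -- uniformly for small `τ`.
  · obtain ⟨C, hC⟩ := exists_eventually_bound (isCompact_sphere (0 : Fin m → ℂ) 1)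
      fun w _ => (hΘ w).continuousAt
    refine IsBigO.of_bound C ?_
    have ht : Tendsto (fun x : Fin m → ℂ => ((‖x‖ : ℝ) : ℂ)) (𝓝 0) (𝓝 0) := by
      have : Continuous (fun x : Fin m → ℂ => ((‖x‖ : ℝ) : ℂ)) := by fun_prop
      simpa using this.tendsto 0
    filter_upwards [hexp, ht.eventually hC] with x hx hCx
    rcases eq_or_ne x 0 with rfl | hx0
    · have h0 := hx 0 0 (by simp)
      rcases n with _ | n
      · simp [h0]
      · have : MvPolynomial.eval (0 : Fin m → ℂ) (Q (n + 1)) = 0 := by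
          have := eval_smul_of_isHomogeneous (hQ (n + 1)) 0 0
          rwa [zero_smul, zero_pow (by omega), zero_mul] at this
        rw [h0, this]
        simp
    · have hn : (‖x‖ : ℂ) ≠ 0 := by simpa using hx0
      set w : Fin m → ℂ := (‖x‖ : ℂ)⁻¹ • x with hw
      have hxw : (‖x‖ : ℂ) • w = x := by rw [hw, smul_smul, mul_inv_cancel₀ hn, one_smul]
      have hws : w ∈ Metric.sphere (0 : Fin m → ℂ) 1 := by
        simp [hw, norm_smul, hx0]
      have h1 : MvPolynomial.eval x (Q n) = (‖x‖ : ℂ) ^ n * MvPolynomial.eval w (Q n) := by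
        conv_lhs => rw [← hxw]
        exact eval_smul_of_isHomogeneous (hQ n) _ _
      rw [hx _ w hxw, h1, mul_add, add_sub_cancel_left, ← mul_assoc, ← pow_succ, norm_mul,
        mul_comm]
      simp only [norm_pow, Complex.norm_real, norm_norm]
      gcongr
      exact hCx w hws

end Taylor

/-! ### Zeros in a disk and the residue formula -/

section Zeros

/-- `S` is the multiset of zeros of `φ` in the open disk of radius `R` about `c`, and `φ` has no
zero on its boundary. -/
def IsZeroMultiset (φ : ℂ → ℂ) (c : ℂ) (R : ℝ) (S : Multiset ℂ) : Prop :=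
  (∀ a ∈ S, a ∈ Metric.ball c R) ∧ ∃ u : ℂ → ℂ, AnalyticOnNhd ℂ u (Metric.closedBall c R) ∧
    (∀ z ∈ Metric.closedBall c R, u z ≠ 0) ∧ ∀ z, φ z = (S.map fun a => z - a).prod * u z

theorem IsZeroMultiset.mem_iff {φ : ℂ → ℂ} {c : ℂ} {R : ℝ} {S : Multiset ℂ}
    (h : IsZeroMultiset φ c R S) {z : ℂ} : z ∈ S ↔ z ∈ Metric.ball c R ∧ φ z = 0 := by
  obtain ⟨h1, u, -, hu, heq⟩ := h
  constructor
  · intro hz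
    refine ⟨h1 z hz, ?_⟩
    rw [heq, Multiset.prod_eq_zero, zero_mul]
    exact Multiset.mem_map.2 ⟨z, hz, sub_self z⟩
  · rintro ⟨hz, h0⟩
    rw [heq, mul_eq_zero] at h0
    obtain ⟨a, ha, haz⟩ := Multiset.mem_map.1
      (Multiset.prod_eq_zero_iff.1 (h0.resolve_right (hu z (Metric.ball_subset_closedBall hz))))
    rwa [sub_eq_zero.1 haz]

/-- Dividing out a zero. -/
theorem exists_eq_pow_mul {φ : ℂ → ℂ} {K : Set ℂ} (hφ : AnalyticOnNhd ℂ φ K) {a : ℂ} (ha : a ∈ K)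
    (h : ¬ ∀ᶠ z in 𝓝 a, φ z = 0) : ∃ (n : ℕ) (u : ℂ → ℂ), AnalyticOnNhd ℂ u K ∧ u a ≠ 0 ∧
      ∀ z, φ z = (z - a) ^ n * u z := by
  obtain ⟨n, g, hg, hg0, heq⟩ := (hφ a ha).exists_eventuallyEq_pow_smul_nonzero_iff.2 h
  classical
  refine ⟨n, fun z => if z = a then g a else φ z / (z - a) ^ n, ?_, by simpa using hg0, ?_⟩
  · intro z hz
    rcases eq_or_ne z a with rfl | hza
    · refine hg.congr ?_
      filter_upwards [heq] with w hw
      split_ifs with hwz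
      · rw [hwz]
      · rw [hw, smul_eq_mul, mul_div_cancel_left₀]
        exact pow_ne_zero _ (sub_ne_zero.2 hwz)
    · have : AnalyticAt ℂ (fun w => φ w / (w - a) ^ n) z :=
        (hφ z hz).fun_div ((analyticAt_id.fun_sub analyticAt_const).fun_pow n)
          (pow_ne_zero _ (sub_ne_zero.2 hza))
      refine this.congr ?_
      filter_upwards [isOpen_ne.mem_nhds hza] with w hw
      rw [if_neg hw]
  · intro z
    dsimp only
    split_ifs with hza
    · subst hza
      have := heq.self_of_nhds
      simpa using this
    · rw [mul_div_cancel₀]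
      exact pow_ne_zero _ (sub_ne_zero.2 hza)

theorem exists_isZeroMultiset {φ : ℂ → ℂ} {c : ℂ} {R : ℝ} (hR : 0 < R)
    (hφ : AnalyticOnNhd ℂ φ (Metric.closedBall c R)) (h0 : ∀ z ∈ Metric.sphere c R, φ z ≠ 0) :
    ∃ S, IsZeroMultiset φ c R S := by
  have hconn : IsPreconnected (Metric.closedBall c R) := (convex_closedBall c R).isPreconnected
  have hne : ∀ ψ : ℂ → ℂ, AnalyticOnNhd ℂ ψ (Metric.closedBall c R) →
      (∀ z ∈ Metric.sphere c R, ψ z ≠ 0) → ∀ a ∈ Metric.closedBall c R,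
      ¬ ∀ᶠ z in 𝓝 a, ψ z = 0 := by
    intro ψ hψ hψ0 a ha hev
    have h1 := hψ.eqOn_zero_of_preconnected_of_eventuallyEq_zero hconn ha hev
    obtain ⟨z, hz⟩ : (Metric.sphere c R).Nonempty := NormedSpace.sphere_nonempty.2 hR.le
    exact hψ0 z hz (h1 (Metric.sphere_subset_closedBall hz))
  have hfin : {z ∈ Metric.closedBall c R | φ z = 0}.Finite := by
    by_contra hinf
    obtain ⟨a, ha, hacc⟩ := (Set.Infinite.exists_accPt_of_subset_isCompact hinf
      (isCompact_closedBall c R) (Set.sep_subset _ _))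
    refine hne φ hφ h0 a ha ((hφ a ha).frequently_zero_iff_eventually_zero.1 ?_)
    have := accPt_iff_frequently_nhdsNE.1 hacc
    exact this.mono fun z hz => hz.2
  -- The induction is on a finite set `Z` merely containing the zeros; an element of `Z` outside the
  -- open disk cannot be a zero in the closed disk and is discarded.
  have key : ∀ (n : ℕ) (ψ : ℂ → ℂ), AnalyticOnNhd ℂ ψ (Metric.closedBall c R) →
      (∀ z ∈ Metric.sphere c R, ψ z ≠ 0) → ∀ Z : Finset ℂ, Z.card = n →
      (∀ z ∈ Metric.closedBall c R, ψ z = 0 → z ∈ Z) → ∃ S, IsZeroMultiset ψ c R S := by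
    intro n
    induction n with
    | zero =>
      intro ψ hψ hψ0 Z hZ hzero
      rw [Finset.card_eq_zero] at hZ
      subst hZ
      exact ⟨0, by simp, ψ, hψ, fun z hz hz0 => by simpa using hzero z hz hz0, by simp⟩
    | succ n ih =>
      intro ψ hψ hψ0 Z hZ hzero
      obtain ⟨a, haZ⟩ : Z.Nonempty := Finset.card_pos.1 (by omega)
      have hcard : (Z.erase a).card = n := by rw [Finset.card_erase_of_mem haZ]; omega
      by_cases ha : a ∈ Metric.ball c R
      swap
      · refine ih ψ hψ hψ0 (Z.erase a) hcard fun z hz hz0 => ?_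
        refine Finset.mem_erase.2 ⟨?_, hzero z hz hz0⟩
        rintro rfl
        rcases Metric.mem_closedBall.1 hz |>.lt_or_eq with h | h
        · exact ha h
        · exact hψ0 z h hz0
      · have hac := Metric.ball_subset_closedBall ha
        obtain ⟨k, u, hu, hua, heq⟩ := exists_eq_pow_mul hψ hac (hne ψ hψ hψ0 a hac)
        obtain ⟨S, hS1, v, hv, hv0, hS⟩ := ih u hu
          (fun z hz hz0 => hψ0 z hz (by rw [heq, hz0, mul_zero])) (Z.erase a) hcard
          (fun z hz hz0 => Finset.mem_erase.2 ⟨by rintro rfl; exact hua hz0,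
            hzero z hz (by rw [heq, hz0, mul_zero])⟩)
        refine ⟨Multiset.replicate k a + S, ?_, v, hv, hv0, fun z => ?_⟩
        · intro b hb
          rcases Multiset.mem_add.1 hb with hb | hb
          · rwa [Multiset.eq_of_mem_replicate hb]
          · exact hS1 b hb
        · rw [heq, hS, Multiset.map_add, Multiset.prod_add, Multiset.map_replicate,
            Multiset.prod_replicate, mul_assoc]
  exact key _ φ hφ h0 hfin.toFinset rfl fun z hz hz0 => by simpa using ⟨hz, hz0⟩

theorem logDeriv_multiset_prod {S : Multiset ℂ} {z : ℂ} (hz : z ∉ S) :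
    HasDerivAt (fun z => (S.map fun a => z - a).prod)
      ((S.map fun a => z - a).prod * (S.map fun a => (z - a)⁻¹).sum) z := by
  induction S using Multiset.induction_on with
  | empty => simpa using hasDerivAt_const z (1 : ℂ)
  | cons a S ih =>
    have h1 : z - a ≠ 0 := sub_ne_zero.2 fun h => hz (by simp [h])
    have h2 := ih fun h => hz (Multiset.mem_cons_of_mem h)
    have h3 := ((hasDerivAt_id z).sub_const a).fun_mul h2
    simp only [Multiset.map_cons, Multiset.prod_cons, Multiset.sum_cons]
    refine h3.congr_deriv ?_
    simp only [id]
    linear_combination -(S.map fun a => z - a).prod * mul_inv_cancel₀ h1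

/-- The residue formula for sums over zeros. -/
theorem IsZeroMultiset.integral_eq {φ : ℂ → ℂ} {c : ℂ} {R : ℝ} {S : Multiset ℂ} (hR : 0 < R)
    (hS : IsZeroMultiset φ c R S) {h : ℂ → ℂ} (hh : AnalyticOnNhd ℂ h (Metric.closedBall c R)) :
    (S.map h).sum = (2 * Real.pi * Complex.I)⁻¹ * ∮ z in C(c, R), h z * (deriv φ z / φ z) := by
  obtain ⟨hS1, u, hu, hu0, heq⟩ := hS
  have hsph : ∀ z ∈ Metric.sphere c R, z ∉ S := fun z hz hzS =>
    (Metric.sphere_disjoint_ball.le_bot ⟨hz, hS1 z hzS⟩).elim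
  have h1 : (∮ z in C(c, R), h z * (deriv φ z / φ z)) =
      ∮ z in C(c, R), ((S.map fun a => (z - a)⁻¹ • h z).sum + h z * (deriv u z / u z)) := by
    refine circleIntegral.integral_congr hR.le fun z hz => ?_
    have hz' := Metric.sphere_subset_closedBall hz
    have hd := (logDeriv_multiset_prod (hsph z hz)).fun_mul (hu z hz').differentiableAt.hasDerivAt
    rw [← funext heq] at hd
    have hp : (S.map fun a => z - a).prod ≠ 0 := by
      rw [Ne, Multiset.prod_eq_zero_iff, Multiset.mem_map]
      rintro ⟨a, ha, haz⟩
      rw [sub_eq_zero] at haz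
      exact hsph z hz (haz ▸ ha)
    have hu' := hu0 z hz'
    have hsum : (S.map fun a => (z - a)⁻¹ • h z).sum = (S.map fun a => (z - a)⁻¹).sum * h z := by
      simp only [smul_eq_mul, Multiset.sum_map_mul_right]
    rw [hsum, hd.deriv, heq z]
    field_simp
  have hcont : ContinuousOn h (Metric.closedBall c R) := hh.continuousOn
  have hint : ∀ T : Multiset ℂ, (∀ a ∈ T, a ∈ Metric.ball c R) →
      CircleIntegrable (fun z => (T.map fun a => (z - a)⁻¹ • h z).sum) c R ∧
      (∮ z in C(c, R), (T.map fun a => (z - a)⁻¹ • h z).sum) =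
        2 * Real.pi * Complex.I * (T.map h).sum := by
    intro T
    induction T using Multiset.induction_on with
    | empty => intro _; simp [circleIntegral]
    | cons a T ih =>
      intro hT
      obtain ⟨i1, i2⟩ := ih fun b hb => hT b (Multiset.mem_cons_of_mem hb)
      have ha := hT a (Multiset.mem_cons_self a T)
      have i3 : CircleIntegrable (fun z => (z - a)⁻¹ • h z) c R := by
        refine ContinuousOn.circleIntegrable hR.le ?_
        refine ContinuousOn.smul (ContinuousOn.inv₀ (f := fun z => z - a) (by fun_prop) fun z hz => ?_)
          (hcont.mono Metric.sphere_subset_closedBall)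
        rw [sub_ne_zero]
        rintro rfl
        exact (Metric.sphere_disjoint_ball.le_bot ⟨hz, ha⟩).elim
      simp only [Multiset.map_cons, Multiset.sum_cons]
      refine ⟨i3.fun_add i1, ?_⟩
      rw [circleIntegral.integral_add i3 i1, i2]
      rw [Complex.circleIntegral_sub_inv_smul_of_differentiable_on_off_countable
        Set.countable_empty ha hcont fun z hz =>
          (hh z (Metric.ball_subset_closedBall hz.1)).differentiableAt]
      simp only [smul_eq_mul]
      ring
  have hdiff : AnalyticOnNhd ℂ (fun z => h z * (deriv u z / u z)) (Metric.closedBall c R) :=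
    fun z hz => (hh z hz).fun_mul ((hu z hz).deriv.fun_div (hu z hz) (hu0 z hz))
  have hzero : (∮ z in C(c, R), h z * (deriv u z / u z)) = 0 :=
    Complex.circleIntegral_eq_zero_of_differentiable_on_off_countable hR.le Set.countable_empty
      hdiff.continuousOn fun z hz =>
        (hdiff z (Metric.ball_subset_closedBall hz.1)).differentiableAt
  have hint2 : CircleIntegrable (fun z => h z * (deriv u z / u z)) c R :=
    ContinuousOn.circleIntegrable hR.le (hdiff.continuousOn.mono Metric.sphere_subset_closedBall)
  rw [h1, circleIntegral.integral_add (hint S hS1).1 hint2, (hint S hS1).2, hzero, add_zero,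
    ← mul_assoc, inv_mul_cancel₀, one_mul]
  exact Complex.two_pi_I_ne_zero

end Zeros

/-! ### Analytic dependence of zeros on a parameter -/

section Parameters

theorem eventually_forall_analyticAt {Ψ : ℂ × ℂ → ℂ} {t₀ : ℂ} {K : Set ℂ} (hK : IsCompact K)
    (h : ∀ s ∈ K, AnalyticAt ℂ Ψ (t₀, s)) : ∀ᶠ t in 𝓝 t₀, ∀ s ∈ K, AnalyticAt ℂ Ψ (t, s) :=
  hK.eventually_forall_of_forall_eventually fun s hs => (h s hs).eventually_analyticAt

/-- Differentiation under the integral sign. In one complex variable, differentiability near `t₀`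
already gives analyticity; the dominating constant comes from compactness of the circle. -/
theorem AnalyticAt.circleIntegral_param {Ψ : ℂ × ℂ → ℂ} {t₀ c : ℂ} {R : ℝ} (hR : 0 ≤ R)
    (h : ∀ s ∈ Metric.sphere c R, AnalyticAt ℂ Ψ (t₀, s)) :
    AnalyticAt ℂ (fun t => ∮ s in C(c, R), Ψ (t, s)) t₀ := by
  have hev := eventually_forall_analyticAt (isCompact_sphere c R) h
  rw [Complex.analyticAt_iff_eventually_differentiableAt]
  filter_upwards [hev] with t₁ h₁
  have hev₁ := eventually_forall_analyticAt (isCompact_sphere c R) h₁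
  obtain ⟨C, hC⟩ := exists_eventually_bound (isCompact_sphere c R)
    (Θ := fun p => fderiv ℂ Ψ p (1, 0)) (a := t₁)
    fun s hs => ((h₁ s hs).fderiv.continuousAt).clm_apply continuousAt_const
  have hcm : Continuous (deriv (circleMap c R)) := by
    rw [funext (deriv_circleMap c R)]
    fun_prop
  have hcont : ∀ t, (∀ s ∈ Metric.sphere c R, AnalyticAt ℂ Ψ (t, s)) →
      Continuous fun θ : ℝ => deriv (circleMap c R) θ • Ψ (t, circleMap c R θ) := by
    intro t ht
    refine Continuous.smul hcm ?_
    rw [continuous_iff_continuousAt]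
    intro θ
    exact ContinuousAt.comp (f := fun θ : ℝ => (t, circleMap c R θ))
      (ht _ (circleMap_mem_sphere c hR θ)).continuousAt (by fun_prop)
  have hcont' : Continuous fun θ : ℝ =>
      deriv (circleMap c R) θ • fderiv ℂ Ψ (t₁, circleMap c R θ) (1, 0) := by
    refine Continuous.smul hcm ?_
    rw [continuous_iff_continuousAt]
    intro θ
    exact (ContinuousAt.comp (f := fun θ : ℝ => (t₁, circleMap c R θ))
      (h₁ _ (circleMap_mem_sphere c hR θ)).fderiv.continuousAt (by fun_prop)).clm_apply
      continuousAt_const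
  refine (intervalIntegral.hasDerivAt_integral_of_dominated_loc_of_deriv_le
    (F := fun t θ => deriv (circleMap c R) θ • Ψ (t, circleMap c R θ))
    (F' := fun t θ => deriv (circleMap c R) θ • fderiv ℂ Ψ (t, circleMap c R θ) (1, 0))
    (bound := fun _ => R * C)
    (hev₁.and hC) ?_ ((hcont t₁ h₁).intervalIntegrable _ _) hcont'.aestronglyMeasurable ?_
    (by simp) ?_).2.differentiableAt
  · exact hev₁.mono fun t ht => (hcont t ht).aestronglyMeasurable
  · refine .of_forall fun θ _ t ht => ?_
    rw [norm_smul]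
    refine mul_le_mul ?_ (ht.2 _ (circleMap_mem_sphere c hR θ)) (norm_nonneg _) hR
    simp [deriv_circleMap, abs_of_nonneg hR]
  · refine .of_forall fun θ _ t ht => ?_
    have h2 := (ht.1 _ (circleMap_mem_sphere c hR θ)).differentiableAt.hasFDerivAt
    have h3 : HasDerivAt (fun t : ℂ => (t, circleMap c R θ)) ((1 : ℂ), (0 : ℂ)) t :=
      (hasDerivAt_id t).prodMk (hasDerivAt_const t _)
    exact HasDerivAt.fun_const_smul _ (h2.comp_hasDerivAt t h3)

/-- `Φ (t, ·)` is analytic near the closed disk, uniformly in `t`, without zeros on its boundary. -/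
def IsGoodAt (Φ : ℂ × ℂ → ℂ) (c : ℂ) (R : ℝ) (t : ℂ) : Prop :=
  (∀ s ∈ Metric.closedBall c R, AnalyticAt ℂ Φ (t, s)) ∧ ∀ s ∈ Metric.sphere c R, Φ (t, s) ≠ 0

open Classical in
/-- The zeros of `Φ (t, ·)` in the disk, with multiplicities. -/
noncomputable def zerosAt (Φ : ℂ × ℂ → ℂ) (c : ℂ) (R : ℝ) (t : ℂ) : Multiset ℂ :=
  if h : ∃ S, IsZeroMultiset (fun s => Φ (t, s)) c R S then h.choose else 0

variable {Φ : ℂ × ℂ → ℂ} {c t₀ : ℂ} {R : ℝ}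

theorem AnalyticAt.slice {Ψ : ℂ × ℂ → ℂ} {t s : ℂ} (h : AnalyticAt ℂ Ψ (t, s)) :
    AnalyticAt ℂ (fun s => Ψ (t, s)) s :=
  h.comp (f := fun s => (t, s)) (analyticAt_const.prod analyticAt_id)

theorem IsGoodAt.isZeroMultiset (hR : 0 < R) (h : IsGoodAt Φ c R t₀) :
    IsZeroMultiset (fun s => Φ (t₀, s)) c R (zerosAt Φ c R t₀) := by
  have : ∃ S, IsZeroMultiset (fun s => Φ (t₀, s)) c R S :=
    exists_isZeroMultiset hR (fun s hs => (h.1 s hs).slice) h.2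
  rw [zerosAt, dif_pos this]
  exact this.choose_spec

theorem IsGoodAt.eventually (h : IsGoodAt Φ c R t₀) : ∀ᶠ t in 𝓝 t₀, IsGoodAt Φ c R t := by
  refine (eventually_forall_analyticAt (isCompact_closedBall c R) h.1).and ?_
  exact (isCompact_sphere c R).eventually_forall_of_forall_eventually fun s hs =>
    (h.1 s (Metric.sphere_subset_closedBall hs)).continuousAt.eventually_ne (h.2 s hs)

/-- The individual zeros need not depend continuously on `t` under any labelling, but the residue
formula writes their symmetric sums as a contour integral over a fixed circle. -/
theorem IsGoodAt.analyticAt_sum (hR : 0 < R) (h : IsGoodAt Φ c R t₀) {H : ℂ × ℂ → ℂ}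
    (hH : ∀ s ∈ Metric.closedBall c R, AnalyticAt ℂ H (t₀, s)) :
    AnalyticAt ℂ (fun t => ((zerosAt Φ c R t).map fun s => H (t, s)).sum) t₀ := by
  have h1 : AnalyticAt ℂ (fun t => (2 * Real.pi * Complex.I)⁻¹ *
      ∮ s in C(c, R), (fun p : ℂ × ℂ => H p * (fderiv ℂ Φ p (0, 1) / Φ p)) (t, s)) t₀ := by
    refine analyticAt_const.fun_mul (AnalyticAt.circleIntegral_param
      (Ψ := fun p : ℂ × ℂ => H p * (fderiv ℂ Φ p (0, 1) / Φ p)) hR.le fun s hs => ?_)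
    have hs' := Metric.sphere_subset_closedBall hs
    refine (hH s hs').fun_mul (AnalyticAt.fun_div ?_ (h.1 s hs') (h.2 s hs))
    exact ((ContinuousLinearMap.apply ℂ ℂ ((0 : ℂ), (1 : ℂ))).analyticAt _).comp
      (h.1 s hs').fderiv
  refine h1.congr ?_
  filter_upwards [h.eventually, eventually_forall_analyticAt (isCompact_closedBall c R) hH]
    with t ht htH
  rw [(ht.isZeroMultiset hR).integral_eq hR fun s hs => (htH s hs).slice]
  congr 1
  refine circleIntegral.integral_congr hR.le fun s hs => ?_
  have h2 := (ht.1 s (Metric.sphere_subset_closedBall hs)).differentiableAt.hasFDerivAt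
  have h3 : HasDerivAt (fun s : ℂ => (t, s)) ((0 : ℂ), (1 : ℂ)) s :=
    (hasDerivAt_const s t).prodMk (hasDerivAt_id s)
  rw [← (h2.comp_hasDerivAt s h3).deriv]
  rfl

theorem eventually_eq_of_continuousAt_natCast {N : ℂ → ℕ}
    (h : ContinuousAt (fun t => (N t : ℂ)) t₀) : ∀ᶠ t in 𝓝 t₀, N t = N t₀ := by
  have h1 : ∀ᶠ t in 𝓝 t₀, ‖(N t : ℂ) - N t₀‖ < 1 := by
    have := Metric.tendsto_nhds.1 h.tendsto 1 one_pos
    simpa [dist_eq_norm] using this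
  filter_upwards [h1] with t ht
  have h2 : ‖(((N t : ℤ) - (N t₀ : ℤ) : ℤ) : ℂ)‖ < 1 := by simpa using ht
  rw [Complex.norm_intCast] at h2
  have h3 : |((N t : ℤ) - (N t₀ : ℤ))| < 1 := by exact_mod_cast h2
  rw [Int.abs_lt_one_iff] at h3
  omega

/-- The sum of `1` over the zeros is continuous in `t` and takes natural values. -/
theorem IsGoodAt.eventually_card_eq (hR : 0 < R) (h : IsGoodAt Φ c R t₀) :
    ∀ᶠ t in 𝓝 t₀, (zerosAt Φ c R t).card = (zerosAt Φ c R t₀).card := by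
  have := (h.analyticAt_sum hR (H := fun _ => 1) fun _ _ => analyticAt_const).continuousAt
  refine eventually_eq_of_continuousAt_natCast (N := fun t => (zerosAt Φ c R t).card) ?_
  simpa using this

end Parameters

/-! ### Newton's identities -/

section Newton

variable {E : Type*} [NormedAddCommGroup E] [NormedSpace ℂ E]

/-- In characteristic zero, Newton's identities express the elementary symmetric functions
recursively through the power sums; the top one is the product. No regularity of the separate
functions `a · i` is needed. -/
theorem AnalyticAt.fin_prod_of_psum {M : ℕ} {a : E → Fin M → ℂ} {z₀ : E}
    (h : ∀ j, AnalyticAt ℂ (fun z => ∑ i, a z i ^ j) z₀) :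
    AnalyticAt ℂ (fun z => ∏ i, a z i) z₀ := by
  have key : ∀ k, AnalyticAt ℂ
      (fun z => MvPolynomial.aeval (a z) (MvPolynomial.esymm (Fin M) ℂ k)) z₀ := by
    intro k
    induction k using Nat.strong_induction_on with
    | _ k ih =>
      rcases Nat.eq_zero_or_pos k with rfl | hk
      · simpa using analyticAt_const
      have hk' : (k : ℂ) ≠ 0 := by exact_mod_cast hk.ne'
      have h1 : (fun z => MvPolynomial.aeval (a z) (MvPolynomial.esymm (Fin M) ℂ k)) = fun z =>
          (k : ℂ)⁻¹ * ((-1) ^ (k + 1) * ∑ b ∈ (Finset.HasAntidiagonal.antidiagonal k).filter (fun b => b.1 < k),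
            (-1) ^ b.1 * MvPolynomial.aeval (a z) (MvPolynomial.esymm (Fin M) ℂ b.1) *
              ∑ i, a z i ^ b.2) := by
        funext z
        have := congrArg (MvPolynomial.aeval (a z)) (MvPolynomial.mul_esymm_eq_sum (Fin M) ℂ k)
        rw [eq_inv_mul_iff_mul_eq₀ hk']
        simpa [MvPolynomial.psum] using this
      rw [h1]
      refine analyticAt_const.fun_mul (analyticAt_const.fun_mul ?_)
      refine Finset.analyticAt_fun_sum _ fun b hb => ?_
      exact (analyticAt_const.fun_mul (ih b.1 (Finset.mem_filter.1 hb).2)).fun_mul (h b.2)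
  have := key M
  have hself : Finset.powersetCard M (Finset.univ : Finset (Fin M)) = {Finset.univ} := by
    simpa using Finset.powersetCard_self (Finset.univ : Finset (Fin M))
  simpa [MvPolynomial.esymm, hself] using this

theorem AnalyticAt.multiset_prod_of_psum {M : ℕ} {S : E → Multiset ℂ} {z₀ : E}
    (hM : ∀ᶠ z in 𝓝 z₀, (S z).card = M)
    (h : ∀ j, AnalyticAt ℂ (fun z => ((S z).map (· ^ j)).sum) z₀) :
    AnalyticAt ℂ (fun z => (S z).prod) z₀ := by
  have hex : ∀ z, ∃ a : Fin M → ℂ, (S z).card = M → S z = Finset.univ.val.map a := by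
    intro z
    by_cases hz : (S z).card = M
    · obtain ⟨l, hl⟩ : ∃ l : List ℂ, (l : Multiset ℂ) = S z := Quot.exists_rep _
      have hlen : l.length = M := by rw [← hz, ← hl, Multiset.coe_card]
      subst hlen
      exact ⟨l.get, fun _ => by rw [← hl, Fin.univ_val_map, List.ofFn_get]⟩
    · exact ⟨0, fun h => (hz h).elim⟩
  choose a ha using hex
  have : AnalyticAt ℂ (fun z => ∏ i, a z i) z₀ := by
    refine AnalyticAt.fin_prod_of_psum fun j => (h j).congr ?_
    filter_upwards [hM] with z hz
    rw [ha z hz, Multiset.map_map]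
    rfl
  refine this.congr ?_
  filter_upwards [hM] with z hz
  rw [ha z hz]
  rfl

end Newton

/-! ### Analytic germs from finite fibres over a line -/

section FiniteFibers

variable {m : ℕ}

/-- The linear form `z ↦ ∑ cⁱ zᵢ`. -/
noncomputable def vandermondeForm (m : ℕ) (c : ℂ) : (Fin m → ℂ) →L[ℂ] ℂ :=
  ∑ i : Fin m, c ^ (i : ℕ) • ContinuousLinearMap.proj (R := ℂ) (φ := fun _ : Fin m => ℂ) i

theorem vandermondeForm_apply (c : ℂ) (z : Fin m → ℂ) :
    vandermondeForm m c z = ∑ i : Fin m, c ^ (i : ℕ) * z i := by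
  simp [vandermondeForm]

/-- The value of the form at `c` is the value at `c` of the nonzero polynomial of degree less than
`m` whose coefficients are those of `z`. -/
theorem card_vandermondeForm_eq_lt {z : Fin m → ℂ} (hz : z ≠ 0) (I : Finset ℂ)
    (hI : ∀ c ∈ I, vandermondeForm m c z = 0) : I.card < m := by
  by_contra hlt
  push Not at hlt
  set P : Polynomial ℂ := ∑ i : Fin m, Polynomial.C (z i) * Polynomial.X ^ (i : ℕ) with hP
  have hm : 0 < m := by
    rcases Nat.eq_zero_or_pos m with rfl | h
    · exact (hz (Subsingleton.elim _ _)).elim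
    · exact h
  have hdeg : P.degree < m := by
    refine (Polynomial.degree_sum_le _ _).trans_lt ?_
    rw [Finset.sup_lt_iff (by exact_mod_cast WithBot.bot_lt_coe m)]
    intro i _
    exact (Polynomial.degree_C_mul_X_pow_le _ _).trans_lt (by exact_mod_cast i.2)
  have hzero : P = 0 := by
    refine Polynomial.eq_zero_of_degree_lt_of_eval_finset_eq_zero I
      (hdeg.trans_le (by exact_mod_cast hlt)) fun c hc => ?_
    have := hI c hc
    rw [vandermondeForm_apply] at this
    rw [hP, Polynomial.eval_finsetSum, ← this]
    exact Finset.sum_congr rfl fun i _ => by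
      rw [Polynomial.eval_mul, Polynomial.eval_C, Polynomial.eval_pow, Polynomial.eval_X, mul_comm]
  refine hz (funext fun i => ?_)
  have := congrArg (fun Q => Polynomial.coeff Q (i : ℕ)) hzero
  simpa [hP, Polynomial.finsetSum_coeff, Polynomial.coeff_C_mul, Polynomial.coeff_X_pow,
    Fin.val_inj] using this

/-- Each `w ≠ z` in `b` agrees with `z` under fewer than `m` of the forms. If `z ∉ b`, at most `m *
b.card` forms can therefore give a zero product, one too few. -/
theorem exists_eq_of_vandermondeForm_prod_eq_zero {b : Multiset (Fin m → ℂ)} {z : Fin m → ℂ}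
    (h : ∀ c : Fin (m * b.card + 1),
      (b.map fun w => vandermondeForm m (c : ℕ) z - vandermondeForm m (c : ℕ) w).prod = 0) :
    z ∈ b := by
  classical
  by_contra hz
  have key : ∀ b : Multiset (Fin m → ℂ), z ∉ b → ∀ I : Finset ℂ, (∀ c ∈ I,
      (b.map fun w => vandermondeForm m c z - vandermondeForm m c w).prod = 0) →
      I.card ≤ m * b.card := by
    intro b
    induction b using Multiset.induction_on with
    | empty =>
      intro _ I hI
      rcases I.eq_empty_or_nonempty with rfl | ⟨c, hc⟩
      · simp
      · simpa using hI c hc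
    | cons w b ih =>
      intro hzb I hI
      have h1 := card_vandermondeForm_eq_lt (z := z - w)
        (sub_ne_zero.2 fun h => hzb (by simp [h]))
        (I.filter fun c => vandermondeForm m c (z - w) = 0) fun c hc => (Finset.mem_filter.1 hc).2
      have h2 := ih (fun h => hzb (Multiset.mem_cons_of_mem h))
        (I.filter fun c => ¬ vandermondeForm m c (z - w) = 0) fun c hc => by
          obtain ⟨hcI, hc⟩ := Finset.mem_filter.1 hc
          have := hI c hcI
          rw [Multiset.map_cons, Multiset.prod_cons, ← map_sub, mul_eq_zero] at this
          exact this.resolve_left hc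
      have h3 := Finset.card_filter_add_card_filter_not (s := I)
        (fun c => vandermondeForm m c (z - w) = 0)
      rw [Multiset.card_cons, mul_add]
      omega
  have hinj : Function.Injective fun c : Fin (m * b.card + 1) => ((c : ℕ) : ℂ) := fun c d hcd => by
    simpa [Fin.val_inj] using hcd
  have := key b hz (Finset.univ.image fun c : Fin (m * b.card + 1) => ((c : ℕ) : ℂ)) (by
    intro c hc
    obtain ⟨c, -, rfl⟩ := Finset.mem_image.1 hc
    exact h c)
  rw [Finset.card_image_of_injective _ hinj, Finset.card_univ, Fintype.card_fin] at this
  omega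

theorem Multiset.sum_map_add_mul_pow (S : Multiset ℂ) (a l : ℂ) (j : ℕ) :
    (S.map fun s => (a + s * l) ^ j).sum = ∑ i ∈ Finset.range (j + 1),
      a ^ i * l ^ (j - i) * (j.choose i) * (S.map fun s => s ^ (j - i)).sum := by
  induction S using Multiset.induction_on with
  | empty => simp
  | cons s S ih =>
    simp only [Multiset.map_cons, Multiset.sum_cons, ih, mul_add, Finset.sum_add_distrib]
    rw [add_pow]
    congr 1
    exact Finset.sum_congr rfl fun i _ => by rw [mul_pow]; ring

/-- A set whose points near the origin lie in the fibres of a finite branched cover of the line,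
with analytic power sums, is an analytic germ. -/
theorem isAnalyticGermAt_of_fibers {B : Set (Fin m → ℂ)} (p : (Fin m → ℂ) →L[ℂ] ℂ)
    {b : ℂ → Multiset (Fin m → ℂ)} {M : ℕ} (hM : ∀ᶠ x in 𝓝 0, (b x).card = M)
    (hsum : ∀ (c : ℂ) (j : ℕ),
      AnalyticAt ℂ (fun x => ((b x).map fun w => vandermondeForm m c w ^ j).sum) 0)
    (hB : ∀ᶠ z in 𝓝 0, z ∈ B ↔ z ∈ b (p z)) : IsAnalyticGermAt B 0 := by
  have hp : Tendsto p (𝓝 0) (𝓝 0) := by simpa using p.continuous.tendsto 0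
  -- The equations: `z` cannot be separated from its fibre by any of the forms. They are analytic
  -- because the power sums of `L z - L w` expand binomially into those of `L w`.
  refine ⟨m * M + 1, fun c z => ((b (p z)).map fun w =>
    vandermondeForm m (c : ℕ) z - vandermondeForm m (c : ℕ) w).prod, fun c => ?_, ?_⟩
  · refine AnalyticAt.multiset_prod_of_psum (M := M) ?_ fun j => ?_
    · simpa using hp.eventually hM
    · set L := vandermondeForm m (c : ℕ)
      have h1 : ∀ z, (((b (p z)).map fun w => L z - L w).map (· ^ j)).sum =
          ∑ i ∈ Finset.range (j + 1), L z ^ i * (-1) ^ (j - i) * (j.choose i) *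
            ((b (p z)).map fun w => L w ^ (j - i)).sum := by
        intro z
        have := ((b (p z)).map L).sum_map_add_mul_pow (L z) (-1) j
        simp only [Multiset.map_map, Function.comp_def] at this ⊢
        rw [← this]
        congr 1
        refine Multiset.map_congr rfl fun w _ => by ring
      simp only [h1]
      refine Finset.analyticAt_fun_sum _ fun i _ => ?_
      refine (((L.analyticAt _).fun_pow i).fun_mul analyticAt_const |>.fun_mul
        analyticAt_const).fun_mul ?_
      have h2 := hsum (c : ℕ) (j - i)
      exact AnalyticAt.fun_comp (g := fun x => ((b x).map fun w => L w ^ (j - i)).sum) (f := p)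
        (by simpa using h2) (p.analyticAt 0)
  · filter_upwards [hB, hp.eventually hM] with z hz hzM
    refine propext (hz.trans ⟨fun h c => ?_, fun h => ?_⟩)
    · exact Multiset.prod_eq_zero (Multiset.mem_map.2 ⟨z, h, sub_self _⟩)
    · subst hzM
      exact exists_eq_of_vandermondeForm_prod_eq_zero h

/-- Curves swept out over an arc `A` by finitely many points on the lines in direction `v`. -/
theorem isAnalyticGermAt_curve {A : ℂ → (Fin m → ℂ)} {v : Fin m → ℂ} (p : (Fin m → ℂ) →L[ℂ] ℂ)
    (hpv : p v = 0) (hA : AnalyticAt ℂ A 0) 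
    (hpA : ∀ᶠ t in 𝓝[≠] 0, p (A t) ≠ 0) {S : ℂ → Multiset ℂ} {N : ℕ}
    (hN : ∀ᶠ t in 𝓝 0, (S t).card = N)
    (hS : ∀ᶠ t in 𝓝 0, ∀ j : ℕ, AnalyticAt ℂ (fun t => ((S t).map fun s => s ^ j).sum) t) :
    ∃ R₀ > 0, ∀ R, 0 < R → R ≤ R₀ →
      IsAnalyticGermAt {z | ∃ t ∈ Metric.ball (0 : ℂ) R, ∃ s ∈ S t, z = A t + s • v} 0 := by
  rw [eventually_nhdsWithin_iff] at hpA
  obtain ⟨r, hr, hall⟩ := Metric.eventually_nhds_iff_ball.1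
    (((hA.eventually_analyticAt).and hpA).and (hN.and hS))
  refine ⟨r / 2, by positivity, fun R hR hRr => ?_⟩
  have hsub : ∀ t ∈ Metric.closedBall (0 : ℂ) R, t ∈ Metric.ball (0 : ℂ) r := fun t ht =>
    Metric.closedBall_subset_ball (by linarith) ht
  -- The zeros of `Φ (x, ·)` are the parameters `t` with `p (A t) = x`. Collecting the points over
  -- all of them turns a family indexed by `t` into one indexed by the coordinate `x = p z`.
  set Φ : ℂ × ℂ → ℂ := fun q => p (A q.2) - q.1 with hΦ
  have hgood : IsGoodAt Φ 0 R 0 := by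
    refine ⟨fun t ht => ?_, fun t ht => ?_⟩
    · have h1 := (hall t (hsub t ht)).1.1
      have h2 : AnalyticAt ℂ (fun q : ℂ × ℂ => p (A q.2)) (0, t) :=
        (p.analyticAt _).comp (AnalyticAt.fun_comp (f := fun q : ℂ × ℂ => q.2) h1 analyticAt_snd)
      exact h2.fun_sub analyticAt_fst
    · have h1 := (hall t (hsub t (Metric.sphere_subset_closedBall ht))).1.2
      have ht0 : t ≠ 0 := by
        rintro rfl
        simp [hR.ne] at ht
      simpa [hΦ] using h1 ht0
  refine isAnalyticGermAt_of_fibers p (M := (zerosAt Φ 0 R 0).card * N)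
    (b := fun x => (zerosAt Φ 0 R x).bind fun t => (S t).map fun s => A t + s • v) ?_ ?_ ?_
  · filter_upwards [hgood.eventually, hgood.eventually_card_eq hR] with x hx hxc
    rw [Multiset.card_bind, ← hxc]
    have : (zerosAt Φ 0 R x).map (Multiset.card ∘ fun t => (S t).map fun s => A t + s • v) =
        (zerosAt Φ 0 R x).map fun _ => N := by
      refine Multiset.map_congr rfl fun t ht => ?_
      have := ((hx.isZeroMultiset hR).mem_iff.1 ht).1
      simpa using (hall t (hsub t (Metric.ball_subset_closedBall this))).2.1
    rw [this]
    simp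
  · intro c j
    set L := vandermondeForm m c
    have h1 : ∀ x, (((zerosAt Φ 0 R x).bind fun t => (S t).map fun s => A t + s • v).map
        fun w => L w ^ j).sum = ((zerosAt Φ 0 R x).map fun t => (fun q : ℂ × ℂ =>
          ∑ i ∈ Finset.range (j + 1), L (A q.2) ^ i * L v ^ (j - i) * (j.choose i) *
            ((S q.2).map fun s => s ^ (j - i)).sum) (x, t)).sum := by
      intro x
      rw [Multiset.map_bind, Multiset.sum_bind]
      congr 1
      refine Multiset.map_congr rfl fun t _ => ?_
      dsimp only
      rw [← Multiset.sum_map_add_mul_pow, Multiset.map_map]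
      simp
    simp only [h1]
    refine hgood.analyticAt_sum hR (H := fun q : ℂ × ℂ =>
          ∑ i ∈ Finset.range (j + 1), L (A q.2) ^ i * L v ^ (j - i) * (j.choose i) *
            ((S q.2).map fun s => s ^ (j - i)).sum) fun t ht => ?_
    refine Finset.analyticAt_fun_sum _ fun i _ => ?_
    have h2 := (hall t (hsub t ht)).1.1
    have h3 : AnalyticAt ℂ (fun q : ℂ × ℂ => L (A q.2)) (0, t) :=
      (L.analyticAt _).comp (AnalyticAt.fun_comp (f := fun q : ℂ × ℂ => q.2) h2 analyticAt_snd)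
    refine (((h3.fun_pow i).fun_mul analyticAt_const).fun_mul analyticAt_const).fun_mul ?_
    exact AnalyticAt.fun_comp (f := fun q : ℂ × ℂ => q.2) (x := (0, t))
      (g := fun t => ((S t).map fun s => s ^ (j - i)).sum) ((hall t (hsub t ht)).2.2 (j - i)) analyticAt_snd
  · have hp : Tendsto p (𝓝 0) (𝓝 0) := by simpa using p.continuous.tendsto 0
    filter_upwards [hp.eventually hgood.eventually] with z hz
    simp only [Multiset.mem_bind, Multiset.mem_map]
    constructor
    · rintro ⟨t, ht, s, hs, rfl⟩
      refine ⟨t, ?_, s, hs, rfl⟩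
      rw [(hz.isZeroMultiset hR).mem_iff]
      exact ⟨ht, by simp [hΦ, hpv]⟩
    · rintro ⟨t, ht, s, hs, rfl⟩
      exact ⟨t, ((hz.isZeroMultiset hR).mem_iff.1 ht).1, s, hs, rfl⟩

end FiniteFibers

/-! ### Splitting the zeros by rate of decay -/

section Splitting

/-- The cofactor must reproduce `ψ` on all of `ℂ`, so it is corrected by `(ψ - φ)` over the product,
a term that vanishes near the closed disk. -/
theorem IsZeroMultiset.congr {φ ψ : ℂ → ℂ} {c : ℂ} {R : ℝ} {S : Multiset ℂ}
    (h : IsZeroMultiset φ c R S) (heq : ∀ z ∈ Metric.closedBall c R, φ =ᶠ[𝓝 z] ψ) :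
    IsZeroMultiset ψ c R S := by
  obtain ⟨h1, u, hu, hu0, hφ⟩ := h
  refine ⟨h1, fun z => u z + (ψ z - φ z) / (S.map fun a => z - a).prod, fun z hz => ?_,
    fun z hz => ?_, fun z => ?_⟩
  · refine (hu z hz).congr ?_
    filter_upwards [heq z hz] with w hw
    simp [hw]
  · simpa [(heq z hz).self_of_nhds] using hu0 z hz
  · by_cases hz : (S.map fun a => z - a).prod = 0
    · obtain ⟨a, ha, haz⟩ := Multiset.mem_map.1 (Multiset.prod_eq_zero_iff.1 hz)
      rw [sub_eq_zero] at haz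
      subst haz
      rw [← (heq z (Metric.ball_subset_closedBall (h1 z ha))).self_of_nhds, hφ z, hz]
      simp
    · rw [mul_add, ← hφ z, mul_div_cancel₀ _ hz]
      ring

theorem IsZeroMultiset.eq_pow_mul {φ : ℂ → ℂ} {c a : ℂ} {R : ℝ} {S : Multiset ℂ}
    (h : IsZeroMultiset φ c R S) (hS : ∀ b ∈ S, b = a) (ha : a ∈ Metric.closedBall c R) :
    ∃ u : ℂ → ℂ, AnalyticAt ℂ u a ∧ u a ≠ 0 ∧ ∀ z, φ z = (z - a) ^ S.card * u z := by
  obtain ⟨-, u, hu, hu0, hφ⟩ := h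
  refine ⟨u, hu a ha, hu0 a ha, fun z => ?_⟩
  rw [hφ, Multiset.eq_replicate_card.2 hS]
  simp

/-- If `l > n`, cancelling `(z - a) ^ n` and letting `z → a` would give `u a = 0`. -/
theorem le_of_pow_mul_eq {a : ℂ} {n l : ℕ} {u w : ℂ → ℂ} (hu : ContinuousAt u a) (hu0 : u a ≠ 0)
    (hw : ContinuousAt w a) (h : ∀ᶠ z in 𝓝 a, (z - a) ^ n * u z = (z - a) ^ l * w z) : l ≤ n := by
  by_contra hlt
  push Not at hlt
  obtain ⟨i, rfl⟩ : ∃ i, l = n + (i + 1) := ⟨l - n - 1, by omega⟩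
  have h1 : ∀ᶠ z in 𝓝[≠] a, u z = (z - a) ^ (i + 1) * w z := by
    filter_upwards [h.filter_mono nhdsWithin_le_nhds, self_mem_nhdsWithin] with z hz hza
    have : (z - a) ^ n ≠ 0 := pow_ne_zero _ (sub_ne_zero.2 hza)
    rw [pow_add, mul_assoc] at hz
    exact mul_left_cancel₀ this hz
  have h2 : ContinuousAt (fun z => (z - a) ^ (i + 1) * w z) a := by fun_prop
  have h3 := tendsto_nhds_unique_of_eventuallyEq (hu.tendsto.mono_left nhdsWithin_le_nhds)
    (h2.tendsto.mono_left nhdsWithin_le_nhds) h1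
  exact hu0 (by simpa using h3)

theorem exists_closedBall_ne_zero {φ : ℂ → ℂ} {a : ℂ} (h : AnalyticAt ℂ φ a)
    (h0 : ¬ ∀ᶠ z in 𝓝 a, φ z = 0) {P : ℂ → Prop} (hP : ∀ᶠ z in 𝓝 a, P z) :
    ∃ R > 0, ∀ z ∈ Metric.closedBall a R, (z ≠ a → φ z ≠ 0) ∧ P z := by
  have h1 := h.eventually_eq_zero_or_eventually_ne_zero.resolve_left h0
  rw [eventually_nhdsWithin_iff] at h1
  obtain ⟨r, hr, hr'⟩ := Metric.nhds_basis_closedBall.eventually_iff.1 (h1.and hP)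
  exact ⟨r, hr, fun z hz => ⟨fun hza => (hr' hz).1 hza, (hr' hz).2⟩⟩

open Classical in
/-- The zeros of a slice, rescaled to a small disk. -/
theorem IsZeroMultiset.filter_scale {φ ψ : ℂ → ℂ} {δ ε : ℝ} {S : Multiset ℂ} {σ₀ κ e : ℂ}
    (hS : IsZeroMultiset φ 0 δ S) (hκ : κ ≠ 0) (he : e ≠ 0)
    (hsub : ∀ σ ∈ Metric.closedBall σ₀ ε, κ * σ ∈ Metric.closedBall (0 : ℂ) δ)
    (hψ : ∀ σ ∈ Metric.closedBall σ₀ ε, ∀ᶠ σ' in 𝓝 σ, φ (κ * σ') = e * ψ σ')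
    (hψ0 : ∀ σ ∈ Metric.sphere σ₀ ε, ψ σ ≠ 0) :
    IsZeroMultiset ψ σ₀ ε
      ((S.filter fun s => s / κ ∈ Metric.ball σ₀ ε).map fun s => s / κ) := by
  have hS' := hS
  obtain ⟨h1, u, hu, hu0, hφ⟩ := hS
  have key : IsZeroMultiset (fun σ => φ (κ * σ) / e) σ₀ ε
      ((S.filter fun s => s / κ ∈ Metric.ball σ₀ ε).map fun s => s / κ) := by
    refine ⟨fun a ha => ?_, fun σ => κ ^ (S.filter fun s => s / κ ∈ Metric.ball σ₀ ε).card *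
      ((S.filter fun s => ¬ s / κ ∈ Metric.ball σ₀ ε).map fun a => κ * σ - a).prod *
        u (κ * σ) / e, fun σ hσ => ?_, fun σ hσ => ?_, fun σ => ?_⟩
    · obtain ⟨s, hs, rfl⟩ := Multiset.mem_map.1 ha
      exact (Multiset.mem_filter.1 hs).2
    · have hlin : AnalyticAt ℂ (fun σ => κ * σ) σ := analyticAt_const.fun_mul analyticAt_id
      refine ((analyticAt_const.fun_mul ?_).fun_mul
        ((hu _ (hsub σ hσ)).fun_comp hlin)).fun_div analyticAt_const he
      generalize (S.filter fun s => ¬ s / κ ∈ Metric.ball σ₀ ε) = T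
      induction T using Multiset.induction_on with
      | empty => simpa using analyticAt_const
      | cons a T ih =>
        simp only [Multiset.map_cons, Multiset.prod_cons]
        exact (hlin.fun_sub analyticAt_const).fun_mul ih
    · refine div_ne_zero (mul_ne_zero (mul_ne_zero (pow_ne_zero _ hκ) ?_) (hu0 _ (hsub σ hσ))) he
      intro hprod
      obtain ⟨a, ha, haz⟩ := Multiset.mem_map.1 (Multiset.prod_eq_zero_iff.1 hprod)
      rw [sub_eq_zero] at haz
      obtain ⟨haS, hab⟩ := Multiset.mem_filter.1 ha
      have hσa : σ = a / κ := by rw [← haz, mul_div_cancel_left₀ _ hκ]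
      rw [← hσa] at hab
      have hsph : σ ∈ Metric.sphere σ₀ ε := by
        rw [Metric.mem_sphere]
        exact le_antisymm hσ (not_lt.1 hab)
      have h2 := (hψ σ hσ).self_of_nhds
      rw [haz, (hS'.mem_iff.1 haS).2] at h2
      exact (mul_ne_zero he (hψ0 σ hsph)) h2.symm
    · have h4 := congrArg (fun T => (T.map fun a => κ * σ - a).prod)
        (Multiset.filter_add_not (fun s => s / κ ∈ Metric.ball σ₀ ε) S)
      simp only [Multiset.map_add, Multiset.prod_add] at h4
      dsimp only
      rw [hφ, ← h4, Multiset.map_map]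
      have h3 : ∀ T : Multiset ℂ, (T.map fun a => κ * σ - a).prod =
          κ ^ T.card * (T.map ((fun a => σ - a) ∘ fun s => s / κ)).prod := by
        intro T
        induction T using Multiset.induction_on with
        | empty => simp
        | cons a T ih =>
          simp only [Multiset.map_cons, Multiset.prod_cons, ih, Multiset.card_cons,
            Function.comp_apply]
          rw [pow_succ]
          field_simp
      rw [h3 (S.filter fun s => s / κ ∈ Metric.ball σ₀ ε)]
      ring
  refine key.congr fun σ hσ => ?_
  filter_upwards [hψ σ hσ] with σ' hσ'
  rw [hσ', mul_div_cancel_left₀ _ he]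

/-- The zeros `s` of `G (t, ·)` near `0` split, according to the limit of `s / tᵏ`, into two
nonempty families with analytic power sums. -/
theorem exists_splitting {G K : ℂ × ℂ → ℂ} {k e l : ℕ} {σ₀ : ℂ} (hk : k ≠ 0)
    (hG : AnalyticAt ℂ G (0, 0)) (hK : ∀ σ, AnalyticAt ℂ K (0, σ))
    (hGK : ∀ σ, ∀ᶠ q : ℂ × ℂ in 𝓝 (0, σ), G (q.1, q.1 ^ k * q.2) = q.1 ^ e * K q)
    (hG0 : ¬ ∀ᶠ s in 𝓝 0, G (0, s) = 0)
    (hGl : ∃ w : ℂ → ℂ, ContinuousAt w 0 ∧ ∀ᶠ s in 𝓝 0, G (0, s) = s ^ l * w s)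
    (hKσ : K (0, σ₀) = 0)
    (hKl : ¬ ∃ w : ℂ → ℂ, AnalyticAt ℂ w σ₀ ∧ ∀ᶠ σ in 𝓝 σ₀, K (0, σ) = (σ - σ₀) ^ l * w σ) :
    ∃ δ > 0, ∃ (S : Fin 2 → ℂ → Multiset ℂ) (N : Fin 2 → ℕ), (∀ i, 0 < N i) ∧
      (∀ i, ∀ᶠ t in 𝓝 0, (S i t).card = N i) ∧
      (∀ i, ∀ᶠ t in 𝓝 0, ∀ j : ℕ, AnalyticAt ℂ (fun t => ((S i t).map fun s => s ^ j).sum) t) ∧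
      (∀ᶠ t in 𝓝 0, ∀ s, (∃ i, s ∈ S i t) ↔ s ∈ Metric.ball 0 δ ∧ G (t, s) = 0) ∧
      (∀ᶠ t in 𝓝[≠] 0, ∀ s ∈ S 0 t, s ∉ S 1 t) ∧
      ∀ η > 0, ∀ᶠ t in 𝓝 0, ∀ i, ∀ s ∈ S i t, ‖s‖ < η := by
  classical
  obtain ⟨δ, hδ, hδ'⟩ := exists_closedBall_ne_zero hG.slice hG0
    (((continuous_const.prodMk continuous_id).tendsto (0 : ℂ)).eventually
      hG.eventually_analyticAt)
  have hK0 : ¬ ∀ᶠ σ in 𝓝 σ₀, K (0, σ) = 0 := fun h =>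
    hKl ⟨0, analyticAt_const, h.mono fun σ hσ => by simp [hσ]⟩
  obtain ⟨ε, hε, hε'⟩ := exists_closedBall_ne_zero (hK σ₀).slice hK0 (P := fun _ => True) (by simp)
  have gG : IsGoodAt G 0 δ 0 := by
    refine ⟨fun s hs => (hδ' s hs).2, fun s hs => (hδ' s (Metric.sphere_subset_closedBall hs)).1 ?_⟩
    rintro rfl
    simp [hδ.ne] at hs
  have gK : IsGoodAt K σ₀ ε 0 := by
    refine ⟨fun s _ => hK s, fun s hs => (hε' s (Metric.sphere_subset_closedBall hs)).1 ?_⟩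
    rintro rfl
    simp [hε.ne] at hs
  have zG := gG.isZeroMultiset hδ
  have zK := gK.isZeroMultiset hε
  set d := (zerosAt K σ₀ ε 0).card with hd
  set n := (zerosAt G 0 δ 0).card with hn
  have sG : ∀ s ∈ zerosAt G 0 δ 0, s = 0 := by
    intro s hs
    obtain ⟨h1, h2⟩ := zG.mem_iff.1 hs
    by_contra h
    exact (hδ' s (Metric.ball_subset_closedBall h1)).1 h h2
  have sK : ∀ s ∈ zerosAt K σ₀ ε 0, s = σ₀ := by
    intro s hs
    obtain ⟨h1, h2⟩ := zK.mem_iff.1 hs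
    by_contra h
    exact (hε' s (Metric.ball_subset_closedBall h1)).1 h h2
  have hd0 : 0 < d := Multiset.card_pos_iff_exists_mem.2
    ⟨σ₀, zK.mem_iff.2 ⟨Metric.mem_ball_self hε, hKσ⟩⟩
  -- All `d` zeros of `K (0, ·)` in the small disk sit at `σ₀`, so `d` is the order there; likewise
  -- `n` is the order of `G (0, ·)` at `0`. Hence `0 < d < l ≤ n`, and both families are nonempty.
  have hdl : d < l := by
    by_contra hle
    push Not at hle
    obtain ⟨u, hu, -, hu'⟩ := zK.eq_pow_mul sK (Metric.mem_closedBall_self hε.le)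
    refine hKl ⟨fun σ => (σ - σ₀) ^ (d - l) * u σ,
      ((analyticAt_id.fun_sub analyticAt_const).fun_pow _).fun_mul hu, .of_forall fun σ => ?_⟩
    rw [hu', ← mul_assoc, ← pow_add, Nat.add_sub_cancel' hle]
  have hln : l ≤ n := by
    obtain ⟨u, hu, hu0, hu'⟩ := zG.eq_pow_mul sG (Metric.mem_closedBall_self hδ.le)
    obtain ⟨w, hw, hw'⟩ := hGl
    refine le_of_pow_mul_eq hu.continuousAt hu0 hw ?_
    filter_upwards [hw'] with s hs
    rw [← hu', hs, sub_zero]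
  have rG : zerosAt G 0 δ 0 = Multiset.replicate n 0 := Multiset.eq_replicate_card.2 sG
  -- the relation between the two families
  have hcl : ∀ᶠ t in 𝓝 (0 : ℂ), ∀ σ ∈ Metric.closedBall σ₀ ε,
      ∀ᶠ q : ℂ × ℂ in 𝓝 (t, σ), G (q.1, q.1 ^ k * q.2) = q.1 ^ e * K q :=
    (isCompact_closedBall σ₀ ε).eventually_forall_of_forall_eventually fun σ _ =>
      eventually_eventually_nhds.2 (hGK σ)
  have hsub : ∀ᶠ t in 𝓝 (0 : ℂ), ∀ σ ∈ Metric.closedBall σ₀ ε,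
      t ^ k * σ ∈ Metric.ball (0 : ℂ) δ := by
    refine (isCompact_closedBall σ₀ ε).eventually_forall_of_forall_eventually fun σ _ => ?_
    have hc : Continuous fun q : ℂ × ℂ => q.1 ^ k * q.2 := by fun_prop
    exact hc.continuousAt.eventually_mem (by simpa [hk] using Metric.ball_mem_nhds (0 : ℂ) hδ)
  -- At `t = 0` the quotient `s / t ^ k` carries no information; the zeros collapse to `0`, and the
  -- multiplicities `d` and `n - d` are prescribed so that the power sums stay analytic there.
  set B : ℂ → Multiset ℂ := fun t => if t = 0 then Multiset.replicate d 0 else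
    (zerosAt G 0 δ t).filter fun s => s / t ^ k ∈ Metric.ball σ₀ ε with hB
  set C : ℂ → Multiset ℂ := fun t => if t = 0 then Multiset.replicate (n - d) 0 else
    (zerosAt G 0 δ t).filter fun s => ¬ s / t ^ k ∈ Metric.ball σ₀ ε with hC
  have hBC : ∀ t, B t + C t = zerosAt G 0 δ t := by
    intro t
    by_cases ht : t = 0
    · subst ht
      simp only [hB, hC, if_true, rG]
      rw [← Multiset.replicate_add, Nat.add_sub_cancel' (by omega)]
    · simp only [hB, hC, if_neg ht]
      exact Multiset.filter_add_not _ _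
  -- The rescaled family consists of the zeros of `K (t, ·)` near `σ₀`, which is analytic across `t
  -- = 0`. The residue formula for both descriptions avoids proving that zero multisets are unique.
  have hBsum : ∀ᶠ t in 𝓝 0, ∀ j : ℕ, ((B t).map fun s => s ^ j).sum =
      ((zerosAt K σ₀ ε t).map fun σ => (t ^ k * σ) ^ j).sum := by
    filter_upwards [gG.eventually, gK.eventually, hcl, hsub] with t tG tK tcl tsub j
    by_cases ht : t = 0
    · subst ht
      simp [hB, hk, hd]
    · have htk : t ^ k ≠ 0 := pow_ne_zero _ ht
      have h1 := (tG.isZeroMultiset hδ).filter_scale (ψ := fun σ => K (t, σ)) (σ₀ := σ₀) (ε := ε)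
        htk (pow_ne_zero e ht) (fun σ hσ => Metric.ball_subset_closedBall (tsub σ hσ))
        (fun σ hσ => ((continuous_const.prodMk continuous_id).tendsto σ).eventually (tcl σ hσ)) tK.2
      have hpoly : AnalyticOnNhd ℂ (fun σ => (t ^ k * σ) ^ j) (Metric.closedBall σ₀ ε) :=
        fun σ _ => (analyticAt_const.fun_mul analyticAt_id).fun_pow j
      rw [(tK.isZeroMultiset hε).integral_eq hε hpoly, ← h1.integral_eq hε hpoly]
      simp only [hB, if_neg ht, Multiset.map_map, Function.comp_def]
      congr 1
      exact Multiset.map_congr rfl fun s _ => by rw [mul_div_cancel₀ _ htk]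
  have hBan : ∀ᶠ t in 𝓝 0, ∀ j : ℕ, AnalyticAt ℂ (fun t => ((B t).map fun s => s ^ j).sum) t := by
    filter_upwards [gK.eventually, eventually_eventually_nhds.2 hBsum] with t tK hs j
    have h1 := tK.analyticAt_sum hε (H := fun q : ℂ × ℂ => (q.1 ^ k * q.2) ^ j)
      fun s _ => ((analyticAt_fst.fun_pow k).fun_mul analyticAt_snd).fun_pow j
    refine h1.congr ?_
    filter_upwards [hs] with t' ht'
    exact (ht' j).symm
  -- The power sums of the complement are those of all zeros minus those of `B`.
  have hCan : ∀ᶠ t in 𝓝 0, ∀ j : ℕ, AnalyticAt ℂ (fun t => ((C t).map fun s => s ^ j).sum) t := by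
    filter_upwards [gG.eventually, hBan] with t tG hs j
    have h1 := tG.analyticAt_sum hδ (H := fun q : ℂ × ℂ => q.2 ^ j)
      fun s _ => analyticAt_snd.fun_pow j
    refine (h1.fun_sub (hs j)).congr (.of_forall fun t' => ?_)
    simp only [← hBC t', Multiset.map_add, Multiset.sum_add, add_sub_cancel_left]
  have hcard : ∀ T : ℂ → Multiset ℂ, (∀ᶠ t in 𝓝 0, ∀ j : ℕ,
      AnalyticAt ℂ (fun t => ((T t).map fun s => s ^ j).sum) t) →
      ∀ᶠ t in 𝓝 0, (T t).card = (T 0).card := by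
    intro T hT
    refine eventually_eq_of_continuousAt_natCast (N := fun t => (T t).card) ?_
    -- The cardinality is the power sum with exponent `0`.
    simpa using (hT.self_of_nhds 0).continuousAt
  refine ⟨δ, hδ, ![B, C], ![d, n - d], ?_, ?_, ?_, ?_, ?_, ?_⟩
  · rw [Fin.forall_fin_two]
    exact ⟨hd0, show 0 < n - d by omega⟩
  · rw [Fin.forall_fin_two]
    refine ⟨(hcard B hBan).mono fun t ht => ?_, (hcard C hCan).mono fun t ht => ?_⟩
    · simpa [hB] using ht
    · simpa [hC] using ht
  · rw [Fin.forall_fin_two]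
    exact ⟨hBan, hCan⟩
  · filter_upwards [gG.eventually] with t tG s
    rw [← (tG.isZeroMultiset hδ).mem_iff, ← hBC, Multiset.mem_add, Fin.exists_fin_two]
    rfl
  · filter_upwards [self_mem_nhdsWithin] with t ht s hsB hsC
    have ht' : t ≠ 0 := ht
    simp only [Matrix.cons_val_zero, Matrix.cons_val_one, hB, hC, if_neg ht',
      Multiset.mem_filter] at hsB hsC
    exact hsC.2 hsB.2
  · intro η hη
    have hcomp : IsCompact (Metric.closedBall (0 : ℂ) δ \ Metric.ball 0 η) :=
      (isCompact_closedBall _ _).diff Metric.isOpen_ball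
    have h1 : ∀ᶠ t in 𝓝 (0 : ℂ), ∀ s ∈ Metric.closedBall (0 : ℂ) δ \ Metric.ball 0 η,
        G (t, s) ≠ 0 :=
      hcomp.eventually_forall_of_forall_eventually fun s hs =>
        (gG.1 s hs.1).continuousAt.eventually_ne ((hδ' s hs.1).1 fun h => hs.2 (by simp [h, hη]))
    filter_upwards [h1, gG.eventually] with t ht tG i s hs
    have hs' : s ∈ zerosAt G 0 δ t := by
      rw [← hBC, Multiset.mem_add]
      fin_cases i
      · exact Or.inl hs
      · exact Or.inr hs
    obtain ⟨h2, h3⟩ := (tG.isZeroMultiset hδ).mem_iff.1 hs'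
    by_contra hlt
    exact ht s ⟨Metric.ball_subset_closedBall h2, fun h => hlt (by simpa using h)⟩ h3

end Splitting

/-! ### Restriction of the quartic to lines -/

section Lines

theorem eval_aeval_line {m : ℕ} (f : MvPolynomial (Fin m) ℂ) (p q : Fin m → ℂ) (x : ℂ) :
    (MvPolynomial.aeval (fun i => Polynomial.C (p i) + Polynomial.C (q i) * Polynomial.X) f :
      Polynomial ℂ).eval x = MvPolynomial.eval (p + x • q) f := by
  rw [← Polynomial.coe_aeval_eq_eval]
  change Polynomial.aeval x _ = _
  rw [MvPolynomial.comp_aeval_apply, MvPolynomial.aeval_eq_eval]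
  congr 2
  funext i
  rw [map_add, map_mul, Polynomial.aeval_C, Polynomial.aeval_C, Polynomial.aeval_X]
  exact congrArg (p i + ·) (mul_comm _ _)

theorem X_pow_dvd_of_eventually_eq {P : Polynomial ℂ} {l : ℕ} {w : ℂ → ℂ} (hw : ContinuousAt w 0)
    (h : ∀ᶠ x in 𝓝 0, P.eval x = x ^ l * w x) : Polynomial.X ^ l ∣ P := by
  rcases eq_or_ne P 0 with rfl | hP
  · exact dvd_zero _
  obtain ⟨Q, hQ, hQ0⟩ := P.exists_eq_pow_rootMultiplicity_mul_and_not_dvd hP 0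
  rw [Polynomial.dvd_iff_isRoot, Polynomial.IsRoot.def] at hQ0
  rw [Polynomial.C_0, sub_zero] at hQ
  have : l ≤ P.rootMultiplicity 0 := by
    refine le_of_pow_mul_eq (a := 0) (u := fun x => Q.eval x) Q.continuous.continuousAt hQ0 hw ?_
    filter_upwards [h] with x hx
    rw [sub_zero, ← hx]
    conv_rhs => rw [hQ]
    simp
  rw [hQ]
  exact (pow_dvd_pow _ this).mul_right _

variable {f : MvPolynomial (Fin 3) ℂ}

/-- A nonzero constant restriction `c` becomes `c * X ^ 4` when the line is parametrized from `q`,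
making `[q]` a hyperflex. The zero restriction has degree `⊥`, hence falls into the case with a
root. -/
theorem exists_root_on_line (hf : f.IsHomogeneous 4) (hflex : ¬ HasHyperflex f)
    {p q : Fin 3 → ℂ} (hpq : LinearIndependent ℂ ![p, q]) :
    ∃ x : ℂ, MvPolynomial.eval (p + x • q) f = 0 := by
  set P : Polynomial ℂ :=
    MvPolynomial.aeval (fun i => Polynomial.C (p i) + Polynomial.C (q i) * Polynomial.X) f with hP
  by_cases hdeg : P.degree = 0
  · exfalso
    rw [Polynomial.eq_C_of_degree_eq_zero hdeg] at hP
    set c := P.coeff 0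
    refine hflex ⟨q, p, LinearIndependent.pair_symm_iff.1 hpq, ?_⟩
    set P' : Polynomial ℂ :=
      MvPolynomial.aeval (fun i => Polynomial.C (q i) + Polynomial.C (p i) * Polynomial.X) f
    have hval : ∀ x : ℂ, x ≠ 0 → P'.eval x = (Polynomial.C c * Polynomial.X ^ 4).eval x := by
      intro x hx
      rw [eval_aeval_line]
      have h1 : q + x • p = x • (p + x⁻¹ • q) := by
        rw [smul_add, smul_smul, mul_inv_cancel₀ hx, one_smul, add_comm]
      rw [h1, eval_smul_of_isHomogeneous hf, ← eval_aeval_line, ← hP, Polynomial.eval_C,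
        Polynomial.eval_mul, Polynomial.eval_C, Polynomial.eval_pow, Polynomial.eval_X, mul_comm]
    have : P' = Polynomial.C c * Polynomial.X ^ 4 :=
      Polynomial.eq_of_infinite_eval_eq _ _ <|
        (Set.finite_singleton (0 : ℂ)).infinite_compl.mono fun x hx => hval x hx
    rw [this]
    exact dvd_mul_left _ _
  · obtain ⟨x, hx⟩ := IsAlgClosed.exists_root P hdeg
    exact ⟨x, by rw [← eval_aeval_line]; exact hx⟩

theorem not_exists_pow_four_mul (hflex : ¬ HasHyperflex f) {p q : Fin 3 → ℂ}
    (hpq : LinearIndependent ℂ ![p, q]) (x₀ : ℂ) : ¬ ∃ w : ℂ → ℂ, AnalyticAt ℂ w x₀ ∧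
      ∀ᶠ x in 𝓝 x₀, MvPolynomial.eval (p + x • q) f = (x - x₀) ^ 4 * w x := by
  rintro ⟨w, hw, heq⟩
  have ht : Tendsto (fun x : ℂ => x₀ + x) (𝓝 0) (𝓝 x₀) := by
    have : Continuous fun x : ℂ => x₀ + x := by fun_prop
    simpa using this.tendsto 0
  refine hflex ⟨p + x₀ • q, q, ?_, X_pow_dvd_of_eventually_eq (w := fun x => w (x₀ + x)) ?_ ?_⟩
  · rw [LinearIndependent.pair_iff] at hpq ⊢
    intro a b hab
    obtain ⟨h1, h2⟩ := hpq a (a * x₀ + b) (by rw [← hab]; module)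
    subst h1
    simpa using h2
  · exact ContinuousAt.comp (f := fun x : ℂ => x₀ + x) (by simpa using hw.continuousAt)
      (by fun_prop)
  · filter_upwards [ht.eventually heq] with x hx
    rw [eval_aeval_line, add_assoc, ← add_smul, hx]
    simp

end Lines

/-! ### Reducibility of arc-sections -/

section ArcSection

variable {X : Set (Fin 3 → ℂ)} {F : (Fin 3 → ℂ) → ℂ} {f : MvPolynomial (Fin 3) ℂ}

theorem isBigO_eval_of_isHomogeneous {m d : ℕ} {f : MvPolynomial (Fin m) ℂ}
    (hf : f.IsHomogeneous d) (l : Filter (Fin m → ℂ)) :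
    (fun x => MvPolynomial.eval x f) =O[l] fun x : Fin m → ℂ => ‖x‖ ^ d := by
  simp only [MvPolynomial.eval_eq']
  refine IsBigO.fun_sum fun e he => ?_
  have h1 : ∑ i, e i = d := by
    have := hf (MvPolynomial.mem_support_iff.1 he)
    rw [← this, Finsupp.weight_apply, Finsupp.sum_fintype _ _ (by simp)]
    simp
  refine IsBigO.of_bound ‖MvPolynomial.coeff e f‖ (.of_forall fun x => ?_)
  rw [norm_mul, norm_prod, ← h1, ← Finset.prod_pow_eq_pow_sum, norm_prod]
  gcongr with i _
  rw [norm_pow, norm_pow, norm_norm]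
  gcongr
  exact norm_le_pi_norm x i

theorem HasInitialForm.isBigO {m d : ℕ} {F : (Fin m → ℂ) → ℂ} {f : MvPolynomial (Fin m) ℂ}
    (hF : HasInitialForm F d f) : F =O[𝓝 0] fun x => ‖x‖ ^ d := by
  obtain ⟨-, hf, -, hO⟩ := hF
  have h1 : (fun x : Fin m → ℂ => ‖x‖ ^ (d + 1)) =O[𝓝 0] fun x => ‖x‖ ^ d := by
    simp only [pow_succ]
    have : (fun x : Fin m → ℂ => ‖x‖) =O[𝓝 0] fun _ => (1 : ℝ) :=
      (continuous_norm.tendsto 0).isBigO_one ℝ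
    simpa using (isBigO_refl (fun x : Fin m → ℂ => ‖x‖ ^ d) (𝓝 0)).mul this
  simpa using (hO.trans h1).add (isBigO_eval_of_isHomogeneous hf (𝓝 0))

/-- On each line through `0` the polynomial is a multiple of `τ ^ d` that is `O(τ ^ (d + 1))`. This
makes initial forms unique. -/
theorem eval_eq_zero_of_isBigO {m d : ℕ} {Q : MvPolynomial (Fin m) ℂ} (hQ : Q.IsHomogeneous d)
    (hO : (fun x => MvPolynomial.eval x Q) =O[𝓝 0] fun x : Fin m → ℂ => ‖x‖ ^ (d + 1)) (w : Fin m → ℂ) :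
    MvPolynomial.eval w Q = 0 := by
  have h1 := isBigO_smul_line hO w
  simp only [eval_smul_of_isHomogeneous hQ] at h1
  have := sum_pow_mul_eq_zero_of_isBigO (n := d + 1) (R := fun _ => 0)
    (c := fun j => if j = d then MvPolynomial.eval w Q else 0) continuousAt_const
    (by simpa using h1) d (by omega)
  simpa using this

/-- The strict transform of a germ with given initial form. -/
theorem HasInitialForm.exists_leading {m d : ℕ} {F : (Fin m → ℂ) → ℂ}
    {f : MvPolynomial (Fin m) ℂ} (hF : HasInitialForm F d f) :
    ∃ Θ : ℂ × (Fin m → ℂ) → ℂ, (∀ w, AnalyticAt ℂ Θ (0, w)) ∧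
      (∀ w, Θ (0, w) = MvPolynomial.eval w f) ∧
      ∀ᶠ x in 𝓝 0, ∀ (τ : ℂ) (w : Fin m → ℂ), τ • w = x → F x = τ ^ d * Θ (τ, w) := by
  obtain ⟨Q, Θ, hQ, hΘ, hΘQ, heq, hO⟩ := hF.1.exists_leading hF.isBigO
  refine ⟨Θ, hΘ, fun w => ?_, heq⟩
  rw [hΘQ, ← sub_eq_zero, ← map_sub]
  refine eval_eq_zero_of_isBigO (hQ.sub hF.2.1) ?_ w
  refine (hF.2.2.2.sub hO).congr_left fun x => ?_
  rw [map_sub]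
  ring

theorem exists_kernel_generator {n : ℕ} {π : (Fin (n + 1) → ℂ) →ₗ[ℂ] (Fin n → ℂ)}
    (hπ : Function.Surjective π) : ∃ v, v ≠ 0 ∧ π v = 0 ∧ ∀ x, π x = 0 → ∃ c : ℂ, x = c • v := by
  have h1 := π.finrank_range_add_finrank_ker
  rw [LinearMap.range_eq_top.2 hπ, finrank_top] at h1
  simp only [Module.finrank_fintype_fun_eq_card, Fintype.card_fin] at h1
  have h2 : Module.finrank ℂ (LinearMap.ker π) = 1 := by omega
  obtain ⟨⟨v, hv⟩, hv0, hall⟩ := finrank_eq_one_iff'.1 h2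
  refine ⟨v, fun h => hv0 (Subtype.ext h), hv, fun x hx => ?_⟩
  obtain ⟨c, hc⟩ := hall ⟨x, hx⟩
  exact ⟨c, (congrArg Subtype.val hc).symm⟩

/-- By injectivity the image of the parameters outside the ball is a compact set missing `0`. Thus
the germ of an arc-section sees only small parameters. -/
theorem eventually_mem_ball_of_injOn {n : ℕ} {α : ℂ → (Fin n → ℂ)} {r R : ℝ}
    (hα : IsInjectiveArc α r) (hR : 0 < R) :
    ∀ᶠ y in 𝓝 0, ∀ t ∈ Metric.closedBall (0 : ℂ) r, α t = y → t ∈ Metric.ball (0 : ℂ) R := by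
  obtain ⟨hr, han, hinj, h0⟩ := hα
  have hcomp : IsCompact (α '' (Metric.closedBall 0 r \ Metric.ball 0 R)) :=
    ((isCompact_closedBall _ _).diff Metric.isOpen_ball).image_of_continuousOn
      (han.continuousOn.mono Set.sdiff_subset)
  have h0' : (0 : Fin n → ℂ) ∈ (α '' (Metric.closedBall 0 r \ Metric.ball 0 R))ᶜ := by
    rintro ⟨t, ht, hat⟩
    have := hinj ht.1 (Metric.mem_closedBall_self hr.le) (hat.trans h0.symm)
    exact ht.2 (this ▸ Metric.mem_ball_self hR)
  filter_upwards [hcomp.isClosed.isOpen_compl.mem_nhds h0'] with y hy t ht hty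
  by_contra htR
  exact hy ⟨t, ⟨ht, htR⟩, hty⟩

theorem isReducibleGermAt_arcSection (hF : HasInitialForm F 4 f) (hflex : ¬ HasHyperflex f)
    (hX : X =ᶠ[𝓝 0] {x | F x = 0}) {π : (Fin (2 + 1) → ℂ) →ₗ[ℂ] (Fin 2 → ℂ)}
    (hπ : IsFiniteProjection X π) {α : ℂ → (Fin 2 → ℂ)} {r : ℝ} (hα : IsInjectiveArc α r) :
    IsReducibleGermAt (arcSection X π α r) 0 := by
  obtain ⟨hsurj, hfin⟩ := hπ
  obtain ⟨hr, han, hinj, hα0⟩ := id hα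
  obtain ⟨v, hv0, hπv, hker⟩ := exists_kernel_generator hsurj
  obtain ⟨ι₀, hι₀⟩ := π.exists_rightInverse_of_surjective (LinearMap.range_eq_top.2 hsurj)
  set ι : (Fin 2 → ℂ) →L[ℂ] (Fin (2 + 1) → ℂ) := LinearMap.toContinuousLinearMap ι₀
  set π' : (Fin (2 + 1) → ℂ) →L[ℂ] (Fin 2 → ℂ) := LinearMap.toContinuousLinearMap π
  have hπι : ∀ y, π (ι y) = y := fun y => LinearMap.congr_fun hι₀ y
  have hdec : ∀ z, ∃ s : ℂ, z = ι (π z) + s • v := fun z => by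
    obtain ⟨s, hs⟩ := hker (z - ι (π z)) (by rw [map_sub, hπι, sub_self])
    exact ⟨s, by rw [← hs]; abel⟩
  have hαan : AnalyticAt ℂ α 0 := han 0 (Metric.mem_closedBall_self hr.le)
  have hαne : ¬ ∀ᶠ t in 𝓝 0, α t = 0 := by
    intro h
    have h1 : ∀ᶠ t in 𝓝 (0 : ℂ), t = 0 := by
      filter_upwards [h, Metric.closedBall_mem_nhds 0 hr] with t ht htr
      exact hinj htr (Metric.mem_closedBall_self hr.le) (ht.trans hα0.symm)
    have h2 := (h1.filter_mono (nhdsWithin_le_nhds (s := {0}ᶜ))).and self_mem_nhdsWithin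
    obtain ⟨t, ht, ht'⟩ := h2.exists
    exact ht' ht
  obtain ⟨k, a, ha, ha0, hαa⟩ := hαan.exists_eventuallyEq_pow_smul_nonzero_iff.2 hαne
  simp only [sub_zero] at hαa
  have hk : k ≠ 0 := by
    rintro rfl
    have := hαa.self_of_nhds
    rw [hα0] at this
    exact ha0 (by simpa using this.symm)
  obtain ⟨Θ, hΘ, hΘ0, hFΘ⟩ := hF.exists_leading
  have hind : LinearIndependent ℂ ![ι (a 0), v] := by
    rw [LinearIndependent.pair_iff]
    intro x y hxy
    have h1 := congrArg π hxy
    rw [map_add, map_smul, map_smul, hπι, hπv, smul_zero, add_zero, map_zero] at h1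
    have h2 := (smul_eq_zero.1 h1).resolve_right ha0
    subst h2
    rw [zero_smul, zero_add] at hxy
    exact ⟨rfl, (smul_eq_zero.1 hxy).resolve_right hv0⟩
  obtain ⟨σ₀, hσ₀⟩ := exists_root_on_line hF.2.1 hflex hind
  have hA : AnalyticAt ℂ (fun t => ι (α t)) 0 := (ι.analyticAt _).comp hαan
  have hA0 : ι (α 0) = 0 := by rw [hα0, map_zero]
  have hAt : Tendsto (fun t => ι (α t)) (𝓝 0) (𝓝 0) := by
    simpa [hA0] using hA.continuousAt.tendsto
  have hlv : ∀ s₀ : ℂ, AnalyticAt ℂ (fun q : ℂ × ℂ => q.2 • v) (0, s₀) := fun s₀ =>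
    analyticAt_snd.fun_smul analyticAt_const
  -- With `s = t ^ k * σ` the point is `t ^ k • (ι (a t) + σ • v)`, so order four of `F` yields the
  -- factor `t ^ (k * 4)`. Finiteness of the projection gives that `F` is not identically zero on
  -- the kernel line, and the initial degree gives the factor `s ^ 4` there.
  obtain ⟨δ, hδ, S, N, hN, hcard, han', hiff, hdisj, hsmall⟩ := exists_splitting
    (G := fun q => F (ι (α q.1) + q.2 • v)) (K := fun q => Θ (q.1 ^ k, ι (a q.1) + q.2 • v))
    (k := k) (e := k * 4) (l := 4) (σ₀ := σ₀) hk
    (by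
      refine AnalyticAt.fun_comp (f := fun q : ℂ × ℂ => ι (α q.1) + q.2 • v)
        (by simpa [hα0] using hF.1) ?_
      exact (hA.fun_comp (f := fun q : ℂ × ℂ => q.1) (x := (0, 0)) analyticAt_fst).fun_add (hlv 0))
    (by
      intro σ
      refine AnalyticAt.fun_comp (f := fun q : ℂ × ℂ => (q.1 ^ k, ι (a q.1) + q.2 • v))
        (by simpa [hk] using hΘ _) ?_
      refine (analyticAt_fst.fun_pow k).prod (AnalyticAt.fun_add ?_ (hlv σ))
      exact ((ι.analyticAt _).comp ha).fun_comp (f := fun q : ℂ × ℂ => q.1) (x := (0, σ))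
        analyticAt_fst)
    (by
      intro σ
      have h1 : ContinuousAt (fun q : ℂ × ℂ => q.1 ^ k • (ι (a q.1) + q.2 • v)) (0, σ) := by
        have h2 : ContinuousAt (fun q : ℂ × ℂ => a q.1) (0, σ) :=
          ContinuousAt.comp (f := fun q : ℂ × ℂ => q.1) ha.continuousAt (by fun_prop)
        fun_prop
      have h3 : ∀ᶠ q : ℂ × ℂ in 𝓝 (0, σ), α q.1 = q.1 ^ k • a q.1 :=
        (continuous_fst.tendsto ((0, σ) : ℂ × ℂ)).eventually hαa
      have h4 : Tendsto (fun q : ℂ × ℂ => q.1 ^ k • (ι (a q.1) + q.2 • v)) (𝓝 (0, σ)) (𝓝 0) := by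
        simpa [hk] using h1.tendsto
      filter_upwards [h3, h4.eventually hFΘ] with q hq1 hq2
      rw [pow_mul, ← hq2 (q.1 ^ k) _ rfl, hq1, map_smul, smul_add, smul_smul])
    (by
      intro h
      have ht : Tendsto (fun s : ℂ => s • v) (𝓝 0) (𝓝 0) := by
        have : Continuous fun s : ℂ => s • v := by fun_prop
        simpa using this.tendsto 0
      have h1 : ∀ᶠ s in 𝓝 (0 : ℂ), s = 0 := by
        filter_upwards [h, ht.eventually hX.mem_iff, ht.eventually hfin] with s hs hsX hsf
        have h2 := hsf (hsX.2 (by simpa [hα0] using hs)) (by rw [map_smul, hπv, smul_zero])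
        exact (smul_eq_zero.1 h2).resolve_right hv0
      have h2 := (h1.filter_mono (nhdsWithin_le_nhds (s := {0}ᶜ))).and self_mem_nhdsWithin
      obtain ⟨t, ht, ht'⟩ := h2.exists
      exact ht' ht)
    (by
      refine ⟨fun s => Θ (s, v), ContinuousAt.comp (f := fun s : ℂ => (s, v))
        (hΘ v).continuousAt (by fun_prop), ?_⟩
      have ht : Tendsto (fun s : ℂ => s • v) (𝓝 0) (𝓝 0) := by
        have : Continuous fun s : ℂ => s • v := by fun_prop
        simpa using this.tendsto 0
      filter_upwards [ht.eventually hFΘ] with s hs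
      rw [← hs s v rfl, hA0, zero_add])
    (by simpa [hk, hΘ0] using hσ₀)
    (by simpa [hk, hΘ0] using not_exists_pow_four_mul hflex hind σ₀)
  -- A coordinate not vanishing on the tangent direction of the arc has only an isolated zero along
  -- the arc at `t = 0`; it serves as the finite map to the line.
  obtain ⟨i, hi⟩ : ∃ i, a 0 i ≠ 0 := Function.ne_iff.1 ha0
  set p : (Fin (2 + 1) → ℂ) →L[ℂ] ℂ := (ContinuousLinearMap.proj i).comp π'
  have hpz : ∀ z, p z = π z i := fun z => rfl
  have hpA : ∀ᶠ t in 𝓝[≠] 0, p (ι (α t)) ≠ 0 := by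
    have h1 : ContinuousAt (fun t => a t i) 0 :=
      (continuous_apply i).continuousAt.comp ha.continuousAt
    filter_upwards [(h1.eventually_ne hi).filter_mono nhdsWithin_le_nhds,
      hαa.filter_mono nhdsWithin_le_nhds, self_mem_nhdsWithin] with t h1 h2 h3
    rw [hpz, hπι, h2, Pi.smul_apply, smul_eq_mul]
    exact mul_ne_zero (pow_ne_zero _ h3) h1
  choose R₀ hR₀ hcurve using fun j => isAnalyticGermAt_curve (A := fun t => ι (α t)) (v := v) p
    (by rw [hpz, hπv]; rfl) hA hpA (hcard j) (han' j)
  obtain ⟨R₁, hR₁, hR₁'⟩ := Metric.eventually_nhds_iff_ball.1 hiff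
  obtain ⟨R, hR, hRle⟩ : ∃ R > 0, R ≤ R₀ 0 ∧ R ≤ R₀ 1 ∧ R ≤ R₁ ∧ R ≤ r :=
    ⟨min (min (R₀ 0) (R₀ 1)) (min R₁ r), lt_min (lt_min (hR₀ 0) (hR₀ 1)) (lt_min hR₁ hr),
      by simp⟩
  set B : Fin 2 → Set (Fin (2 + 1) → ℂ) := fun j =>
    {z | ∃ t ∈ Metric.ball (0 : ℂ) R, ∃ s ∈ S j t, z = ι (α t) + s • v} with hB
  have hBan : ∀ j, IsAnalyticGermAt (B j) 0 := by
    intro j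
    refine hcurve j R hR ?_
    fin_cases j
    · exact hRle.1
    · exact hRle.2.1
  have hRr : ∀ t ∈ Metric.ball (0 : ℂ) R, t ∈ Metric.closedBall (0 : ℂ) r := fun t ht =>
    Metric.closedBall_subset_closedBall hRle.2.2.2 (Metric.ball_subset_closedBall ht)
  have hRR : ∀ t ∈ Metric.ball (0 : ℂ) R, t ∈ Metric.ball (0 : ℂ) R₁ := fun t ht =>
    Metric.ball_subset_ball hRle.2.2.1 ht
  have hunion : ∀ᶠ z in 𝓝 0, z ∈ arcSection X π α r ↔ ∃ j, z ∈ B j := by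
    have hπt : Tendsto π (𝓝 0) (𝓝 0) := by
      have := π'.continuous.tendsto 0
      rwa [map_zero] at this
    have hst : ∀ᶠ z in 𝓝 (0 : Fin (2 + 1) → ℂ), ‖z - ι (π z)‖ < δ * ‖v‖ := by
      have h1 : Continuous fun z : Fin (2 + 1) → ℂ => ‖z - ι (π' z)‖ := by fun_prop
      have h2 : ‖(0 : Fin (2 + 1) → ℂ) - ι (π' 0)‖ < δ * ‖v‖ := by
        simpa using mul_pos hδ (norm_pos_iff.2 hv0)
      exact h1.continuousAt.eventually_lt_const h2
    filter_upwards [hX.mem_iff, hπt.eventually (eventually_mem_ball_of_injOn hα hR), hst]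
      with z hzX hzt hzs
    constructor
    · rintro ⟨⟨t, ht, htz⟩, hz⟩
      have htR := hzt t ht htz
      obtain ⟨s, hs⟩ := hdec z
      have hsδ : s ∈ Metric.ball (0 : ℂ) δ := by
        rw [sub_eq_iff_eq_add'.2 hs, norm_smul] at hzs
        simpa using lt_of_mul_lt_mul_right hzs (norm_nonneg v)
      rw [← htz] at hs
      obtain ⟨j, hj⟩ := (hR₁' t (hRR t htR) s).2 ⟨hsδ, by
        have : F z = 0 := hzX.1 hz
        rwa [hs] at this⟩
      exact ⟨j, t, htR, s, hj, hs⟩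
    · rintro ⟨j, t, ht, s, hs, rfl⟩
      have h1 := (hR₁' t (hRR t ht) s).1 ⟨j, hs⟩
      refine ⟨⟨t, hRr t ht, ?_⟩, hzX.2 h1.2⟩
      rw [map_add, hπι, map_smul, hπv, smul_zero, add_zero]
  -- For small `t ≠ 0` the family `j` has a point close to the origin. If it lay on the other curve,
  -- injectivity of `α` would give the same `t`, then the same `s`, against disjointness.
  have hne : ∀ j j' : Fin 2, (∀ᶠ t in 𝓝[≠] 0, ∀ s ∈ S j t, s ∉ S j' t) →
      ¬ B j' =ᶠ[𝓝 0] arcSection X π α r := by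
    intro j j' hd heq
    obtain ⟨η, hη, hη'⟩ := Metric.eventually_nhds_iff_ball.1 (hunion.and heq.mem_iff)
    have hvp : 0 < ‖v‖ := norm_pos_iff.2 hv0
    have h1 : ∀ᶠ t in 𝓝 (0 : ℂ), ‖ι (α t)‖ < η / 2 :=
      hA.continuousAt.norm.eventually_lt_const (by simpa [hA0] using hη)
    have h2 := hsmall (η / (2 * ‖v‖)) (by positivity)
    obtain ⟨t, htd, ht1, ht2, ht3, htR⟩ := (hd.and ((h1.and (h2.and ((hcard j).and
      (Metric.ball_mem_nhds 0 hR)))).filter_mono nhdsWithin_le_nhds)).exists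
    obtain ⟨s, hs⟩ := Multiset.card_pos_iff_exists_mem.1 (ht3 ▸ hN j)
    have hz : ι (α t) + s • v ∈ Metric.ball (0 : Fin (2 + 1) → ℂ) η := by
      have h3 : ‖s • v‖ < η / 2 := by
        rw [norm_smul]
        have := mul_lt_mul_of_pos_right (ht2 j s hs) hvp
        calc ‖s‖ * ‖v‖ < η / (2 * ‖v‖) * ‖v‖ := this
          _ = η / 2 := by field_simp
      rw [mem_ball_zero_iff]
      linarith [norm_add_le (ι (α t)) (s • v)]
    obtain ⟨hu, he⟩ := hη' _ hz
    obtain ⟨t', ht', s', hs', hzz⟩ := he.2 (hu.2 ⟨j, t, htR, s, hs, rfl⟩)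
    have h4 := congrArg π hzz
    rw [map_add, map_add, hπι, hπι, map_smul, map_smul, hπv, smul_zero, smul_zero, add_zero,
      add_zero] at h4
    have h5 := hinj (hRr t htR) (hRr t' ht') h4
    subst h5
    have h6 := smul_left_injective ℂ hv0 (add_left_cancel hzz)
    subst h6
    exact htd s hs hs'
  refine ⟨B 0, B 1, hBan 0, hBan 1, ?_, hne 1 0 ?_, hne 0 1 hdisj⟩
  · filter_upwards [hunion] with z hz
    exact propext (hz.trans Fin.exists_fin_two)
  · filter_upwards [hdisj] with t ht s h1 h0
    exact ht s h0 h1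

end ArcSection

/-! ### A smooth plane quartic is prime -/

section QuarticIrreducible

open MvPolynomial

theorem three_le_height_vanishingIdeal_zero :
    3 ≤ (vanishingIdeal ℂ ({0} : Set (Fin 3 → ℂ))).height := by
  -- `e j` kills the first `j` variables. The kernels form a strict chain of four primes, prime
  -- because the target is a domain.
  let e : ℕ → MvPolynomial (Fin 3) ℂ →ₐ[ℂ] MvPolynomial (Fin 3) ℂ := fun j =>
    aeval fun i => if (i : ℕ) < j then 0 else X i
  have he : ∀ j i, e j (X i) = if (i : ℕ) < j then 0 else X i := fun j i => aeval_X _ _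
  have hprime : ∀ j, (RingHom.ker (e j)).IsPrime := fun j => RingHom.ker_isPrime _
  have hlt : ∀ j < 3, RingHom.ker (e j) < RingHom.ker (e (j + 1)) := by
    intro j hj
    refine lt_of_le_of_ne (fun g hg => ?_) fun heq => ?_
    · have hcomp : (e (j + 1)).comp (e j) = e (j + 1) := by
        refine algHom_ext fun i => ?_
        rw [AlgHom.comp_apply, he, he]
        split_ifs with h1 h2 h2
        · exact map_zero _
        · omega
        · rw [he, if_pos h2]
        · rw [he, if_neg h2]
      rw [RingHom.mem_ker] at hg ⊢
      rw [← hcomp, AlgHom.comp_apply, hg, map_zero]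
    · have h1 : X (⟨j, hj⟩ : Fin 3) ∈ RingHom.ker (e (j + 1)) := by
        rw [RingHom.mem_ker, he, if_pos (Nat.lt_succ_self j)]
      rw [← heq, RingHom.mem_ker, he, if_neg (lt_irrefl _)] at h1
      exact X_ne_zero _ h1
  have hstep : ∀ j < 3, (RingHom.ker (e j)).height + 1 ≤ (RingHom.ker (e (j + 1))).height :=
    fun j hj => by
      have := hprime j
      have := hprime (j + 1)
      exact Ideal.height_add_one_le_of_lt_of_isPrime (hlt j hj)
  have hle : RingHom.ker (e 3) ≤ vanishingIdeal ℂ ({0} : Set (Fin 3 → ℂ)) := by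
    intro g hg
    rw [mem_vanishingIdeal_singleton_iff]
    have hcomp : (aeval (0 : Fin 3 → ℂ)).comp (e 3) = (aeval (0 : Fin 3 → ℂ) : _ →ₐ[ℂ] ℂ) := by
      refine algHom_ext fun i => ?_
      rw [AlgHom.comp_apply, he, if_pos i.2, map_zero, aeval_X]
      rfl
    rw [RingHom.mem_ker] at hg
    rw [← hcomp, AlgHom.comp_apply, hg, map_zero]
  refine le_trans ?_ (Ideal.height_mono hle)
  calc (3 : ℕ∞) = 0 + 1 + 1 + 1 := by norm_num
    _ ≤ (RingHom.ker (e 0)).height + 1 + 1 + 1 := by gcongr; exact zero_le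
    _ ≤ (RingHom.ker (e 1)).height + 1 + 1 := by gcongr; exact hstep 0 (by norm_num)
    _ ≤ (RingHom.ker (e 2)).height + 1 := by gcongr; exact hstep 1 (by norm_num)
    _ ≤ (RingHom.ker (e 3)).height := hstep 2 (by norm_num)

/-- Two surfaces through the origin of `ℂ³` meet in another point. -/
theorem exists_common_zero {g h : MvPolynomial (Fin 3) ℂ} (hg : eval 0 g = 0) (hh : eval 0 h = 0) :
    ∃ x : Fin 3 → ℂ, x ≠ 0 ∧ eval x g = 0 ∧ eval x h = 0 := by
  classical
  set m := vanishingIdeal ℂ ({0} : Set (Fin 3 → ℂ)) with hm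
  have hIm : Ideal.span (({g, h} : Finset (MvPolynomial (Fin 3) ℂ)) :
      Set (MvPolynomial (Fin 3) ℂ)) ≤ m := by
    rw [Ideal.span_le]
    intro p hp
    simp only [Finset.coe_insert, Finset.coe_singleton, Set.mem_insert_iff,
      Set.mem_singleton_iff] at hp
    rw [SetLike.mem_coe, hm, mem_vanishingIdeal_singleton_iff, aeval_eq_eval]
    rcases hp with rfl | rfl
    · exact hg
    · exact hh
  -- By Krull's height theorem this minimal prime has height at most two. Were the origin the only
  -- common zero, the Nullstellensatz would put the ideal of the origin, of height at least three,
  -- inside it.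
  obtain ⟨P, hP, hPm⟩ := Ideal.exists_minimalPrimes_le hIm
  have hPprime : P.IsPrime := hP.1.1
  have h2 : P.height ≤ 2 :=
    (Ideal.height_le_card_of_mem_minimalPrimes_span_finset hP).trans
      (by exact_mod_cast Finset.card_le_two)
  by_contra hno
  push Not at hno
  have hmP : m ≤ P := by
    rw [← IsPrime.vanishingIdeal_zeroLocus (K := ℂ) P]
    refine vanishingIdeal_anti_mono fun x hx => ?_
    by_contra hx0
    have hx' : ∀ p ∈ P, eval x p = 0 := fun p hp => by
      have := hx p hp
      rwa [aeval_eq_eval] at this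
    exact hno x hx0 (hx' g (hP.1.2 (Ideal.subset_span (by simp))))
      (hx' h (hP.1.2 (Ideal.subset_span (by simp))))
  have h3 := three_le_height_vanishingIdeal_zero.trans ((Ideal.height_mono hmP).trans h2)
  exact absurd h3 (by norm_num)

/-- On a line through `0` where `f` is nonzero, `G * H` is a constant times `X ^ d`. As `G` does not
vanish at `0` it is coprime to `X`, hence a unit, so `g` equals `eval 0 g` wherever `f ≠ 0`. -/
theorem isUnit_of_mul_isHomogeneous {m d : ℕ} {f g h : MvPolynomial (Fin m) ℂ}
    (hf : f.IsHomogeneous d) (hf0 : f ≠ 0) (hfgh : f = g * h) (hg : eval 0 g ≠ 0) : IsUnit g := by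
  have key : ∀ x, eval x f ≠ 0 → eval x g = eval 0 g := by
    intro x hx
    set G : Polynomial ℂ := aeval
      (fun i => Polynomial.C ((0 : Fin m → ℂ) i) + Polynomial.C (x i) * Polynomial.X) g with hG
    set H : Polynomial ℂ := aeval
      (fun i => Polynomial.C ((0 : Fin m → ℂ) i) + Polynomial.C (x i) * Polynomial.X) h with hH
    have hGH : G * H = Polynomial.C (eval x f) * Polynomial.X ^ d := by
      refine Polynomial.funext fun τ => ?_
      rw [Polynomial.eval_mul, hG, hH, eval_aeval_line, eval_aeval_line, ← map_mul, ← hfgh,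
        zero_add, eval_smul_of_isHomogeneous hf]
      simp only [Polynomial.eval_mul, Polynomial.eval_C, Polynomial.eval_pow, Polynomial.eval_X]
      exact mul_comm _ _
    have hG0 : G.eval 0 ≠ 0 := by
      rw [hG, eval_aeval_line]
      simpa using hg
    have hcop : IsCoprime (Polynomial.X ^ d) G := by
      refine IsCoprime.pow_left ?_
      rw [Polynomial.irreducible_X.coprime_iff_not_dvd, Polynomial.X_dvd_iff,
        Polynomial.coeff_zero_eq_eval_zero]
      exact hG0
    obtain ⟨H', hH'⟩ := hcop.dvd_of_dvd_mul_left (Dvd.intro_left _ hGH.symm)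
    have hdeg : IsUnit G := by
      refine IsUnit.of_mul_eq_one (H' * Polynomial.C (eval x f)⁻¹) ?_
      have hX : (Polynomial.X ^ d : Polynomial ℂ) ≠ 0 := pow_ne_zero _ Polynomial.X_ne_zero
      refine mul_left_cancel₀ hX ?_
      rw [hH'] at hGH
      calc Polynomial.X ^ d * (G * (H' * Polynomial.C (eval x f)⁻¹))
          = G * (Polynomial.X ^ d * H') * Polynomial.C (eval x f)⁻¹ := by ring
        _ = Polynomial.X ^ d * 1 := by
          rw [hGH, mul_right_comm, ← Polynomial.C_mul, mul_inv_cancel₀ hx, Polynomial.C_1, mul_comm]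
    obtain ⟨c, -, hc⟩ := Polynomial.isUnit_iff.1 hdeg
    have h0 : G.eval 0 = eval 0 g := by rw [hG, eval_aeval_line, zero_smul, add_zero]
    have h1 : G.eval 1 = eval x g := by rw [hG, eval_aeval_line, one_smul, zero_add]
    rw [← h0, ← h1, ← hc, Polynomial.eval_C, Polynomial.eval_C]
  have hz : (g - C (eval 0 g)) * f = 0 := by
    refine MvPolynomial.funext fun x => ?_
    by_cases hx : eval x f = 0
    · simp [hx]
    · simp [key x hx]
  have := (mul_eq_zero.1 hz).resolve_right hf0
  rw [sub_eq_zero.1 this]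
  exact (isUnit_iff_ne_zero.2 hg).map C

/-- Nonunit factors `g` and `h` both vanish at the origin, hence at a common nonzero point; there
the Leibniz rule kills all partial derivatives of `g * h`. -/
theorem IsSmoothPlaneQuartic.prime {f : MvPolynomial (Fin 3) ℂ} (hf : IsSmoothPlaneQuartic f) :
    Prime f := by
  obtain ⟨hhom, hf0, hsm⟩ := hf
  refine Irreducible.prime ⟨fun hu => ?_, fun g h hfgh => ?_⟩
  · have h1 := hhom.totalDegree hf0
    rw [(MvPolynomial.isUnit_iff_totalDegree_of_isReduced.1 hu).2] at h1
    omega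
  · by_contra hno
    push Not at hno
    have hg : eval 0 g = 0 := by
      by_contra hg
      exact hno.1 (isUnit_of_mul_isHomogeneous hhom hf0 hfgh hg)
    have hh : eval 0 h = 0 := by
      by_contra hh
      exact hno.2 (isUnit_of_mul_isHomogeneous hhom hf0 (hfgh.trans (mul_comm _ _)) hh)
    obtain ⟨x, hx0, hxg, hxh⟩ := exists_common_zero hg hh
    obtain ⟨i, hi⟩ := hsm x hx0 (by rw [hfgh, map_mul, hxg, zero_mul])
    refine hi ?_
    rw [hfgh, Derivation.leibniz]
    simp [hxg, hxh]

end QuarticIrreducible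

/-! ### Irreducibility of the surface germ -/

section Irreducibility

variable {F : (Fin 3 → ℂ) → ℂ} {f : MvPolynomial (Fin 3) ℂ}

theorem hasDerivAt_eval_line {m : ℕ} (f : MvPolynomial (Fin m) ℂ) (w : Fin m → ℂ) (i : Fin m) :
    HasDerivAt (fun s : ℂ => MvPolynomial.eval (w + s • Pi.single i 1) f)
      (MvPolynomial.eval w (MvPolynomial.pderiv i f)) 0 := by
  induction f using MvPolynomial.induction_on with
  | C a => simpa using hasDerivAt_const (0 : ℂ) a
  | add p q hp hq => simpa using hp.fun_add hq
  | mul_X p j hp =>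
    have h1 : HasDerivAt (fun s : ℂ => w j + s * (Pi.single i (1 : ℂ) : Fin m → ℂ) j)
        ((Pi.single i (1 : ℂ) : Fin m → ℂ) j) 0 := by
      simpa using ((hasDerivAt_id (0 : ℂ)).mul_const _).const_add (w j)
    have h2 := hp.fun_mul h1
    simp only [map_mul, MvPolynomial.eval_X, Pi.add_apply, Pi.smul_apply, smul_eq_mul]
    refine h2.congr_deriv ?_
    rw [Derivation.leibniz, MvPolynomial.pderiv_X]
    have : MvPolynomial.eval w ((Pi.single i 1 : Fin m → MvPolynomial (Fin m) ℂ) j) =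
        (Pi.single i (1 : ℂ) : Fin m → ℂ) j := by
      rcases eq_or_ne j i with rfl | h
      · simp
      · simp [h]
    simp [this]
    ring

/-- The zero set of `Θ` near a point with nonzero derivative in a fixed direction is a graph. -/
theorem exists_arcs {m : ℕ} {Θ : ℂ × (Fin m → ℂ) → ℂ} {w₀ q : Fin m → ℂ}
    (hΘ : AnalyticAt ℂ Θ (0, w₀)) (h0 : Θ (0, w₀) = 0)
    (hq : fderiv ℂ Θ (0, w₀) (0, q) ≠ 0) :
    ∃ S : ℂ × (Fin m → ℂ) → ℂ, AnalyticAt ℂ S (0, w₀) ∧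
      (∀ᶠ p in 𝓝 ((0 : ℂ), w₀), Θ (p.1, p.2 + S p • q) = 0) ∧
      ∀ᶠ p in 𝓝 ((0 : ℂ), w₀), Θ p = 0 → S p = 0 := by
  set g : (ℂ × (Fin m → ℂ)) × ℂ → ℂ × (Fin m → ℂ) := fun v => (v.1.1, v.1.2 + v.2 • q) with hg
  set Ψ : (ℂ × (Fin m → ℂ)) × ℂ → ℂ := fun v => Θ (g v) with hΨ
  set u : (ℂ × (Fin m → ℂ)) × ℂ := ((0, w₀), 0) with hu
  have hgu : g u = (0, w₀) := by simp [hg, hu]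
  have hgan : AnalyticAt ℂ g u := by
    have h1 : AnalyticAt ℂ (fun v : (ℂ × (Fin m → ℂ)) × ℂ => v.1.1) u :=
      analyticAt_fst.fun_comp analyticAt_fst
    have h2 : AnalyticAt ℂ (fun v : (ℂ × (Fin m → ℂ)) × ℂ => v.1.2) u :=
      analyticAt_snd.fun_comp analyticAt_fst
    exact h1.prod (h2.fun_add (analyticAt_snd.fun_smul analyticAt_const))
  have han : AnalyticAt ℂ Ψ u := AnalyticAt.fun_comp (by rw [hgu]; exact hΘ) hgan
  have hcd : ContDiffAt ℂ ⊤ Ψ u := han.contDiffAt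
  -- The derivative of `Ψ` in the variable `s` is the derivative of `Θ` in direction `(0, q)`, so
  -- the implicit function theorem solves for `s`.
  have hval : (fderiv ℂ Ψ u ∘L .inr ℂ (ℂ × (Fin m → ℂ)) ℂ) 1 ≠ 0 := by
    have hc : HasFDerivAt Θ (fderiv ℂ Θ (0, w₀)) (g (u.1, 0)) := by
      rw [show ((u.1, 0) : (ℂ × (Fin m → ℂ)) × ℂ) = u from rfl, hgu]
      exact hΘ.differentiableAt.hasFDerivAt
    have h1 : HasDerivAt (fun s : ℂ => g (u.1, s)) ((0 : ℂ), q) 0 := by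
      refine HasDerivAt.prodMk (hasDerivAt_const _ _) ?_
      simpa using ((hasDerivAt_id (0 : ℂ)).smul_const q).const_add w₀
    have h2 := hc.comp_hasDerivAt 0 h1
    have h3 : HasDerivAt (fun s : ℂ => ((u.1, s) : (ℂ × (Fin m → ℂ)) × ℂ)) (0, 1) 0 :=
      (hasDerivAt_const _ _).prodMk (hasDerivAt_id _)
    have h4 := (han.differentiableAt.hasFDerivAt : HasFDerivAt Ψ _ (u.1, (0 : ℂ))).comp_hasDerivAt
      0 h3
    have h5 := h4.unique h2
    simpa using h5.trans_ne hq
  have hinv : (fderiv ℂ Ψ u ∘L .inr ℂ (ℂ × (Fin m → ℂ)) ℂ).IsInvertible := by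
    refine ⟨ContinuousLinearEquiv.unitsEquivAut ℂ (Units.mk0 _ hval), ?_⟩
    ext
    simp
  have hΨu : Ψ u = 0 := by rw [hΨ]; simp only [hgu, h0]
  refine ⟨hcd.implicitFunction (by simp) hinv, ?_, ?_, ?_⟩
  · exact (hcd.contDiffAt_implicitFunction (by simp) hinv).analyticAt
  · filter_upwards [hcd.eventually_apply_implicitFunction (by simp) hinv] with p hp
    exact hp.trans hΨu
  · have ht : Tendsto (fun p : ℂ × (Fin m → ℂ) => (p, (0 : ℂ))) (𝓝 (0, w₀)) (𝓝 u) :=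
      (Continuous.prodMk_left (0 : ℂ)).tendsto _
    filter_upwards [ht.eventually (hcd.eventually_apply_eq_iff_implicitFunction (by simp) hinv)]
      with p hp hp0
    exact hp.1 (by rw [hΨu]; simpa [hΨ, hg] using hp0)

theorem eventually_eq_zero_of_forall_isBigO_pow {β : ℂ → ℂ} (hβ : AnalyticAt ℂ β 0)
    (h : ∀ n : ℕ, β =O[𝓝 0] fun τ => τ ^ n) : ∀ᶠ τ in 𝓝 0, β τ = 0 := by
  by_contra hne
  obtain ⟨n, g, hg, hg0, heq⟩ := hβ.exists_eventuallyEq_pow_smul_nonzero_iff.2 hne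
  obtain ⟨C, hC⟩ := (h (n + 1)).bound
  have h1 : ∀ᶠ τ in 𝓝[≠] (0 : ℂ), ‖g τ‖ ≤ C * ‖τ‖ := by
    filter_upwards [hC.filter_mono nhdsWithin_le_nhds, heq.filter_mono nhdsWithin_le_nhds,
      self_mem_nhdsWithin] with τ h1 h2 h3
    rw [h2, sub_zero, smul_eq_mul, norm_mul, pow_succ, norm_mul, mul_left_comm] at h1
    exact le_of_mul_le_mul_left h1 (norm_pos_iff.2 (pow_ne_zero _ h3))
  have h2 : ContinuousAt (fun τ : ℂ => C * ‖τ‖) 0 := by fun_prop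
  have h3 := le_of_tendsto_of_tendsto (hg.continuousAt.norm.tendsto.mono_left nhdsWithin_le_nhds)
    (h2.tendsto.mono_left nhdsWithin_le_nhds) h1
  exact hg0 (by simpa using h3)

theorem IsSmoothPlaneQuartic.exists_fderiv_ne_zero (hf : IsSmoothPlaneQuartic f)
    {Θ : ℂ × (Fin 3 → ℂ) → ℂ} (hΘ : ∀ w, AnalyticAt ℂ Θ (0, w))
    (hΘf : ∀ w, Θ (0, w) = MvPolynomial.eval w f) {w₀ : Fin 3 → ℂ} (hw₀ : w₀ ≠ 0)
    (h0 : MvPolynomial.eval w₀ f = 0) : ∃ q, fderiv ℂ Θ (0, w₀) (0, q) ≠ 0 := by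
  obtain ⟨i, hi⟩ := hf.2.2 w₀ hw₀ h0
  refine ⟨Pi.single i 1, ?_⟩
  have h1 : HasDerivAt (fun s : ℂ => ((0 : ℂ), w₀ + s • (Pi.single i 1 : Fin 3 → ℂ)))
      (0, Pi.single i 1) 0 := by
    refine HasDerivAt.prodMk (hasDerivAt_const _ _) ?_
    simpa using ((hasDerivAt_id (0 : ℂ)).smul_const (Pi.single i 1 : Fin 3 → ℂ)).const_add w₀
  have h2 : HasFDerivAt Θ (fderiv ℂ Θ (0, w₀))
      (0, w₀ + (0 : ℂ) • (Pi.single i 1 : Fin 3 → ℂ)) := by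
    simpa using (hΘ w₀).differentiableAt.hasFDerivAt
  have h3 := h2.comp_hasDerivAt 0 h1
  have h4 : (Θ ∘ fun s : ℂ => ((0 : ℂ), w₀ + s • (Pi.single i 1 : Fin 3 → ℂ))) =
      fun s : ℂ => MvPolynomial.eval (w₀ + s • Pi.single i 1) f := funext fun s => hΘf _
  rw [h4] at h3
  rwa [h3.unique (hasDerivAt_eval_line f w₀ i)]

/-- A germ that agrees with multiples of `F` to arbitrary order vanishes on `F = 0`. -/
theorem eventually_eq_zero_of_flat (hf : IsSmoothPlaneQuartic f) (hF : HasInitialForm F 4 f)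
    {b : (Fin 3 → ℂ) → ℂ} (hb : AnalyticAt ℂ b 0)
    (hflat : ∀ n : ℕ, ∃ g : MvPolynomial (Fin 3) ℂ,
      (fun x => b x - MvPolynomial.eval x g * F x) =O[𝓝 0] fun x : Fin 3 → ℂ => ‖x‖ ^ n) :
    ∀ᶠ x in 𝓝 0, F x = 0 → b x = 0 := by
  obtain ⟨Θ, hΘ, hΘf, hFΘ⟩ := hF.exists_leading
  have hlocal : ∀ w₀ ∈ Metric.sphere (0 : Fin 3 → ℂ) 1, ∀ᶠ p in 𝓝 ((0 : ℂ), w₀),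
      p.1 ≠ 0 → F (p.1 • p.2) = 0 → b (p.1 • p.2) = 0 := by
    intro w₀ hw₀
    have hw₀' : w₀ ≠ 0 := by
      rintro rfl
      simp at hw₀
    have hev := AnalyticAt.eventually_smul hFΘ w₀
    by_cases h0 : MvPolynomial.eval w₀ f = 0
    swap
    · filter_upwards [hev, (hΘ w₀).continuousAt.eventually_ne (hΘf w₀ ▸ h0)] with p h1 h2 h3 h4
      rw [h1 p.1 p.2 rfl] at h4
      exact (mul_ne_zero (pow_ne_zero _ h3) h2 h4).elim
    · obtain ⟨q, hq⟩ := hf.exists_fderiv_ne_zero hΘ hΘf hw₀' h0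
      obtain ⟨S, hS, hS1, hS2⟩ := exists_arcs (hΘ w₀) ((hΘf w₀).trans h0) hq
      have hω : ContinuousAt (fun p : ℂ × (Fin 3 → ℂ) => p.1 • (p.2 + S p • q)) (0, w₀) := by
        have := hS.continuousAt
        fun_prop
      have hωt : Tendsto (fun p : ℂ × (Fin 3 → ℂ) => p.1 • (p.2 + S p • q)) (𝓝 (0, w₀)) (𝓝 0) := by
        simpa using hω.tendsto
      have hall := ((hS.eventually_analyticAt).and hS1).and
        ((hωt.eventually hb.eventually_analyticAt).and (hωt.eventually hFΘ))
      rw [nhds_prod_eq] at hall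
      obtain ⟨pa, hpa, pb, hpb, hab⟩ := eventually_prod_iff.1 hall
      obtain ⟨ρ, hρ, hρ'⟩ := Metric.eventually_nhds_iff_ball.1 hpa
      have hnear : ∀ᶠ p in 𝓝 ((0 : ℂ), w₀), p.1 ∈ Metric.ball (0 : ℂ) ρ ∧ pb p.2 :=
        ((continuous_fst.tendsto ((0 : ℂ), w₀)).eventually (Metric.ball_mem_nhds 0 hρ)).and
          ((continuous_snd.tendsto ((0 : ℂ), w₀)).eventually hpb)
      filter_upwards [hev, hS2, hnear] with p h1 h2 h3 h4 h5
      obtain ⟨τ₀, w₁⟩ := p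
      simp only at h1 h2 h3 h4 h5 ⊢
      have hΘ0 : Θ (τ₀, w₁) = 0 := by
        rw [h1 τ₀ w₁ rfl] at h5
        exact (mul_eq_zero.1 h5).resolve_left (pow_ne_zero _ h4)
      have hS0 := h2 hΘ0
      -- This arc lies in `F = 0`, starts at the origin, and passes through the given point at time
      -- `τ₀` because `S (τ₀, w₁) = 0`. Its domain, the ball of radius `ρ`, does not depend on `w₁`,
      -- so flatness at `0` propagates to `τ₀` by the identity theorem.
      set γ : ℂ → (Fin 3 → ℂ) := fun τ => τ • (w₁ + S (τ, w₁) • q) with hγ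
      have hγan : AnalyticOnNhd ℂ γ (Metric.ball 0 ρ) := by
        intro τ hτ
        have hSτ : AnalyticAt ℂ (fun τ => S (τ, w₁)) τ :=
          (hab (hρ' τ hτ) h3.2).1.1.fun_comp (f := fun τ : ℂ => (τ, w₁)) (analyticAt_id.prod analyticAt_const)
        exact analyticAt_id.fun_smul (analyticAt_const.fun_add (hSτ.fun_smul analyticAt_const))
      have hγF : ∀ τ ∈ Metric.ball (0 : ℂ) ρ, F (γ τ) = 0 := fun τ hτ => by
        obtain ⟨⟨-, i1⟩, -, i2⟩ := hab (hρ' τ hτ) h3.2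
        rw [i2 τ _ rfl, i1, mul_zero]
      have hβ : AnalyticOnNhd ℂ (fun τ => b (γ τ)) (Metric.ball 0 ρ) := fun τ hτ =>
        (hab (hρ' τ hτ) h3.2).2.1.fun_comp (f := γ) (hγan τ hτ)
      have h0ρ : (0 : ℂ) ∈ Metric.ball (0 : ℂ) ρ := Metric.mem_ball_self hρ
      have hγ0 : Tendsto γ (𝓝 0) (𝓝 0) := by
        simpa [hγ] using (hγan 0 h0ρ).continuousAt.tendsto
      have hγO : γ =O[𝓝 0] fun τ => τ := by
        have hSc : ContinuousAt (fun τ : ℂ => w₁ + S (τ, w₁) • q) 0 := by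
          have : ContinuousAt (fun τ => S (τ, w₁)) 0 :=
            ((hab (hρ' 0 h0ρ) h3.2).1.1.fun_comp
              (f := fun τ : ℂ => (τ, w₁)) (analyticAt_id.prod analyticAt_const)).continuousAt
          exact continuousAt_const.add (this.smul continuousAt_const)
        have := (isBigO_refl (fun τ : ℂ => τ) (𝓝 0)).smul (hSc.tendsto.isBigO_one ℂ)
        simpa only [smul_eq_mul, mul_one] using this
      have hzero := hβ.eqOn_zero_of_preconnected_of_eventuallyEq_zero
        (convex_ball (0 : ℂ) ρ).isPreconnected h0ρ
        (eventually_eq_zero_of_forall_isBigO_pow (hβ 0 h0ρ) fun n => by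
          obtain ⟨g, hg⟩ := hflat n
          refine ((hg.comp_tendsto hγ0).trans (hγO.norm_left.pow n)).congr' ?_ (.refl _ _)
          filter_upwards [Metric.ball_mem_nhds (0 : ℂ) hρ] with τ hτ
          simp [hγF τ hτ])
      have := hzero h3.1
      simpa [hγ, hS0] using this
  have hb0 : b 0 = 0 := by
    obtain ⟨g, hg⟩ := hflat 1
    have h1 := hg.eq_zero_imp.self_of_nhds
    have h2 : F 0 = 0 := by
      have := hFΘ.self_of_nhds 0 0 (by simp)
      simpa using this
    simpa [h2] using h1
  have hsph := (isCompact_sphere (0 : Fin 3 → ℂ) 1).eventually_forall_of_forall_eventually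
    (x₀ := (0 : ℂ)) (P := fun τ w => τ ≠ 0 → F (τ • w) = 0 → b (τ • w) = 0) hlocal
  have ht : Tendsto (fun x : Fin 3 → ℂ => ((‖x‖ : ℝ) : ℂ)) (𝓝 0) (𝓝 0) := by
    have : Continuous (fun x : Fin 3 → ℂ => ((‖x‖ : ℝ) : ℂ)) := by fun_prop
    simpa using this.tendsto 0
  filter_upwards [ht.eventually hsph] with x hx hFx
  rcases eq_or_ne x 0 with rfl | hx0
  · exact hb0
  · have hn : (‖x‖ : ℂ) ≠ 0 := by simpa using hx0
    have hxw : (‖x‖ : ℂ) • ((‖x‖ : ℂ)⁻¹ • x) = x := by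
      rw [smul_smul, mul_inv_cancel₀ hn, one_smul]
    have := hx ((‖x‖ : ℂ)⁻¹ • x) (by simp [norm_smul, hx0]) hn
    simp only [hxw] at this
    exact this hFx

/-- The initial forms of two germs whose product vanishes on `F = 0`. -/
theorem eval_mul_eval_eq_zero (hf : IsSmoothPlaneQuartic f) (hF : HasInitialForm F 4 f)
    {b c : (Fin 3 → ℂ) → ℂ} {Θb Θc : ℂ × (Fin 3 → ℂ) → ℂ} {n l : ℕ}
    (hΘb : ∀ w, AnalyticAt ℂ Θb (0, w)) (hΘc : ∀ w, AnalyticAt ℂ Θc (0, w))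
    (hb : ∀ᶠ x in 𝓝 0, ∀ (τ : ℂ) (w : Fin 3 → ℂ), τ • w = x → b x = τ ^ n * Θb (τ, w))
    (hc : ∀ᶠ x in 𝓝 0, ∀ (τ : ℂ) (w : Fin 3 → ℂ), τ • w = x → c x = τ ^ l * Θc (τ, w))
    (hbc : ∀ᶠ x in 𝓝 0, F x = 0 → b x * c x = 0) {w₀ : Fin 3 → ℂ} (hw₀ : w₀ ≠ 0)
    (h0 : MvPolynomial.eval w₀ f = 0) : Θb (0, w₀) * Θc (0, w₀) = 0 := by
  obtain ⟨Θ, hΘ, hΘf, hFΘ⟩ := hF.exists_leading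
  obtain ⟨q, hq⟩ := hf.exists_fderiv_ne_zero hΘ hΘf hw₀ h0
  obtain ⟨S, hS, hS1, hS2⟩ := exists_arcs (hΘ w₀) ((hΘf w₀).trans h0) hq
  have hS0 : S (0, w₀) = 0 := hS2.self_of_nhds ((hΘf w₀).trans h0)
  have hj : Tendsto (fun τ : ℂ => (τ, w₀)) (𝓝 0) (𝓝 (0, w₀)) :=
    (Continuous.prodMk_left w₀).tendsto 0
  have hSc : ContinuousAt (fun τ : ℂ => S (τ, w₀)) 0 :=
    ContinuousAt.comp (f := fun τ : ℂ => (τ, w₀)) hS.continuousAt hj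
  have hγ : ContinuousAt (fun τ : ℂ => τ • (w₀ + S (τ, w₀) • q)) 0 := by fun_prop
  have hγt : Tendsto (fun τ : ℂ => τ • (w₀ + S (τ, w₀) • q)) (𝓝 0) (𝓝 0) := by
    simpa using hγ.tendsto
  have hω : ContinuousAt (fun τ : ℂ => (τ, w₀ + S (τ, w₀) • q)) 0 := by fun_prop
  have hcomp : ∀ Ψ : ℂ × (Fin 3 → ℂ) → ℂ, AnalyticAt ℂ Ψ (0, w₀) →
      ContinuousAt (fun τ : ℂ => Ψ (τ, w₀ + S (τ, w₀) • q)) 0 := fun Ψ hΨ =>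
    ContinuousAt.comp (f := fun τ : ℂ => (τ, w₀ + S (τ, w₀) • q))
      (by simpa [hS0] using hΨ.continuousAt) hω
  have hprod := (hcomp Θb (hΘb w₀)).fun_mul (hcomp Θc (hΘc w₀))
  -- Along the arc in `F = 0` with initial direction `w₀`, divide `b * c = 0` by `τ ^ (n + l)` and
  -- let `τ → 0`.
  have hev : ∀ᶠ τ in 𝓝[≠] (0 : ℂ),
      Θb (τ, w₀ + S (τ, w₀) • q) * Θc (τ, w₀ + S (τ, w₀) • q) = 0 := by
    filter_upwards [(hj.eventually hS1).filter_mono nhdsWithin_le_nhds,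
      (hγt.eventually (hb.and (hc.and (hbc.and hFΘ)))).filter_mono nhdsWithin_le_nhds,
      self_mem_nhdsWithin] with τ h1 h2 h3
    obtain ⟨i1, i2, i3, i4⟩ := h2
    have := i3 (by rw [i4 τ _ rfl, h1, mul_zero])
    rw [i1 τ _ rfl, i2 τ _ rfl, mul_mul_mul_comm, ← pow_add] at this
    exact (mul_eq_zero.1 this).resolve_left (pow_ne_zero _ h3)
  have := tendsto_nhds_unique_of_eventuallyEq (hprod.tendsto.mono_left nhdsWithin_le_nhds)
    tendsto_const_nhds hev
  simpa [hS0] using this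

/-- Modulo multiples of `F`, a germ that is not flat along `F = 0` has an initial form that is not
divisible by that of `F`. -/
theorem exists_leading_not_dvd (hf : f.IsHomogeneous 4) (hF : HasInitialForm F 4 f)
    {b : (Fin 3 → ℂ) → ℂ} (hb : AnalyticAt ℂ b 0)
    (hflat : ¬ ∀ n : ℕ, ∃ g : MvPolynomial (Fin 3) ℂ,
      (fun x => b x - MvPolynomial.eval x g * F x) =O[𝓝 0] fun x : Fin 3 → ℂ => ‖x‖ ^ n) :
    ∃ (g Q : MvPolynomial (Fin 3) ℂ) (n : ℕ) (Θ : ℂ × (Fin 3 → ℂ) → ℂ),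
      Q.IsHomogeneous n ∧ ¬ f ∣ Q ∧ (∀ w, AnalyticAt ℂ Θ (0, w)) ∧
      (∀ w, Θ (0, w) = MvPolynomial.eval w Q) ∧
      ∀ᶠ x in 𝓝 0, ∀ (τ : ℂ) (w : Fin 3 → ℂ), τ • w = x →
        b x - MvPolynomial.eval x g * F x = τ ^ n * Θ (τ, w) := by
  classical
  push Not at hflat
  have hspec := Nat.find_spec hflat
  have hpoly : ∀ (g : MvPolynomial (Fin 3) ℂ) x, AnalyticAt ℂ (fun x => MvPolynomial.eval x g) x :=
    fun g x => AnalyticOnNhd.eval_mvPolynomial g x (Set.mem_univ _)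
  obtain ⟨n, hn⟩ : ∃ n, Nat.find hflat = n + 1 := by
    refine Nat.exists_eq_succ_of_ne_zero fun h => ?_
    rw [h] at hspec
    refine hspec 0 ?_
    simpa using hb.continuousAt.tendsto.isBigO_one ℝ
  rw [hn] at hspec
  have h1 := Nat.find_min hflat (m := n) (by omega)
  push Not at h1
  obtain ⟨g, hg⟩ := h1
  have hban : AnalyticAt ℂ (fun x => b x - MvPolynomial.eval x g * F x) 0 :=
    hb.fun_sub ((hpoly g 0).fun_mul hF.1)
  obtain ⟨Q, Θ, hQ, hΘ, hΘQ, heq, hO⟩ := hban.exists_leading hg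
  refine ⟨g, Q, n, Θ, hQ, ?_, hΘ, hΘQ, heq⟩
  rintro ⟨g', hg'⟩
  -- The quotient of `Q` by `f` may be taken homogeneous of degree `n - 4`, or zero if `n < 4`.
  -- Adding it to `g` raises the order of the remainder to `n + 1`, against the choice of `n`.
  obtain ⟨g₁, e, hg₁, he, hQg⟩ : ∃ (g₁ : MvPolynomial (Fin 3) ℂ) (e : ℕ), g₁.IsHomogeneous e ∧
      n + 1 ≤ e + 5 ∧ Q = f * g₁ := by
    let _ : GradedRing (MvPolynomial.homogeneousSubmodule (Fin 3) ℂ) := MvPolynomial.gradedAlgebra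
    have h2 := DirectSum.coe_decompose_mul_of_left_mem (MvPolynomial.homogeneousSubmodule (Fin 3) ℂ)
      n (i := 4) (b := g') hf
    rw [← hg'] at h2
    have h3 := DirectSum.decompose_of_mem_same (MvPolynomial.homogeneousSubmodule (Fin 3) ℂ) hQ
    rw [h3] at h2
    split_ifs at h2 with h4
    · exact ⟨_, n - 4, (DirectSum.decompose (MvPolynomial.homogeneousSubmodule (Fin 3) ℂ)
        g' (n - 4)).2, by omega, h2⟩
    · exact ⟨0, n, MvPolynomial.isHomogeneous_zero _ _ _, by omega, by rw [h2, mul_zero]⟩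
  refine hspec (g + g₁) ?_
  have h5 : (fun x => MvPolynomial.eval x g₁ * (F x - MvPolynomial.eval x f)) =O[𝓝 0]
      fun x : Fin 3 → ℂ => ‖x‖ ^ (n + 1) := by
    refine ((isBigO_eval_of_isHomogeneous hg₁ (𝓝 0)).mul hF.2.2.2).trans ?_
    simp only [← pow_add]
    obtain ⟨i, hi⟩ := Nat.exists_eq_add_of_le he
    rw [show e + (4 + 1) = n + 1 + i by omega]
    simp only [pow_add _ (n + 1) i]
    have h6 : (fun x : Fin 3 → ℂ => ‖x‖ ^ i) =O[𝓝 0] fun _ => (1 : ℝ) :=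
      ((continuous_norm.pow i).tendsto 0).isBigO_one ℝ
    simpa using (isBigO_refl (fun x : Fin 3 → ℂ => ‖x‖ ^ (n + 1)) (𝓝 0)).mul h6
  refine (hO.sub h5).congr_left fun x => ?_
  rw [hQg, map_mul, map_add]
  ring

/-- The reduced local ring of the surface has no zero divisors: the two initial forms left modulo
`F` multiply to a polynomial vanishing on the cone `f = 0`, so the prime `f` would divide one of
them. -/
theorem eventually_eq_zero_or (hf : IsSmoothPlaneQuartic f) (hflex : ¬ HasHyperflex f)
    (hF : HasInitialForm F 4 f) {b c : (Fin 3 → ℂ) → ℂ} (hb : AnalyticAt ℂ b 0)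
    (hc : AnalyticAt ℂ c 0) (hbc : ∀ᶠ x in 𝓝 0, F x = 0 → b x * c x = 0) :
    (∀ᶠ x in 𝓝 0, F x = 0 → b x = 0) ∨ ∀ᶠ x in 𝓝 0, F x = 0 → c x = 0 := by
  by_contra hno
  rw [not_or] at hno
  obtain ⟨g, Q, n, Θ, hQ, hQf, hΘ, hΘQ, heq⟩ := exists_leading_not_dvd hf.1 hF hb
    fun h => hno.1 (eventually_eq_zero_of_flat hf hF hb h)
  obtain ⟨g', Q', n', Θ', hQ', hQf', hΘ', hΘQ', heq'⟩ := exists_leading_not_dvd hf.1 hF hc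
    fun h => hno.2 (eventually_eq_zero_of_flat hf hF hc h)
  have hzero : ∀ w, w ≠ 0 → MvPolynomial.eval w f = 0 → MvPolynomial.eval w (Q * Q') = 0 := by
    intro w hw hw0
    rw [map_mul, ← hΘQ, ← hΘQ']
    refine eval_mul_eval_eq_zero hf hF hΘ hΘ' heq heq' ?_ hw hw0
    filter_upwards [hbc] with x hx hFx
    simpa [hFx] using hx hFx
  have hind : LinearIndependent ℂ ![(Pi.single 0 1 : Fin 3 → ℂ), Pi.single 1 1] := by
    rw [LinearIndependent.pair_iff]
    intro s t hst
    have h0 := congrFun hst 0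
    have h1 := congrFun hst 1
    simp at h0 h1
    exact ⟨h0, h1⟩
  -- The Nullstellensatz also needs `Q * Q'` to vanish at the origin. It vanishes at a nonzero point
  -- of the cone, and homogeneity carries this to `0`.
  obtain ⟨x, hx⟩ := exists_root_on_line hf.1 hflex hind
  have hx0 : (Pi.single 0 1 + x • Pi.single 1 1 : Fin 3 → ℂ) ≠ 0 := by
    intro h
    have := congrFun h 0
    simp at this
  have hzero0 : MvPolynomial.eval 0 (Q * Q') = 0 := by
    have := eval_smul_of_isHomogeneous (hQ.mul hQ') 0 (Pi.single 0 1 + x • Pi.single 1 1)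
    rwa [hzero _ hx0 hx, mul_zero, zero_smul] at this
  have hprime := hf.prime
  have hmem : Q * Q' ∈ MvPolynomial.vanishingIdeal ℂ
      (MvPolynomial.zeroLocus ℂ (Ideal.span {f})) := by
    intro w hw
    rw [MvPolynomial.aeval_eq_eval]
    have hwf : MvPolynomial.eval w f = 0 := by
      have := hw f (Ideal.mem_span_singleton_self f)
      rwa [MvPolynomial.aeval_eq_eval] at this
    rcases eq_or_ne w 0 with rfl | hw0
    · exact hzero0
    · exact hzero w hw0 hwf
  have : (Ideal.span {f}).IsPrime := (Ideal.span_singleton_prime hprime.ne_zero).2 hprime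
  rw [MvPolynomial.IsPrime.vanishingIdeal_zeroLocus, Ideal.mem_span_singleton] at hmem
  exact (hprime.dvd_or_dvd hmem).elim hQf hQf'

theorem isIrreducibleGermAt_of_hasInitialForm (hf : IsSmoothPlaneQuartic f)
    (hflex : ¬ HasHyperflex f) (hF : HasInitialForm F 4 f) {X : Set (Fin 3 → ℂ)}
    (hX : X =ᶠ[𝓝 0] {x | F x = 0}) : IsIrreducibleGermAt X 0 := by
  have hF0 : F 0 = 0 := by
    have := hF.isBigO.eq_zero_imp.self_of_nhds
    simpa using this
  refine ⟨⟨1, fun _ => F, fun _ => hF.1, hX.trans (.of_eq (by ext; simp))⟩,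
    hX.mem_iff.self_of_nhds.2 hF0, ?_⟩
  rintro ⟨B, C, ⟨kB, fB, hfB, hB⟩, ⟨kC, fC, hfC, hC⟩, hBC, hBX, hCX⟩
  -- A piece strictly smaller than `X` has a defining function that does not vanish on `X`; one such
  -- function from each piece gives a product vanishing on `X`.
  have key : ∀ (Y : Set (Fin 3 → ℂ)) (k : ℕ) (g : Fin k → (Fin 3 → ℂ) → ℂ),
      Y =ᶠ[𝓝 0] {x | ∀ i, g i x = 0} → (∀ᶠ x in 𝓝 0, x ∈ Y → x ∈ X) → ¬ Y =ᶠ[𝓝 0] X →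
      ∃ i, ¬ ∀ᶠ x in 𝓝 0, F x = 0 → g i x = 0 := by
    intro Y k g hY hsub hne
    by_contra hall
    push Not at hall
    refine hne ?_
    filter_upwards [hY.mem_iff, hsub, eventually_all.2 hall, hX.mem_iff] with x h1 h2 h3 h4
    exact propext ⟨h2, fun hx => h1.2 fun i => h3 i (h4.1 hx)⟩
  obtain ⟨i, hi⟩ := key B kB fB hB (hBC.mem_iff.mono fun x hx h => hx.2 (Or.inl h)) hBX
  obtain ⟨j, hj⟩ := key C kC fC hC (hBC.mem_iff.mono fun x hx h => hx.2 (Or.inr h)) hCX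
  refine (eventually_eq_zero_or hf hflex hF (hfB i) (hfC j) ?_).elim hi hj
  filter_upwards [hX.mem_iff, hBC.mem_iff, hB.mem_iff, hC.mem_iff] with x h1 h2 h3 h4 hx
  rcases h2.1 (h1.2 hx) with h | h
  · rw [h3.1 h i, zero_mul]
  · rw [h4.1 h j, mul_zero]

theorem isIrreducibleWithReducibleArcSections_of_hasInitialForm (hf : IsSmoothPlaneQuartic f)
    (hflex : ¬ HasHyperflex f) (hF : HasInitialForm F 4 f) {X : Set (Fin 3 → ℂ)}
    (hX : X =ᶠ[𝓝 0] {x | F x = 0}) : IsIrreducibleWithReducibleArcSections (n := 2) X := by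
  have hF0 : F 0 = 0 := by
    have := hF.isBigO.eq_zero_imp.self_of_nhds
    simpa using this
  refine ⟨⟨F, hF.1, hF0, fun h => ?_, hX⟩, isIrreducibleGermAt_of_hasInitialForm hf hflex hF hX,
    fun π hπ α r hα => isReducibleGermAt_arcSection hF hflex hX hπ hα⟩
  refine hF.2.2.1 (MvPolynomial.funext fun w => ?_)
  rw [map_zero]
  refine eval_eq_zero_of_isBigO hF.2.1 ?_ w
  refine hF.2.2.2.neg_left.congr' ?_ (.refl _ _)
  filter_upwards [h] with x hx
  simp [hx]

end Irreducibility

/-! ### Initial forms under coordinate changes -/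

section CoordinateChange

theorem AnalyticAt.isBigO_sub_fderiv {E G : Type*} [NormedAddCommGroup E] [NormedSpace ℂ E]
    [NormedAddCommGroup G] [NormedSpace ℂ G] {ψ : E → G} (hψ : AnalyticAt ℂ ψ 0)
    (hψ0 : ψ 0 = 0) : (fun y => ψ y - fderiv ℂ ψ 0 y) =O[𝓝 0] fun y => ‖y‖ ^ 2 := by
  obtain ⟨p, hp⟩ := hψ
  have h := hp.isBigO_sub_partialSum_pow 2
  refine h.congr_left fun y => ?_
  rw [hp.fderiv_eq, zero_add, FormalMultilinearSeries.partialSum, Finset.sum_range_succ,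
    Finset.sum_range_one, continuousMultilinearCurryFin1_apply, hp.coeff_zero, hψ0, zero_add]
  congr 2

variable {m d : ℕ} {f : MvPolynomial (Fin m) ℂ}

/-- A homogeneous polynomial of degree `d` takes values that agree up to order `d + 1` on maps
that agree up to order `2`. -/
theorem MvPolynomial.IsHomogeneous.isBigO_eval_sub {E : Type*} [NormedAddCommGroup E]
    (hf : f.IsHomogeneous d) {u v : E → Fin m → ℂ} (hu : u =O[𝓝 0] fun y => y)
    (hv : v =O[𝓝 0] fun y => y) (huv : (fun y => u y - v y) =O[𝓝 0] fun y => ‖y‖ ^ 2) :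
    (fun y => eval (u y) f - eval (v y) f) =O[𝓝 0] fun y => ‖y‖ ^ (d + 1) := by
  obtain ⟨A, hA⟩ := hu.bound
  obtain ⟨B, hB⟩ := hv.bound
  obtain ⟨C, hC⟩ := huv.bound
  have hcd : ContDiff ℂ 1 fun w : Fin m → ℂ => eval w f := by
    have := (AnalyticOnNhd.eval_mvPolynomial (𝕜 := ℂ) f).contDiffOn (n := 1) uniqueDiffOn_univ
    exact contDiffOn_univ.1 this
  -- Dividing `u y` and `v y` by `‖y‖` moves both into this fixed ball, where `f` is Lipschitz;
  -- homogeneity restores the factor `‖y‖ ^ d`.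
  obtain ⟨K, hK⟩ := (hcd.contDiffOn (s := Metric.closedBall 0 (max A B))).restrict_scalars ℝ
    |>.exists_lipschitzOnWith one_ne_zero (convex_closedBall _ _) (isCompact_closedBall _ _)
  refine .of_bound (K * C) ?_
  filter_upwards [hA, hB, hC] with y h1 h2 h3
  rcases eq_or_ne y 0 with rfl | hy
  · simp only [norm_zero, mul_zero, norm_le_zero_iff] at h1 h2
    simp [h1, h2]
  have hy' : 0 < ‖y‖ := norm_pos_iff.2 hy
  have hy0 : ((‖y‖ : ℝ) : ℂ) ≠ 0 := by exact_mod_cast hy'.ne'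
  have hmem : ∀ {w : Fin m → ℂ} {D : ℝ}, D ≤ max A B → ‖w‖ ≤ D * ‖y‖ →
      ((‖y‖ : ℝ) : ℂ)⁻¹ • w ∈ Metric.closedBall (0 : Fin m → ℂ) (max A B) := by
    intro w D hD hw
    rw [mem_closedBall_zero_iff, norm_smul, norm_inv, Complex.norm_real, norm_norm,
      inv_mul_le_iff₀ hy', mul_comm]
    exact hw.trans (by gcongr)
  have hscale : ∀ w : Fin m → ℂ,
      eval w f = ((‖y‖ : ℝ) : ℂ) ^ d * eval (((‖y‖ : ℝ) : ℂ)⁻¹ • w) f := fun w => by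
    rw [← eval_smul_of_isHomogeneous hf, smul_inv_smul₀ hy0]
  have hlip := hK.norm_sub_le (hmem (le_max_left A B) h1) (hmem (le_max_right A B) h2)
  rw [hscale (u y), hscale (v y), ← mul_sub, norm_mul, norm_pow, Complex.norm_real, norm_norm]
  rw [← smul_sub, norm_smul, norm_inv, Complex.norm_real, norm_norm] at hlip
  rw [norm_pow, norm_norm] at h3 ⊢
  calc ‖y‖ ^ d * _ ≤ ‖y‖ ^ d * (K * (‖y‖⁻¹ * (C * ‖y‖ ^ 2))) := by
        refine mul_le_mul_of_nonneg_left (hlip.trans ?_) (by positivity)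
        gcongr
    _ = K * C * ‖y‖ ^ (d + 1) := by field_simp; ring

/-- The polynomial `f ∘ L`, for a linear map `L`. -/
noncomputable def MvPolynomial.compLinear (L : (Fin m → ℂ) →L[ℂ] (Fin m → ℂ))
    (f : MvPolynomial (Fin m) ℂ) : MvPolynomial (Fin m) ℂ :=
  bind₁ (fun i => ∑ j, C (L (Pi.single j 1) i) * X j) f

variable (L : (Fin m → ℂ) →L[ℂ] (Fin m → ℂ))

theorem MvPolynomial.eval_compLinear (w : Fin m → ℂ) :
    eval w (compLinear L f) = eval (L w) f := by
  have hL : L w = fun i => ∑ j, L (Pi.single j 1) i * w j := by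
    conv_lhs => rw [← Finset.univ_sum_single w, map_sum]
    ext i
    rw [Finset.sum_apply]
    refine Finset.sum_congr rfl fun j _ => ?_
    rw [show (Pi.single j (w j) : Fin m → ℂ) = w j • Pi.single j 1 by
      rw [← Pi.single_smul, smul_eq_mul, mul_one], map_smul, Pi.smul_apply, smul_eq_mul, mul_comm]
  rw [hL, compLinear, ← aeval_eq_eval, ← aeval_eq_eval]
  rw [aeval_bind₁]
  simp

theorem MvPolynomial.IsHomogeneous.compLinear (hf : f.IsHomogeneous d) :
    (MvPolynomial.compLinear L f).IsHomogeneous d := by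
  have := hf.aeval (fun i => ∑ j, C (L (Pi.single j 1) i) * X j) (n := 1) fun i =>
    IsHomogeneous.sum _ _ _ fun j _ => by
      simpa using (isHomogeneous_C (Fin m) (L (Pi.single j 1) i)).mul (isHomogeneous_X ℂ j)
  rwa [one_mul] at this

theorem eval_pderiv_eq_fderiv (w : Fin m → ℂ) (i : Fin m) :
    MvPolynomial.eval w (MvPolynomial.pderiv i f) =
      fderiv ℂ (fun x => MvPolynomial.eval x f) w (Pi.single i 1) := by
  have h1 := hasDerivAt_eval_line f w i
  have hd : DifferentiableAt ℂ (fun x => MvPolynomial.eval x f) w :=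
    (AnalyticOnNhd.eval_mvPolynomial (𝕜 := ℂ) f w (Set.mem_univ _)).differentiableAt
  have h2 : HasDerivAt (fun s : ℂ => w + s • (Pi.single i 1 : Fin m → ℂ)) (Pi.single i 1) 0 := by
    simpa using ((hasDerivAt_id (0 : ℂ)).smul_const (Pi.single i (1 : ℂ) : Fin m → ℂ)).const_add w
  have h3 := HasFDerivAt.comp_hasDerivAt_of_eq (0 : ℂ) hd.hasFDerivAt h2 (by simp)
  exact h1.unique h3

/-- With `L` the derivative of `ψ`, split `F ∘ ψ - f ∘ L` into `(F - f) ∘ ψ` and `f ∘ ψ - f ∘ L`;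
both have order above `d`. Surjectivity of `L` keeps `f ∘ L` nonzero. -/
theorem HasInitialForm.comp {F : (Fin m → ℂ) → ℂ} {ψ : (Fin m → ℂ) → Fin m → ℂ}
    (hF : HasInitialForm F d f) (hψ : AnalyticAt ℂ ψ 0) (hψ0 : ψ 0 = 0)
    (hL : Function.Surjective (fderiv ℂ ψ 0)) :
    HasInitialForm (F ∘ ψ) d (f.compLinear (fderiv ℂ ψ 0)) := by
  refine ⟨AnalyticAt.comp (by rw [hψ0]; exact hF.1) hψ, hF.2.1.compLinear _, fun h => ?_, ?_⟩
  · refine hF.2.2.1 (MvPolynomial.funext fun w => ?_)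
    obtain ⟨w, rfl⟩ := hL w
    rw [← MvPolynomial.eval_compLinear, h, map_zero, map_zero]
  · have hu : ψ =O[𝓝 0] fun y => y := by
      simpa [hψ0] using hψ.differentiableAt.isBigO_sub
    have h1 := hF.2.1.isBigO_eval_sub hu ((fderiv ℂ ψ 0).isBigO_id _) (hψ.isBigO_sub_fderiv hψ0)
    have ht : Tendsto ψ (𝓝 0) (𝓝 0) := by simpa [hψ0] using hψ.continuousAt.tendsto
    have h2 := (hF.2.2.2.comp_tendsto ht).trans (hu.norm_norm.pow (d + 1))
    refine (h2.add h1).congr_left fun y => ?_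
    simp [MvPolynomial.eval_compLinear]

end CoordinateChange

/-! ### Linear invariance of smoothness and hyperflexes -/

section CoordinateChangeQuartic

variable {f : MvPolynomial (Fin 3) ℂ} {L : (Fin 3 → ℂ) →L[ℂ] (Fin 3 → ℂ)}

theorem IsSmoothPlaneQuartic.compLinear (hf : IsSmoothPlaneQuartic f)
    (hL : Function.Bijective L) : IsSmoothPlaneQuartic (f.compLinear L) := by
  refine ⟨hf.1.compLinear L, fun h => ?_, fun x hx0 hx => ?_⟩
  · refine hf.2.1 (MvPolynomial.funext fun w => ?_)
    obtain ⟨w, rfl⟩ := hL.2 w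
    rw [← MvPolynomial.eval_compLinear, h, map_zero, map_zero]
  · rw [MvPolynomial.eval_compLinear] at hx
    obtain ⟨i, hi⟩ := hf.2.2 (L x) (fun h => hx0 (hL.1 (by rw [h, map_zero]))) hx
    by_contra! hall
    refine hi ?_
    have hd : DifferentiableAt ℂ (fun x => MvPolynomial.eval x f) (L x) :=
      (AnalyticOnNhd.eval_mvPolynomial (𝕜 := ℂ) f _ (Set.mem_univ _)).differentiableAt
    have hcomp : fderiv ℂ (fun x => MvPolynomial.eval x (f.compLinear L)) x =
        (fderiv ℂ (fun x => MvPolynomial.eval x f) (L x)).comp L := by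
      simp only [MvPolynomial.eval_compLinear]
      exact (hd.hasFDerivAt.comp x L.hasFDerivAt).fderiv
    have hzero : fderiv ℂ (fun x => MvPolynomial.eval x (f.compLinear L)) x = 0 := by
      ext w
      rw [← Finset.univ_sum_single w, map_sum]
      refine Finset.sum_eq_zero fun j _ => ?_
      rw [show (Pi.single j (w j) : Fin 3 → ℂ) = w j • Pi.single j 1 by
        rw [← Pi.single_smul, smul_eq_mul, mul_one], map_smul, ← eval_pderiv_eq_fderiv, hall,
        smul_zero]
    obtain ⟨v, hv⟩ := hL.2 (Pi.single i 1)
    rw [eval_pderiv_eq_fderiv, ← hv, ← ContinuousLinearMap.comp_apply, ← hcomp, hzero,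
      zero_apply]

theorem HasHyperflex.of_compLinear (h : HasHyperflex (f.compLinear L))
    (hL : Function.Injective L) : HasHyperflex f := by
  obtain ⟨p, q, hpq, hdvd⟩ := h
  refine ⟨L p, L q, ?_, ?_⟩
  · rw [LinearIndependent.pair_iff] at hpq ⊢
    intro s t hst
    refine hpq s t (hL ?_)
    rw [map_add, map_smul, map_smul, hst, map_zero]
  · convert hdvd using 1
    refine Polynomial.funext fun x => ?_
    rw [eval_aeval_line, eval_aeval_line, MvPolynomial.eval_compLinear, map_add, map_smul]

theorem IsAnalyticCoordChange.bijective_fderiv_symm {E : Type*} [NormedAddCommGroup E]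
    [NormedSpace ℂ E] {φ : OpenPartialHomeomorph E E} (hφ : IsAnalyticCoordChange φ) :
    Function.Bijective (fderiv ℂ φ.symm 0) := by
  obtain ⟨hs, h0, hφa, hψa⟩ := hφ
  have ht : (0 : E) ∈ φ.target := h0 ▸ φ.map_source hs
  have hψ0 : φ.symm 0 = 0 := by simpa [h0] using φ.left_inv hs
  have h1 : HasFDerivAt (φ ∘ φ.symm) ((fderiv ℂ φ 0).comp (fderiv ℂ φ.symm 0)) 0 :=
    HasFDerivAt.comp 0 (by rw [hψ0]; exact hφa.differentiableAt.hasFDerivAt)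
      hψa.differentiableAt.hasFDerivAt
  have h2 : HasFDerivAt (φ.symm ∘ φ) ((fderiv ℂ φ.symm 0).comp (fderiv ℂ φ 0)) 0 :=
    HasFDerivAt.comp 0 (by rw [h0]; exact hψa.differentiableAt.hasFDerivAt)
      hφa.differentiableAt.hasFDerivAt
  have e1 := h1.unique ((hasFDerivAt_id (0 : E)).congr_of_eventuallyEq
    (φ.eventually_right_inverse ht))
  have e2 := h2.unique ((hasFDerivAt_id (0 : E)).congr_of_eventuallyEq
    (φ.eventually_left_inverse hs))
  exact Function.bijective_iff_has_inverse.2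
    ⟨fderiv ℂ φ 0, fun x => DFunLike.congr_fun e1 x, fun x => DFunLike.congr_fun e2 x⟩

/-- Near `0` the image is a preimage under the inverse chart, so the image of `F = 0` is the zero
set of `F ∘ φ.symm`. -/
theorem IsAnalyticCoordChange.coordImage_eventuallyEq {E : Type*} [NormedAddCommGroup E]
    [NormedSpace ℂ E] {φ : OpenPartialHomeomorph E E} (hφ : IsAnalyticCoordChange φ) (X : Set E) :
    coordImage φ X =ᶠ[𝓝 0] (φ.symm ⁻¹' X : Set E) := by
  have ht : (0 : E) ∈ φ.target := by simpa [hφ.2.1] using φ.map_source hφ.1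
  filter_upwards [φ.open_target.mem_nhds ht] with y hy
  refine propext ⟨?_, fun h => ⟨φ.symm y, ⟨φ.map_target hy, h⟩, φ.right_inv hy⟩⟩
  rintro ⟨x, ⟨hx, hxX⟩, rfl⟩
  change φ.symm (φ x) ∈ X
  rwa [φ.left_inv hx]

theorem isIrreducibleWithReducibleArcSections_coordImage (hf : IsSmoothPlaneQuartic f)
    (hflex : ¬ HasHyperflex f) {F : (Fin 3 → ℂ) → ℂ} (hF : HasInitialForm F 4 f)
    {φ : OpenPartialHomeomorph (Fin 3 → ℂ) (Fin 3 → ℂ)} (hφ : IsAnalyticCoordChange φ) :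
    IsIrreducibleWithReducibleArcSections (n := 2) (coordImage φ {x | F x = 0}) := by
  have hL := hφ.bijective_fderiv_symm
  have hψ0 : φ.symm 0 = 0 := by simpa [hφ.2.1] using φ.left_inv hφ.1
  exact isIrreducibleWithReducibleArcSections_of_hasInitialForm (hf.compLinear hL)
    (fun h => hflex (h.of_compLinear hL.1)) (hF.comp hφ.2.2.2 hψ0 hL.2)
    (hφ.coordImage_eventuallyEq _)

end CoordinateChangeQuartic

/-! ### The explicit quartic -/

section Example

theorem HasInitialForm.eval {m d : ℕ} {f : MvPolynomial (Fin m) ℂ} (hf : f.IsHomogeneous d)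
    (hf0 : f ≠ 0) : HasInitialForm (fun x => MvPolynomial.eval x f) d f :=
  ⟨AnalyticOnNhd.eval_mvPolynomial (𝕜 := ℂ) f 0 (Set.mem_univ _), hf, hf0, by
    simpa using isBigO_zero _ _⟩

theorem eval_exampleQuartic (x : Fin 3 → ℂ) : MvPolynomial.eval x exampleQuartic =
    x 0 ^ 4 + x 1 ^ 4 + x 0 ^ 2 * x 2 ^ 2 + x 1 * x 2 ^ 3 + x 2 ^ 4 := by
  simp [exampleQuartic]

theorem isHomogeneous_exampleQuartic : exampleQuartic.IsHomogeneous 4 := by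
  have hX := fun (i : Fin 3) (k : ℕ) => MvPolynomial.isHomogeneous_X_pow (R := ℂ) i k
  exact ((((hX 0 4).add (hX 1 4)).add ((hX 0 2).mul (hX 2 2))).add
    ((MvPolynomial.isHomogeneous_X ℂ 1).mul (hX 2 3))).add (hX 2 4)

theorem exampleQuartic_ne_zero : exampleQuartic ≠ 0 := fun h => by
  simpa [eval_exampleQuartic] using congrArg (MvPolynomial.eval ![1, 0, 0]) h

theorem isSmoothPlaneQuartic_exampleQuartic : IsSmoothPlaneQuartic exampleQuartic := by
  refine ⟨isHomogeneous_exampleQuartic, exampleQuartic_ne_zero, fun v hv _ => ?_⟩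
  by_contra! h
  have h0 := h 0
  have h1 := h 1
  have h2 := h 2
  simp only [exampleQuartic, map_add, Derivation.leibniz, Derivation.leibniz_pow,
    MvPolynomial.pderiv_X, Pi.single_apply, smul_eq_mul] at h0 h1 h2
  norm_num [show (2 : Fin 3) ≠ 0 by decide, show (0 : Fin 3) ≠ 2 by decide,
    show (2 : Fin 3) ≠ 1 by decide, show (1 : Fin 3) ≠ 2 by decide] at h0 h1 h2
  obtain ⟨x, hx⟩ : ∃ x, v 0 = x := ⟨_, rfl⟩
  obtain ⟨y, hy⟩ : ∃ y, v 1 = y := ⟨_, rfl⟩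
  obtain ⟨z, hz⟩ : ∃ z, v 2 = z := ⟨_, rfl⟩
  simp only [hx, hy, hz] at h0 h1 h2
  have hz0 : z = 0 := by
    rcases eq_or_ne x 0 with rfl | hx0
    · by_contra hz0
      have e : 3 * y + 4 * z = 0 := by
        have : z ^ 2 * (3 * y + 4 * z) = 0 := by linear_combination h2
        exact (mul_eq_zero.1 this).resolve_left (pow_ne_zero _ hz0)
      have : z ^ 3 = 0 := by
        have hy : y = -4 / 3 * z := by linear_combination e / 3
        rw [hy] at h1
        linear_combination -27 / 229 * h1
      exact hz0 (by simpa using this)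
    · by_contra hz0
      have e : z ^ 2 = -2 * x ^ 2 := by
        have : x * (z ^ 2 + 2 * x ^ 2) = 0 := by linear_combination h0 / 2
        linear_combination (mul_eq_zero.1 this).resolve_left hx0
      have e' : y = -z := by
        have : z ^ 2 * (y + z) = 0 := by linear_combination h2 / 3 - z * e / 3
        linear_combination (mul_eq_zero.1 this).resolve_left (pow_ne_zero _ hz0)
      have : z ^ 3 = 0 := by
        rw [e'] at h1
        linear_combination -h1 / 3
      exact hz0 (by simpa using this)
  subst hz0
  have hx0 : x = 0 := by simpa using h0
  have hy0 : y = 0 := by simpa using h1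
  refine hv (funext fun i => ?_)
  fin_cases i
  · exact hx.trans hx0
  · exact hy.trans hy0
  · exact hz

/-- The restriction has degree at most `d` and is divisible by `X ^ d`, hence is a monomial.
Homogeneity extends this to all `a ≠ 0`, and continuity to `a = 0`. -/
theorem exists_eval_eq_const_mul_pow {m d : ℕ} {f : MvPolynomial (Fin m) ℂ}
    (hf : f.IsHomogeneous d) {p q : Fin m → ℂ}
    (h : (Polynomial.X : Polynomial ℂ) ^ d ∣
      MvPolynomial.aeval (fun i => Polynomial.C (p i) + Polynomial.C (q i) * Polynomial.X) f) :
    ∃ c : ℂ, ∀ a b : ℂ, MvPolynomial.eval (a • p + b • q) f = c * b ^ d := by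
  set P := MvPolynomial.aeval (fun i => Polynomial.C (p i) + Polynomial.C (q i) * Polynomial.X) f
    with hP
  have hdeg : P.natDegree ≤ d := by
    have := MvPolynomial.aeval_natDegree_le (n := 1) f hf.totalDegree_le
      (fun i => Polynomial.C (p i) + Polynomial.C (q i) * Polynomial.X)
      (fun i => by compute_degree)
    rwa [mul_one] at this
  have hPc : P = Polynomial.C (P.coeff d) * Polynomial.X ^ d := by
    ext k
    rw [Polynomial.coeff_C_mul_X_pow]
    split_ifs with hk
    · rw [hk]
    · rcases lt_or_gt_of_ne hk with hk | hk
      · exact Polynomial.X_pow_dvd_iff.1 h k hk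
      · exact Polynomial.coeff_eq_zero_of_natDegree_lt (hdeg.trans_lt hk)
  refine ⟨P.coeff d, fun a b => ?_⟩
  have hcont : Continuous fun a : ℂ => MvPolynomial.eval (a • p + b • q) f :=
    f.continuous_eval.comp (by fun_prop)
  refine congrFun (hcont.ext_on (dense_compl_singleton (0 : ℂ)) continuous_const
    fun a ha => ?_) a
  have ha : a ≠ 0 := ha
  have := congrArg (Polynomial.eval (a⁻¹ * b)) hPc
  rw [hP, eval_aeval_line, ← hP, Polynomial.eval_mul, Polynomial.eval_C, Polynomial.eval_pow,
    Polynomial.eval_X] at this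
  change MvPolynomial.eval (a • p + b • q) f = _
  rw [show a • p + b • q = a • (p + (a⁻¹ * b) • q) by
    rw [smul_add, smul_smul, mul_inv_cancel_left₀ ha], eval_smul_of_isHomogeneous hf, this,
    mul_left_comm, ← mul_pow, mul_inv_cancel_left₀ ha]

theorem binary_quartic_coeff_eq {A₀ A₁ A₂ A₃ A₄ c μ ν : ℂ}
    (h : ∀ x z : ℂ, A₀ * x ^ 4 + A₁ * x ^ 3 * z + A₂ * x ^ 2 * z ^ 2 + A₃ * x * z ^ 3 + A₄ * z ^ 4 =
      c * (μ * x + ν * z) ^ 4) :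
    A₀ = c * μ ^ 4 ∧ A₁ = 4 * (c * μ ^ 3 * ν) ∧ A₂ = 6 * (c * μ ^ 2 * ν ^ 2) ∧
      A₃ = 4 * (c * μ * ν ^ 3) ∧ A₄ = c * ν ^ 4 := by
  have e0 : A₀ = c * μ ^ 4 := by linear_combination h 1 0
  have e4 : A₄ = c * ν ^ 4 := by linear_combination h 0 1
  have e2 : A₂ = 6 * (c * μ ^ 2 * ν ^ 2) := by
    linear_combination (h 1 1) / 2 + (h 1 (-1)) / 2 - e0 - e4
  have e3 : A₃ = 4 * (c * μ * ν ^ 3) := by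
    linear_combination (h 1 2 - e0 - 4 * e2 - 16 * e4 - h 1 1 + h 1 (-1)) / 6
  have e1 : A₁ = 4 * (c * μ ^ 3 * ν) := by linear_combination (h 1 1) / 2 - (h 1 (-1)) / 2 - e3
  exact ⟨e0, e1, e2, e3, e4⟩

/-- The restriction of the quartic to a line `y = m x + n z` is not a fourth power. -/
theorem exampleQuartic_restrict_ne {m n c μ ν : ℂ}
    (h : ∀ x z : ℂ, x ^ 4 + (m * x + n * z) ^ 4 + x ^ 2 * z ^ 2 + (m * x + n * z) * z ^ 3 + z ^ 4 =
      c * (μ * x + ν * z) ^ 4) : False := by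
  obtain ⟨h0, h1, h2, h3, h4⟩ := binary_quartic_coeff_eq (A₀ := 1 + m ^ 4) (A₁ := 4 * m ^ 3 * n)
    (A₂ := 6 * m ^ 2 * n ^ 2 + 1) (A₃ := 4 * m * n ^ 3 + m) (A₄ := n ^ 4 + n + 1) (c := c) (μ := μ)
    (ν := ν) fun x z => by linear_combination h x z
  obtain ⟨w, hw⟩ : ∃ w, w = m ^ 2 * n ^ 2 := ⟨_, rfl⟩
  obtain ⟨k, hk⟩ : ∃ k, k = m ^ 4 := ⟨_, rfl⟩
  have h1' : m ^ 3 * n = c * μ ^ 3 * ν := by linear_combination h1 / 4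
  have hkw : k * n ^ 4 = w ^ 2 := by rw [hw, hk]; ring
  -- The coefficients of a fourth power satisfy `8 * A₀ * A₂ = 3 * A₁ ^ 2`, `9 * A₁ * A₃ = 4 * A₂ ^
  -- 2` and `36 * A₀ * A₄ = A₂ ^ 2`; these relations eliminate `c`, `μ` and `ν`.
  have e1 : 6 * w + 1 + k = 0 := by
    have : (1 + m ^ 4) * (6 * m ^ 2 * n ^ 2 + 1) = 6 * (m ^ 3 * n) ^ 2 := by
      rw [h0, h2, h1']; ring
    rw [hw, hk]
    linear_combination this
  have e2 : 9 * k * n = 12 * w + 1 := by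
    have : 9 * (m ^ 3 * n) * (4 * m * n ^ 3 + m) = (6 * m ^ 2 * n ^ 2 + 1) ^ 2 := by
      rw [h2, h3, h1']; ring
    rw [hw, hk]
    linear_combination this
  have e3 : -216 * w * (n ^ 4 + n + 1) = (6 * w + 1) ^ 2 := by
    have : 36 * (1 + m ^ 4) * (n ^ 4 + n + 1) = (6 * m ^ 2 * n ^ 2 + 1) ^ 2 := by
      rw [h0, h2, h4]; ring
    rw [show (6 * w + 1) ^ 2 = (6 * m ^ 2 * n ^ 2 + 1) ^ 2 by rw [hw]; ring, ← this, ← hk]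
    linear_combination -36 * (n ^ 4 + n + 1) * e1
  -- Multiplying `e3` by `k` makes `n` enter only through `k * n ^ 4` and `k * n`, both known in
  -- terms of `w`; the cubic terms then cancel.
  have hQ : 1116 * w ^ 2 + 210 * w + 1 = 0 := by
    linear_combination k * e3 + 216 * w * hkw + 24 * w * e2 + (216 * w + (6 * w + 1) ^ 2) * e1
  have hR : 6561 * w ^ 2 * (6 * w + 1) ^ 3 + (12 * w + 1) ^ 4 = 0 := by
    have : (9 * k * n) ^ 4 = (12 * w + 1) ^ 4 := by rw [e2]
    linear_combination -this + 6561 * k ^ 3 * hkw +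
      6561 * w ^ 2 * ((6 * w + 1) ^ 2 - (6 * w + 1) * k + k ^ 2) * e1
  refine one_ne_zero (α := ℂ) ?_
  -- A Bézout identity: the polynomials in `hQ` and `hR` are coprime, so `w` cannot be a common
  -- root.
  linear_combination ((-72113999 - 28479163146 * w - 434155014504 * w ^ 2 -
    2073310282224 * w ^ 3 - 3007700023536 * w ^ 4) / 787356721) * hQ +
    ((859470720 + 2368508376 * w) / 787356721) * hR

/-- If the restriction of the quartic to a line through `[0 : 1 : 0]` is a fourth power, then the
other points of the line are trivial. -/
theorem exampleQuartic_restrict_pencil {s t c κ l : ℂ}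
    (h : ∀ x y : ℂ, (x * s) ^ 4 + y ^ 4 + (x * s) ^ 2 * (x * t) ^ 2 + y * (x * t) ^ 3 +
      (x * t) ^ 4 = c * (κ * x + l * y) ^ 4) : s = 0 ∧ t = 0 := by
  obtain ⟨h0, h1, -, h3, h4⟩ := binary_quartic_coeff_eq (A₀ := s ^ 4 + s ^ 2 * t ^ 2 + t ^ 4)
    (A₁ := t ^ 3) (A₂ := 0) (A₃ := 0) (A₄ := 1) (c := c) (μ := κ)
    (ν := l) fun x z => by linear_combination h x z
  have hc : c ≠ 0 := by rintro rfl; simp at h4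
  have hl : l ≠ 0 := by rintro rfl; simp at h4
  have hκ : κ = 0 := by simpa [hc, hl] using h3.symm
  have ht : t = 0 := by simpa [hκ] using h1
  exact ⟨by simpa [hκ, ht] using h0, ht⟩

theorem not_hasHyperflex_exampleQuartic : ¬ HasHyperflex exampleQuartic := by
  rintro ⟨p, q, hpq, hdvd⟩
  obtain ⟨c, hc⟩ := exists_eval_eq_const_mul_pow isHomogeneous_exampleQuartic hdvd
  simp only [eval_exampleQuartic, Pi.add_apply, Pi.smul_apply, smul_eq_mul] at hc
  rw [LinearIndependent.pair_iff] at hpq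
  have hne : ¬ (p 0 = 0 ∧ p 2 = 0 ∧ q 0 = 0 ∧ q 2 = 0) := by
    rintro ⟨hp0, hp2, hq0, hq2⟩
    obtain ⟨-, hp1⟩ := hpq (q 1) (-p 1) (by
      ext i
      fin_cases i <;> simp [hp0, hp2, hq0, hq2]
      ring)
    have hp : p = 0 := by
      ext i
      fin_cases i
      · exact hp0
      · simpa using hp1
      · exact hp2
    exact one_ne_zero (hpq 1 0 (by simp [hp])).1
  -- The determinant vanishes exactly when the line passes through `[0 : 1 : 0]`; otherwise the line
  -- is a graph `y = m x + n z`.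
  rcases eq_or_ne (p 0 * q 2 - p 2 * q 0) 0 with hD | hD
  · obtain ⟨ρ, σ, h0, h1, h2⟩ : ∃ ρ σ : ℂ, ρ * p 0 + σ * q 0 = 0 ∧ ρ * p 1 + σ * q 1 = 1 ∧
        ρ * p 2 + σ * q 2 = 0 := by
      by_contra! hno
      have key : ∀ a b : ℂ, a * p 0 + b * q 0 = 0 → a * p 2 + b * q 2 = 0 → a = 0 ∧ b = 0 := by
        intro a b ha hb
        refine hpq a b (funext fun i => ?_)
        have h1 : a * p 1 + b * q 1 = 0 := by
          by_contra h1
          refine hno ((a * p 1 + b * q 1)⁻¹ * a) ((a * p 1 + b * q 1)⁻¹ * b) ?_ ?_ ?_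
          · linear_combination (a * p 1 + b * q 1)⁻¹ * ha
          · linear_combination inv_mul_cancel₀ h1
          · linear_combination (a * p 1 + b * q 1)⁻¹ * hb
        fin_cases i
        · exact ha
        · exact h1
        · exact hb
      obtain ⟨k1, k2⟩ := key (q 0) (-p 0) (by ring) (by linear_combination -hD)
      obtain ⟨k3, k4⟩ := key (q 2) (-p 2) (by linear_combination hD) (by ring)
      exact hne ⟨neg_eq_zero.1 k2, neg_eq_zero.1 k4, k1, k3⟩
    -- Since `ρ • p + σ • q` is `(0, 1, 0)`, adding `y - x * p 1` times it to `x • p` gives the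
    -- point `(x * p 0, y, x * p 2)`. The same device is then used with `q` in place of `p`.
    obtain ⟨hp0, hp2⟩ := exampleQuartic_restrict_pencil (s := p 0) (t := p 2) (c := c)
      (κ := -p 1 * σ) (l := σ) fun x y => by
        have := hc (x + (y - x * p 1) * ρ) ((y - x * p 1) * σ)
        rw [show (x + (y - x * p 1) * ρ) * p 0 + (y - x * p 1) * σ * q 0 = x * p 0 by
            linear_combination (y - x * p 1) * h0,
          show (x + (y - x * p 1) * ρ) * p 1 + (y - x * p 1) * σ * q 1 = y by
            linear_combination (y - x * p 1) * h1,
          show (x + (y - x * p 1) * ρ) * p 2 + (y - x * p 1) * σ * q 2 = x * p 2 by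
            linear_combination (y - x * p 1) * h2] at this
        linear_combination this
    obtain ⟨hq0, hq2⟩ := exampleQuartic_restrict_pencil (s := q 0) (t := q 2) (c := c)
      (κ := 1 - q 1 * σ) (l := σ) fun x y => by
        have := hc ((y - x * q 1) * ρ) (x + (y - x * q 1) * σ)
        rw [show (y - x * q 1) * ρ * p 0 + (x + (y - x * q 1) * σ) * q 0 = x * q 0 by
            linear_combination (y - x * q 1) * h0,
          show (y - x * q 1) * ρ * p 1 + (x + (y - x * q 1) * σ) * q 1 = y by
            linear_combination (y - x * q 1) * h1,
          show (y - x * q 1) * ρ * p 2 + (x + (y - x * q 1) * σ) * q 2 = x * q 2 by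
            linear_combination (y - x * q 1) * h2] at this
        linear_combination this
    exact hne ⟨hp0, hp2, hq0, hq2⟩
  -- Cramer's rule gives the combination of `p` and `q` with prescribed outer coordinates `x` and
  -- `z`. Its middle coordinate defines `m` and `n`, and its coefficient of `q` defines `μ` and `ν`.
  · obtain ⟨e, he⟩ : ∃ e, (p 0 * q 2 - p 2 * q 0) * e = 1 := ⟨_, mul_inv_cancel₀ hD⟩
    refine exampleQuartic_restrict_ne (m := (q 2 * p 1 - p 2 * q 1) * e)
      (n := (p 0 * q 1 - q 0 * p 1) * e) (c := c) (μ := -p 2 * e) (ν := p 0 * e) fun x z => ?_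
    have := hc ((x * q 2 - z * q 0) * e) ((-x * p 2 + z * p 0) * e)
    rw [show (x * q 2 - z * q 0) * e * p 0 + (-x * p 2 + z * p 0) * e * q 0 = x by
        linear_combination x * he,
      show (x * q 2 - z * q 0) * e * p 2 + (-x * p 2 + z * p 0) * e * q 2 = z by
        linear_combination z * he] at this
    linear_combination this

end Example

theorem mainTheorem1 :
    -- there are irreducible hypersurface germs with all arc-sections reducible, and this persists
    -- after every analytic change of coordinates
    (∃ X : Set (Fin 3 → ℂ), IsIrreducibleWithReducibleArcSections (n := 2) X ∧
      ∀ φ : OpenPartialHomeomorph (Fin 3 → ℂ) (Fin 3 → ℂ), IsAnalyticCoordChange φ →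
        IsIrreducibleWithReducibleArcSections (n := 2) (coordImage φ X)) ∧
    -- every surface germ whose tangent cone is a smooth plane quartic without hyperflexes is one
    (∀ f : MvPolynomial (Fin 3) ℂ, IsSmoothPlaneQuartic f → ¬ HasHyperflex f →
      ∀ F : (Fin 3 → ℂ) → ℂ, HasInitialForm F 4 f →
        IsIrreducibleWithReducibleArcSections (n := 2) {x | F x = 0} ∧
        ∀ φ : OpenPartialHomeomorph (Fin 3 → ℂ) (Fin 3 → ℂ), IsAnalyticCoordChange φ →
          IsIrreducibleWithReducibleArcSections (n := 2) (coordImage φ {x | F x = 0})) ∧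
    -- the explicit quartic is smooth without hyperflexes, and its affine cone is an example
    (IsSmoothPlaneQuartic exampleQuartic ∧ ¬ HasHyperflex exampleQuartic ∧
      IsIrreducibleWithReducibleArcSections (n := 2)
        {x : Fin 3 → ℂ | x 0 ^ 4 + x 1 ^ 4 + x 0 ^ 2 * x 2 ^ 2 + x 1 * x 2 ^ 3 + x 2 ^ 4 = 0} ∧
      ∀ φ : OpenPartialHomeomorph (Fin 3 → ℂ) (Fin 3 → ℂ), IsAnalyticCoordChange φ →
        IsIrreducibleWithReducibleArcSections (n := 2) (coordImage φ
          {x : Fin 3 → ℂ |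
            x 0 ^ 4 + x 1 ^ 4 + x 0 ^ 2 * x 2 ^ 2 + x 1 * x 2 ^ 3 + x 2 ^ 4 = 0})) := by
  have quartic : ∀ f : MvPolynomial (Fin 3) ℂ, IsSmoothPlaneQuartic f → ¬ HasHyperflex f →
      ∀ F : (Fin 3 → ℂ) → ℂ, HasInitialForm F 4 f →
        IsIrreducibleWithReducibleArcSections (n := 2) {x | F x = 0} ∧
        ∀ φ : OpenPartialHomeomorph (Fin 3 → ℂ) (Fin 3 → ℂ), IsAnalyticCoordChange φ →
          IsIrreducibleWithReducibleArcSections (n := 2) (coordImage φ {x | F x = 0}) :=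
    fun f hf hflex F hF =>
      ⟨isIrreducibleWithReducibleArcSections_of_hasInitialForm hf hflex hF (.refl _ _),
        fun φ hφ => isIrreducibleWithReducibleArcSections_coordImage hf hflex hF hφ⟩
  have cone := quartic _ isSmoothPlaneQuartic_exampleQuartic not_hasHyperflex_exampleQuartic _
    (.eval isHomogeneous_exampleQuartic exampleQuartic_ne_zero)
  simp only [eval_exampleQuartic] at cone
  exact ⟨⟨_, cone⟩, quartic, isSmoothPlaneQuartic_exampleQuartic,
    not_hasHyperflex_exampleQuartic, cone⟩
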